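/- **Setup.** Let $p$ be a prime, $\kappa$ a perfect field of characteristic $p$, $O_F = W(\kappa)$, $d \ge 0$, and let $R$ be the $p$-adic completion of an étale algebra over $R^{\square} = O_F\langle X_1^{\pm 1}, \ldots, X_d^{\pm 1}\rangle$ (the $p$-adic completion of $O_F[X_1^{\pm1},\dots,X_d^{\pm1}]$) such that $\operatorname{Spec}(R/pR)$ is non-empty and connected. Let $\varphi : R \to R$ be the unique lift of the absolute Frobenius of $R/p$ which extends the Witt vector Frobenius on $O_F$ and satisfies $\varphi(X_i) = X_i^p$. *The ring $A_R$.* Let $A_R = R[[\mu]]$, put $q = 1+\mu$, and write $[X_i^\flat]$ for $X_i \in R \subset A_R$. The Frobenius $\varphi$ of $A_R$ extends the one of $R$ by $\varphi(q) = q^p$. Let $[p]_q = \varphi(\mu)/\mu = 1 + q + \cdots + q^{p-1}$. The group $\Gamma_R = \mathbb{Z}_p(1)^d \rtimes \mathbb{Z}_p^\times$ acts on $A_R$: for $g = (b,a)$, with $b \in \mathbb{Z}_p^d$ and $a = \chi(g) \in \mathbb{Z}_p^\times$, one has $g(q) = q^{a}$, and on $R$ the map $g$ is the unique $O_F$-algebra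 homomorphism $R \to R[[\mu]]$ which is the identity modulo $\mu$ and sends $X_i$ to $q^{b_i} X_i$. *The ring $A_R(1)$.* Let $B = A_R \widehat{\otimes}_{O_F} A_R$ be the $(p, \mu \otimes 1)$-adic completion of $A_R \otimes_{O_F} A_R$, with the tensor product Frobenius. Let $J \subset B$ be the kernel of the surjection $B \to A_R/[p]_q \otimes_R A_R/[p]_q$, where $A_R/[p]_q$ is an $R$-algebra via $\varphi$; that is, $J$ is generated by $[p]_q \otimes 1$, $1 \otimes [p]_q$ and the elements $\varphi(r) \otimes 1 - 1 \otimes \varphi(r)$ for $r \in R$. Let $E$ be the smallest $B$-subalgebra of $B\big[\tfrac1p, \tfrac{1}{\varphi^n([p]_q \otimes 1)} : n \in \mathbb{N}\big]$ which contains $\tfrac{j}{[p]_q \otimes 1}$ for all $j \in J$ and is stable under $\delta(x) = (\varphi(x) - x^p)/p$, and let $A_R(1)$ be the $(p, \mu \otimes 1)$-adic completion of $E$ (this is the prismatic envelope of $(B, J)$ over the prism $(A_R, [p]_q)$, i.e. the self-product of $(A_R,[p]_q)$ in the prismatic site of $\operatorname{Spf} R$). Let $p_1, p_2 : A_R \to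 A_R(1)$ be the maps induced by $a \mapsto a \otimes 1$ and $a \mapsto 1 \otimes a$. The Frobenius of $B$ and the action of $1 \times \Gamma_R$ on $B$ (through the second factor) induce a Frobenius and an action of $\Gamma_R$ on $A_R(1)$ and on $A_R(1)/p_1(\mu)$. We regard $A_R(1)/p_1(\mu)$ as an $A_R$-algebra via $p_2$. *The divided power algebra.* Let $P = A_R\big[\prod_{\mathbf{k}\in\mathbb{N}^{d+1}} (\mu^{p-1}/p)^{[k_0]} T_1^{[k_1]} \cdots T_d^{[k_d]}\big]$ be the $A_R$-subalgebra of $A_R[1/p][T_1, \ldots, T_d]$ generated by the elements $\frac{(\mu^{p-1}/p)^{k}}{k!}$ and $\frac{T_i^{k}}{k!}$ for $k \in \mathbb{N}$, $1 \le i \le d$. The Frobenius and the $\Gamma_R$-action on $A_R$ extend to $P$ by $\varphi([X_i^\flat] - T_i) = ([X_i^\flat] - T_i)^p$ and $g(T_i) = g([X_i^\flat]) - [X_i^\flat] + T_i$ for $g \in \Gamma_R$ (so $\gamma_i(T_i) = \mu [X_i^\flat] + T_i$ and $\gamma_j(T_i) = T_i$ for $j \ne i$, where $\gamma_j$ is the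 $j$-th standard generator of $\mathbb{Z}_p(1)^d$). Let $P_p^\wedge$ be the $p$-adic completion of $P$, with the induced structures. **Proposition.** The rings $A_R(1)/p_1(\mu)$ and $P_p^\wedge$ are $p$-adically complete and $p$-torsion free, and there is an isomorphism of $A_R$-algebras $$\alpha : A_R(1)/p_1(\mu) \xrightarrow{\ \sim\ } A_R\Big[\textstyle\prod_{\mathbf{k}\in\mathbb{N}^{d+1}} (\mu^{p-1}/p)^{[k_0]} T_1^{[k_1]} \cdots T_d^{[k_d]}\Big]_p^\wedge$$ which is equivariant for $\varphi$ and for $\Gamma_R$. It satisfies $p_2(\mu) \mapsto \mu$, $p_2([X_i^\flat]) \mapsto [X_i^\flat]$ and $p_1([X_i^\flat]) \mapsto [X_i^\flat] - T_i$ for $1 \le i \le d$. -/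

import Mathlib

open scoped TensorProduct

set_option linter.unusedSectionVars false

noncomputable section

universe u v

namespace WachPrism

/-! ### Adic completions of rings -/

section Adic

variable {A B T : Type*} [CommRing A] [CommRing B] [CommRing T]

/-- The ring homomorphism `A / I ^ n → B / J ^ n` induced by `f`, composed with the projection. -/
def adicMapAux (I : Ideal A) (J : Ideal B) (f : A →+* B) (h : I.map f ≤ J) (n : ℕ) :
    AdicCompletion I A →+* B ⧸ J ^ n :=
  (Ideal.quotientMap (J ^ n) f (by
      rw [← Ideal.map_le_iff_le_comap, Ideal.map_pow]
      exact Ideal.pow_right_mono h n)).comp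
    (AdicCompletion.evalₐ I n : AdicCompletion I A →+* A ⧸ I ^ n)

theorem adicMapAux_compat (I : Ideal A) (J : Ideal B) (f : A →+* B) (h : I.map f ≤ J)
    {m n : ℕ} (hle : m ≤ n) :
    (Ideal.Quotient.factorPow J hle).comp (adicMapAux I J f h n) = adicMapAux I J f h m := by
  ext x
  induction x using AdicCompletion.induction_on with
  | _ r =>
    have hr : Ideal.Quotient.mk (I ^ m) (r.val n) = Ideal.Quotient.mk (I ^ m) (r.val m) :=
      AdicCompletion.Ideal.mk_eq_mk I hle r
    have h1 : f (r.val n) - f (r.val m) ∈ J ^ m := by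
      rw [← map_sub]
      refine (Ideal.pow_right_mono h m) ?_
      rw [← Ideal.map_pow]
      exact Ideal.mem_map_of_mem f (Ideal.Quotient.eq.mp hr)
    simpa [adicMapAux] using Ideal.Quotient.eq.mpr h1

/-- The ring homomorphism between adic completions induced by a ring homomorphism
`f : A → B` with `f(I) ⊆ J`. -/
def adicMap (I : Ideal A) (J : Ideal B) (f : A →+* B) (h : I.map f ≤ J) :
    AdicCompletion I A →+* AdicCompletion J B :=
  AdicCompletion.liftRingHom J (adicMapAux I J f h) (adicMapAux_compat I J f h)

@[simp]
theorem adicMap_of (I : Ideal A) (J : Ideal B) (f : A →+* B) (h : I.map f ≤ J) (a : A) :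
    adicMap I J f h (AdicCompletion.of I A a) = AdicCompletion.of J B (f a) := by
  refine AdicCompletion.ext_evalₐ (I := J) (fun n => ?_)
  rw [adicMap, AdicCompletion.evalₐ_liftRingHom J _ (adicMapAux_compat I J f h)]
  simp [adicMapAux]

/-- The extension of a ring homomorphism `f : A → T` with `f(I) ⊆ J` to the `I`-adic completion
of `A`, for a `J`-adically complete ring `T`. -/
def adicExtend (I : Ideal A) (J : Ideal T) [IsAdicComplete J T] (f : A →+* T)
    (h : I.map f ≤ J) : AdicCompletion I A →+* T :=
  ((AdicCompletion.ofAlgEquiv J).symm : AdicCompletion J T →+* T).comp (adicMap I J f h)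

@[simp]
theorem adicExtend_of (I : Ideal A) (J : Ideal T) [IsAdicComplete J T] (f : A →+* T)
    (h : I.map f ≤ J) (a : A) : adicExtend I J f h (AdicCompletion.of I A a) = f a := by
  simp [adicExtend]

/-- The completion at a finitely generated ideal is complete. -/
theorem isAdicComplete_map {I : Ideal A} (hI : I.FG) :
    IsAdicComplete (I.map (algebraMap A (AdicCompletion I A))) (AdicCompletion I A) :=
  (IsAdicComplete.map_algebraMap_iff _ _).mpr (AdicCompletion.isAdicComplete hI)

instance isAdicComplete_natCast (p : ℕ) :
    IsAdicComplete (Ideal.span {(p : AdicCompletion (Ideal.span {(p : A)}) A)})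
      (AdicCompletion (Ideal.span {(p : A)}) A) := by
  have := isAdicComplete_map (A := A) (I := Ideal.span {(p : A)}) ⟨{(p : A)}, by simp⟩
  rwa [Ideal.map_span, Set.image_singleton, map_natCast] at this

/-- Two ring homomorphisms out of the completion at a finitely generated ideal `I`, sending `I`
into an ideal for which the target is separated, agree if they agree on `A`. -/
theorem adic_hom_ext {I : Ideal A} (hI : I.FG) (J : Ideal T) [IsHausdorff J T]
    (f g : AdicCompletion I A →+* T)
    (hf : ∀ a ∈ I, f (AdicCompletion.of I A a) ∈ J)
    (h : ∀ a, f (AdicCompletion.of I A a) = g (AdicCompletion.of I A a)) : f = g := by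
  have hmap : ∀ F : AdicCompletion I A →+* T, (∀ a ∈ I, F (AdicCompletion.of I A a) ∈ J) →
      (I.map (algebraMap A (AdicCompletion I A))).map F ≤ J := by
    intro F hF
    rw [Ideal.map_map, Ideal.map_le_iff_le_comap]
    exact fun a ha => hF a ha
  refine RingHom.ext fun x => ?_
  have key : ∀ n, f x - g x ∈ J ^ n := by
    intro n
    obtain ⟨a, ha⟩ := Ideal.Quotient.mk_surjective (AdicCompletion.evalₐ I n x)
    have hx : x - AdicCompletion.of I A a ∈
        (I.map (algebraMap A (AdicCompletion I A))) ^ n := by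
      have h0 : x - AdicCompletion.of I A a ∈ (AdicCompletion.eval I A n).ker := by
        rw [LinearMap.mem_ker, ← AdicCompletion.factor_evalₐ_eq_eval I _
          (le_of_eq (Ideal.mul_top _).symm), map_sub, AdicCompletion.evalₐ_of, ← ha, sub_self,
          map_zero]
      rw [← AdicCompletion.pow_smul_top_eq_ker_eval hI, Ideal.smul_top_eq_map] at h0
      rw [← Ideal.map_pow]
      exact h0
    have e : f x - g x = f (x - AdicCompletion.of I A a) - g (x - AdicCompletion.of I A a) := by
      simp [h]
    rw [e]
    refine Ideal.sub_mem _ ?_ ?_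
    · refine Ideal.pow_right_mono (hmap f hf) n ?_
      rw [← Ideal.map_pow]
      exact Ideal.mem_map_of_mem f hx
    · refine Ideal.pow_right_mono (hmap g fun a ha => h a ▸ hf a ha) n ?_
      rw [← Ideal.map_pow]
      exact Ideal.mem_map_of_mem g hx
  refine sub_eq_zero.mp (IsHausdorff.haus (I := J) inferInstance _ fun n => ?_)
  rw [SModEq.zero]
  simpa using key n

/-- Lifting along formally smooth maps into adically complete rings. -/
theorem exists_lift {P S : Type*} [CommRing P] [CommRing S] [Algebra P S]
    [Algebra.FormallySmooth P S] (I : Ideal T) [IsAdicComplete I T] (f : P →+* T)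
    (s : S →+* T ⧸ I) (h : ∀ a, s (algebraMap P S a) = Ideal.Quotient.mk I (f a)) :
    ∃ F : S →+* T, (∀ a, F (algebraMap P S a) = f a) ∧
      ∀ x, Ideal.Quotient.mk I (F x) = s x := by
  let := f.toAlgebra
  let s' : S →ₐ[P] T ⧸ I := { s with commutes' := h }
  obtain ⟨g, hg⟩ := Algebra.FormallySmooth.exists_mkₐ_comp_eq_of_isAdicComplete s'
  exact ⟨g, g.commutes, fun x => congr($hg x)⟩

/-- Lifts along formally unramified maps into adically separated rings are unique. -/
theorem lift_ext {P S : Type*} [CommRing P] [CommRing S] [Algebra P S]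
    [Algebra.FormallyUnramified P S] (I : Ideal T) [IsHausdorff I T] (F G : S →+* T)
    (h : ∀ a, F (algebraMap P S a) = G (algebraMap P S a))
    (hI : ∀ x, F x - G x ∈ I) : F = G := by
  let := (F.comp (algebraMap P S)).toAlgebra
  let F' : S →ₐ[P] T := { F with commutes' := fun _ => rfl }
  let G' : S →ₐ[P] T := { G with commutes' := fun a => (h a).symm }
  have : F' = G' := by
    refine Algebra.FormallyUnramified.ext_of_iInf (I := I) ?_ ?_
    · have := (IsHausdorff.iInf_pow_smul (I := I) (M := T) inferInstance)
      simpa using this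
    · intro x
      exact Ideal.Quotient.eq.mpr (hI x)
  exact RingHom.ext fun x => congr($this x)

end Adic
/-! ### Power series -/

section PowerSeriesHoms

open PowerSeries

variable {R T : Type*} [CommRing R] [CommRing T]

/-- The continuous ring homomorphism `R⟦X⟧ → T` extending `f : R → T` with `X ↦ t`, where `T` is
`J`-adically complete and `t ∈ J`; i.e. `∑ aₙ Xⁿ ↦ ∑ f(aₙ) tⁿ`. -/
def psExtend (J : Ideal T) [IsAdicComplete J T] (f : R →+* T) (t : T) (ht : t ∈ J) :
    R⟦X⟧ →+* T :=
  (adicExtend (MvPolynomial.idealOfVars Unit R) J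
    (MvPolynomial.eval₂Hom f fun _ => t) (by
      rw [MvPolynomial.idealOfVars, Ideal.map_span, Ideal.span_le]
      rintro _ ⟨_, ⟨i, rfl⟩, rfl⟩
      simpa using ht)).comp
    ((MvPowerSeries.toAdicCompletionAlgEquiv Unit R).toRingEquiv : R⟦X⟧ →+* _)

theorem psExtend_coe (J : Ideal T) [IsAdicComplete J T] (f : R →+* T) (t : T) (ht : t ∈ J)
    (q : MvPolynomial Unit R) :
    psExtend J f t ht ((q : MvPowerSeries Unit R) : R⟦X⟧) =
      MvPolynomial.eval₂Hom f (fun _ => t) q := by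
  change adicExtend _ J _ _ (MvPowerSeries.toAdicCompletion Unit R (q : MvPowerSeries Unit R)) = _
  rw [MvPowerSeries.toAdicCompletion_coe, adicExtend_of]

@[simp]
theorem psExtend_C (J : Ideal T) [IsAdicComplete J T] (f : R →+* T) (t : T) (ht : t ∈ J)
    (r : R) : psExtend J f t ht (C r) = f r := by
  have := psExtend_coe J f t ht (MvPolynomial.C r)
  rw [MvPolynomial.coe_C] at this
  simpa using! this

@[simp]
theorem psExtend_X (J : Ideal T) [IsAdicComplete J T] (f : R →+* T) (t : T) (ht : t ∈ J) :
    psExtend J f t ht (X : R⟦X⟧) = t := by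
  have := psExtend_coe J f t ht (MvPolynomial.X ())
  rw [MvPolynomial.coe_X] at this
  simpa using! this

/-- Ring homomorphisms out of `R⟦X⟧` sending `X` to a topologically nilpotent element are
determined by their values on `R` and `X`. -/
theorem ps_hom_ext (J : Ideal T) [IsHausdorff J T] (F G : R⟦X⟧ →+* T) (hX : F X ∈ J)
    (hC : ∀ r, F (C r) = G (C r)) (hFG : F X = G X) : F = G := by
  refine RingHom.ext fun x => ?_
  have hp : ∀ q : Polynomial R, F (q : R⟦X⟧) = G (q : R⟦X⟧) := by
    intro q
    have : F.comp (Polynomial.coeToPowerSeries.ringHom) =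
        G.comp (Polynomial.coeToPowerSeries.ringHom) := by
      refine Polynomial.ringHom_ext ?_ ?_
      · intro a; simpa using hC a
      · simpa using hFG
    exact congr($this q)
  refine sub_eq_zero.mp (IsHausdorff.haus (I := J) inferInstance _ fun n => ?_)
  rw [SModEq.zero]
  have hx := PowerSeries.eq_X_pow_mul_shift_add_trunc n x
  rw [hx]
  simp only [map_add, map_mul, map_pow, hp, ← hFG, add_sub_add_right_eq_sub, ← mul_sub]
  simpa using Ideal.mul_mem_right _ _ (Ideal.pow_mem_pow hX n)

/-- If `R` is complete for the principal ideal `(a)`, so is `R⟦X⟧`. -/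
theorem isAdicComplete_powerSeries (a : R) [IsAdicComplete (Ideal.span {a}) R] :
    IsAdicComplete (Ideal.span {(C a : R⟦X⟧)}) R⟦X⟧ := by
  have hdvd : ∀ (n : ℕ) (f : R⟦X⟧), f ∈ (Ideal.span {(C a : R⟦X⟧)}) ^ n ↔
      ∀ k, coeff k f ∈ (Ideal.span {a}) ^ n := by
    intro n f
    rw [Ideal.span_singleton_pow, Ideal.span_singleton_pow]
    simp only [Ideal.mem_span_singleton']
    constructor
    · rintro ⟨g, rfl⟩ k
      exact ⟨coeff k g, by rw [← map_pow, coeff_mul_C]⟩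
    · intro h
      choose g hg using h
      exact ⟨PowerSeries.mk g, by ext k; rw [← map_pow, coeff_mul_C, coeff_mk, hg]⟩
  have h1 : IsHausdorff (Ideal.span {(C a : R⟦X⟧)}) R⟦X⟧ := by
    constructor
    intro f hf
    ext k
    refine IsHausdorff.haus (I := Ideal.span {a}) inferInstance _ fun n => ?_
    have := hf n
    rw [SModEq.zero] at this ⊢
    simp only [smul_eq_mul, Ideal.mul_top] at this ⊢
    exact (hdvd n f).mp this k
  have h2 : IsPrecomplete (Ideal.span {(C a : R⟦X⟧)}) R⟦X⟧ := by
    constructor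
    intro f hf
    have h : ∀ k, ∃ L : R, ∀ n, coeff k (f n) ≡ L [SMOD (Ideal.span {a} ^ n • ⊤ : Ideal R)] := by
      intro k
      refine IsPrecomplete.prec inferInstance fun {m n} hmn => ?_
      have := hf hmn
      rw [SModEq.sub_mem] at this ⊢
      simp only [smul_eq_mul, Ideal.mul_top] at this ⊢
      simpa using (hdvd m _).mp this k
    choose L hL using h
    refine ⟨PowerSeries.mk L, fun n => ?_⟩
    rw [SModEq.sub_mem]
    simp only [smul_eq_mul, Ideal.mul_top]
    rw [hdvd]
    intro k
    have := hL k n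
    rw [SModEq.sub_mem] at this
    simpa using this
  exact { h1, h2 with }

instance isAdicComplete_powerSeries_natCast (p : ℕ) [IsAdicComplete (Ideal.span {(p : R)}) R] :
    IsAdicComplete (Ideal.span {(p : R⟦X⟧)}) R⟦X⟧ := by
  simpa using isAdicComplete_powerSeries (p : R)

end PowerSeriesHoms

/-! ### The base ring `R` and its Frobenius -/

section FrobMod

variable {Q : Type*} [CommRing Q]

/-- The absolute Frobenius `x ↦ x ^ p` of a commutative ring in which the prime `p` vanishes. -/
def absFrob (p : ℕ) [hp : Fact p.Prime] (h : (p : Q) = 0) : Q →+* Q where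
  toFun x := x ^ p
  map_one' := one_pow p
  map_mul' x y := mul_pow x y p
  map_zero' := zero_pow hp.out.ne_zero
  map_add' x y := by
    rw [add_pow_prime_eq hp.out, h]
    ring

@[simp]
theorem absFrob_apply (p : ℕ) [Fact p.Prime] (h : (p : Q) = 0) (x : Q) :
    absFrob p h x = x ^ p := rfl

theorem quot_natCast_eq_zero (A : Type*) [CommRing A] (p : ℕ) :
    ((p : A ⧸ Ideal.span {(p : A)})) = 0 := by
  rw [← map_natCast (Ideal.Quotient.mk (Ideal.span {(p : A)}))]
  exact Ideal.Quotient.eq_zero_iff_mem.mpr (Ideal.mem_span_singleton_self _)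

end FrobMod

section Base

variable (p : ℕ) [Fact p.Prime] (κ : Type u) [Field κ] [CharP κ p] (d : ℕ)

/-- The Laurent polynomial ring `W(κ)[X₁^{±1}, …, X_d^{±1}]`, as the localization of the polynomial
ring at the product of the variables. -/
abbrev Laurent : Type u :=
  Localization.Away (∏ i : Fin d, (MvPolynomial.X i : MvPolynomial (Fin d) (WittVector p κ)))

/-- The variable `Xᵢ` as a unit of the Laurent polynomial ring. -/
theorem isUnit_laurentX (i : Fin d) :
    IsUnit (algebraMap (MvPolynomial (Fin d) (WittVector p κ)) (Laurent p κ d)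
      (MvPolynomial.X i)) := by
  have h := IsLocalization.Away.algebraMap_isUnit (S := Laurent p κ d)
    (∏ i : Fin d, (MvPolynomial.X i : MvPolynomial (Fin d) (WittVector p κ)))
  rw [map_prod] at h
  exact isUnit_of_dvd_unit (Finset.dvd_prod_of_mem (fun i =>
    algebraMap (MvPolynomial (Fin d) (WittVector p κ)) (Laurent p κ d) (MvPolynomial.X i))
    (Finset.mem_univ i)) h

section LaurentLift

variable {p κ d} {T : Type*} [CommRing T]

/-- The ring homomorphism `W(κ)[X₁^{±1}, …, X_d^{±1}] → T` given by `c` on the coefficients and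
sending `Xᵢ` to the unit `xᵢ`. -/
def laurentLift (c : WittVector p κ →+* T) (x : Fin d → Tˣ) : Laurent p κ d →+* T :=
  IsLocalization.Away.lift (∏ i : Fin d, (MvPolynomial.X i))
    (g := MvPolynomial.eval₂Hom c fun i => (x i : T)) (by
      rw [map_prod]
      simp)

@[simp]
theorem laurentLift_C (c : WittVector p κ →+* T) (x : Fin d → Tˣ) (a : WittVector p κ) :
    laurentLift c x (algebraMap _ (Laurent p κ d) a) = c a := by
  rw [IsScalarTower.algebraMap_apply (WittVector p κ)
    (MvPolynomial (Fin d) (WittVector p κ)) (Laurent p κ d), laurentLift,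
    IsLocalization.Away.lift_eq]
  simp

@[simp]
theorem laurentLift_X (c : WittVector p κ →+* T) (x : Fin d → Tˣ) (i : Fin d) :
    laurentLift c x (algebraMap (MvPolynomial (Fin d) (WittVector p κ)) (Laurent p κ d)
      (MvPolynomial.X i)) = x i := by
  rw [laurentLift, IsLocalization.Away.lift_eq]
  simp

theorem laurent_hom_ext (f g : Laurent p κ d →+* T)
    (hC : ∀ a, f (algebraMap (WittVector p κ) (Laurent p κ d) a) =
      g (algebraMap (WittVector p κ) (Laurent p κ d) a))
    (hX : ∀ i, f (algebraMap (MvPolynomial (Fin d) (WittVector p κ)) (Laurent p κ d)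
      (MvPolynomial.X i)) =
      g (algebraMap (MvPolynomial (Fin d) (WittVector p κ)) (Laurent p κ d)
      (MvPolynomial.X i))) : f = g := by
  refine IsLocalization.ringHom_ext
    (Submonoid.powers (∏ i : Fin d, (MvPolynomial.X i : MvPolynomial (Fin d) (WittVector p κ)))) ?_
  refine MvPolynomial.ringHom_ext (fun a => ?_) (fun i => hX i)
  exact hC a

end LaurentLift

/-- The ring `R^□ = W(κ)⟨X₁^{±1}, …, X_d^{±1}⟩`, the `p`-adic completion of the Laurent polynomial
ring. -/
abbrev RSq : Type u := AdicCompletion (Ideal.span {(p : Laurent p κ d)}) (Laurent p κ d)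

/-- The variable `Xᵢ` as a unit of `R^□`. -/
def sqX (i : Fin d) : (RSq p κ d)ˣ :=
  Units.map (algebraMap (Laurent p κ d) (RSq p κ d) : Laurent p κ d →* RSq p κ d)
    (isUnit_laurentX p κ d i).unit

theorem sqX_val (i : Fin d) : (sqX p κ d i : RSq p κ d) =
    AdicCompletion.of _ _ (algebraMap (MvPolynomial (Fin d) (WittVector p κ)) (Laurent p κ d)
      (MvPolynomial.X i)) := rfl

theorem map_span_natCast_le {A B : Type*} [CommRing A] [CommRing B] (f : A →+* B) (p : ℕ) :
    (Ideal.span {(p : A)}).map f ≤ Ideal.span {(p : B)} := by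
  rw [Ideal.map_span, Set.image_singleton, map_natCast]

/-- The continuous ring homomorphism from `R^□` to a `p`-adically complete ring given by `c` on
`W(κ)` and sending `Xᵢ` to the unit `xᵢ`. -/
def sqLift {T : Type*} [CommRing T] [IsAdicComplete (Ideal.span {(p : T)}) T]
    (c : WittVector p κ →+* T) (x : Fin d → Tˣ) : RSq p κ d →+* T :=
  adicExtend (Ideal.span {(p : Laurent p κ d)}) (Ideal.span {(p : T)}) (laurentLift c x)
    (map_span_natCast_le _ p)

section

variable {p κ d} {T : Type*} [CommRing T]

@[simp]
theorem sqLift_C [IsAdicComplete (Ideal.span {(p : T)}) T]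
    (c : WittVector p κ →+* T) (x : Fin d → Tˣ) (a : WittVector p κ) :
    sqLift p κ d c x (algebraMap _ (RSq p κ d) a) = c a := by
  have : algebraMap (WittVector p κ) (RSq p κ d) a =
    AdicCompletion.of _ _ (algebraMap _ (Laurent p κ d) a) := rfl
  rw [this, sqLift, adicExtend_of, laurentLift_C]

@[simp]
theorem sqLift_X [IsAdicComplete (Ideal.span {(p : T)}) T]
    (c : WittVector p κ →+* T) (x : Fin d → Tˣ) (i : Fin d) :
    sqLift p κ d c x (sqX p κ d i) = x i := by
  rw [sqX_val, sqLift, adicExtend_of, laurentLift_X]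

theorem span_natCast_fg {A : Type*} [CommRing A] (p : ℕ) : (Ideal.span {(p : A)}).FG :=
  ⟨{(p : A)}, by simp⟩

theorem padic_hom_ext {A : Type*} [CommRing A] [IsHausdorff (Ideal.span {(p : T)}) T]
    (f g : AdicCompletion (Ideal.span {(p : A)}) A →+* T)
    (h : ∀ a, f (AdicCompletion.of _ A a) = g (AdicCompletion.of _ A a)) : f = g := by
  refine adic_hom_ext (span_natCast_fg p) (Ideal.span {(p : T)}) f g (fun a ha => ?_) h
  have h1 := map_span_natCast_le (f.comp (algebraMap A _)) p
  exact h1 (Ideal.mem_map_of_mem (f.comp (algebraMap A _)) ha)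

theorem sq_hom_ext [IsHausdorff (Ideal.span {(p : T)}) T] (f g : RSq p κ d →+* T)
    (hC : ∀ a, f (algebraMap (WittVector p κ) (RSq p κ d) a) =
      g (algebraMap (WittVector p κ) (RSq p κ d) a))
    (hX : ∀ i, f (sqX p κ d i) = g (sqX p κ d i)) : f = g := by
  refine padic_hom_ext f g fun a => ?_
  have := laurent_hom_ext (f.comp (algebraMap _ (RSq p κ d)))
    (g.comp (algebraMap _ (RSq p κ d))) hC hX
  exact congr($this a)

end

/-- The Frobenius of `R^□`: the Witt vector Frobenius on `W(κ)`, and `Xᵢ ↦ Xᵢ ^ p`. -/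
def frobSq : RSq p κ d →+* RSq p κ d :=
  sqLift p κ d ((algebraMap _ _).comp WittVector.frobenius) fun i => sqX p κ d i ^ p

theorem witt_frobenius_sub_pow_mem [PerfectRing κ p] (a : WittVector p κ) :
    WittVector.frobenius a - a ^ p ∈ Ideal.span {(p : WittVector p κ)} := by
  rw [← WittVector.ker_constantCoeff, RingHom.mem_ker, map_sub, map_pow,
    WittVector.constantCoeff_apply, WittVector.constantCoeff_apply,
    WittVector.coeff_frobenius_charP, sub_self]

theorem frobSq_sub_pow_mem [PerfectRing κ p] (a : RSq p κ d) :
    frobSq p κ d a - a ^ p ∈ Ideal.span {(p : RSq p κ d)} := by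
  set I := Ideal.span {(p : RSq p κ d)}
  have h0 : Ideal.span {(p : RSq p κ d ⧸ I)} = ⊥ := by
    rw [quot_natCast_eq_zero]; simp
  have : IsHausdorff (Ideal.span {(p : RSq p κ d ⧸ I)}) (RSq p κ d ⧸ I) := by
    rw [h0]; infer_instance
  have key : (Ideal.Quotient.mk I).comp (frobSq p κ d) =
      (absFrob p (quot_natCast_eq_zero _ p)).comp (Ideal.Quotient.mk I) := by
    refine sq_hom_ext _ _ (fun a => ?_) (fun i => ?_)
    · simp only [RingHom.comp_apply, frobSq, sqLift_C, absFrob_apply, ← map_pow]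
      rw [Ideal.Quotient.eq, ← map_sub]
      exact map_span_natCast_le (algebraMap (WittVector p κ) (RSq p κ d)) p
        (Ideal.mem_map_of_mem _ (witt_frobenius_sub_pow_mem p κ a))
    · simp [frobSq]
  rw [← Ideal.Quotient.eq, map_pow]
  exact congr($key a)

variable (S : Type v) [CommRing S]

/-- The `p`-adic completion of `S`. -/
abbrev RR : Type v := AdicCompletion (Ideal.span {(p : S)}) S

section Etale

variable [Algebra (RSq p κ d) S]

/-- Uniqueness of the extension of ring homomorphisms from `R^□` to the `p`-adic completion of an
étale algebra. -/
theorem rr_hom_ext [Algebra.Etale (RSq p κ d) S] {T : Type*} [CommRing T]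
    [IsHausdorff (Ideal.span {(p : T)}) T]
    (I : Ideal T) [IsHausdorff I T] (f g : RR p S →+* T)
    (h : ∀ a, f (algebraMap (RSq p κ d) (RR p S) a) = g (algebraMap (RSq p κ d) (RR p S) a))
    (hI : ∀ x, f x - g x ∈ I) : f = g := by
  refine padic_hom_ext f g fun a => ?_
  have := lift_ext (P := RSq p κ d) I (f.comp (algebraMap S (RR p S)))
    (g.comp (algebraMap S (RR p S))) h (fun x => hI _)
  exact congr($this a)

theorem exists_frobR [PerfectRing κ p] [Algebra.Etale (RSq p κ d) S] :
    ∃ f : RR p S →+* RR p S,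
      (∀ a, f (algebraMap (RSq p κ d) (RR p S) a) =
        algebraMap (RSq p κ d) (RR p S) (frobSq p κ d a)) ∧
      ∀ x, f x - x ^ p ∈ Ideal.span {(p : RR p S)} := by
  set I := Ideal.span {(p : RR p S)} with hI
  obtain ⟨F, hF1, hF2⟩ := exists_lift (P := RSq p κ d) (S := S) I
    ((algebraMap (RSq p κ d) (RR p S)).comp (frobSq p κ d))
    (((absFrob p (quot_natCast_eq_zero _ p)).comp (Ideal.Quotient.mk I)).comp
      (algebraMap S (RR p S))) (by
        intro a
        simp only [RingHom.comp_apply, absFrob_apply, ← map_pow]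
        change Ideal.Quotient.mk I (algebraMap (RSq p κ d) (RR p S) (a ^ p)) = _
        symm
        rw [Ideal.Quotient.eq, ← map_sub]
        exact map_span_natCast_le (algebraMap (RSq p κ d) (RR p S)) p
          (Ideal.mem_map_of_mem _ (frobSq_sub_pow_mem p κ d a)))
  refine ⟨adicExtend (Ideal.span {(p : S)}) I F (map_span_natCast_le _ p), fun a => ?_, ?_⟩
  · change adicExtend _ I F _ (AdicCompletion.of _ S (algebraMap (RSq p κ d) S a)) = _
    rw [adicExtend_of, hF1]
    rfl
  · have h0 : Ideal.span {(p : RR p S ⧸ I)} = ⊥ := by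
      rw [quot_natCast_eq_zero]; simp
    have : IsHausdorff (Ideal.span {(p : RR p S ⧸ I)}) (RR p S ⧸ I) := by
      rw [h0]; infer_instance
    have key : (Ideal.Quotient.mk I).comp
        (adicExtend (Ideal.span {(p : S)}) I F (map_span_natCast_le _ p)) =
        (absFrob p (quot_natCast_eq_zero _ p)).comp (Ideal.Quotient.mk I) := by
      refine padic_hom_ext _ _ fun a => ?_
      rw [RingHom.comp_apply, adicExtend_of, hF2]
      rfl
    intro x
    rw [← Ideal.Quotient.eq, map_pow]
    exact congr($key x)

/-- The Frobenius endomorphism `φ` of `R`: the (unique) lift of the absolute Frobenius of `R / p`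
which extends the Frobenius of `R^□`. -/
def frobR [PerfectRing κ p] [Algebra.Etale (RSq p κ d) S] : RR p S →+* RR p S :=
  (exists_frobR p κ d S).choose

variable {S} in
theorem frobR_algebraMap [PerfectRing κ p] [Algebra.Etale (RSq p κ d) S] (a : RSq p κ d) :
    frobR p κ d S (algebraMap (RSq p κ d) (RR p S) a) =
      algebraMap (RSq p κ d) (RR p S) (frobSq p κ d a) :=
  (exists_frobR p κ d S).choose_spec.1 a

variable {S} in
theorem frobR_sub_pow_mem [PerfectRing κ p] [Algebra.Etale (RSq p κ d) S] (x : RR p S) :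
    frobR p κ d S x - x ^ p ∈ Ideal.span {(p : RR p S)} :=
  (exists_frobR p κ d S).choose_spec.2 x

/-- The properties defining `φ` characterise it. -/
theorem frobR_unique [PerfectRing κ p] [Algebra.Etale (RSq p κ d) S] (f : RR p S →+* RR p S)
    (h1 : ∀ a, f (algebraMap (RSq p κ d) (RR p S) a) =
      algebraMap (RSq p κ d) (RR p S) (frobSq p κ d a))
    (h2 : ∀ x, f x - x ^ p ∈ Ideal.span {(p : RR p S)}) : f = frobR p κ d S := by
  refine rr_hom_ext p κ d S (Ideal.span {(p : RR p S)}) f _ (fun a => ?_) fun x => ?_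
  · rw [h1, frobR_algebraMap]
  · have := Ideal.sub_mem _ (h2 x) (frobR_sub_pow_mem p κ d x)
    simpa using this

/-- The coordinate `Xᵢ` of `R`. -/
def rX (i : Fin d) : (RR p S)ˣ :=
  Units.map (algebraMap (RSq p κ d) (RR p S) : RSq p κ d →* RR p S) (sqX p κ d i)

end Etale

end Base

/-! ### The power series `q ^ a = (1 + X) ^ a` for a `p`-adic integer `a` -/

section QPow

variable {p : ℕ} [Fact p.Prime]

theorem pow_prime_pow_sub_one_mem {T : Type*} [CommRing T] (J : Ideal T) (hp : (p : T) ∈ J)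
    {x : T} (hx : x - 1 ∈ J) (n : ℕ) : x ^ p ^ n - 1 ∈ J ^ (n + 1) := by
  induction n with
  | zero => simpa using hx
  | succ n ih =>
    set y := x ^ p ^ n
    have hy : y - 1 ∈ J := Ideal.pow_le_self (Nat.succ_ne_zero n) ih
    have h1 : ∑ i ∈ Finset.range p, y ^ i ∈ J := by
      have e : ∑ i ∈ Finset.range p, y ^ i = ∑ i ∈ Finset.range p, (y ^ i - 1) + (p : T) := by
        simp
      rw [e]
      refine J.add_mem (J.sum_mem fun i _ => ?_) hp
      exact J.mem_of_dvd (by simpa using sub_dvd_pow_sub_pow y 1 i) hy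
    rw [pow_succ p n, pow_mul, ← geom_sum_mul y p, mul_comm, pow_succ J]
    exact Ideal.mul_mem_mul ih h1

/-- Two homomorphisms from `ℤ_p` to the units congruent to `1` modulo an ideal containing `p` for
which the ring is separated agree as soon as they agree at `1`. -/
theorem exp_ext {T : Type*} [CommRing T] (J : Ideal T) [IsHausdorff J T] (hp : (p : T) ∈ J)
    (u v : Multiplicative ℤ_[p] →* T) (hu : ∀ a, u a - 1 ∈ J) (hv : ∀ a, v a - 1 ∈ J)
    (h1 : u (Multiplicative.ofAdd 1) = v (Multiplicative.ofAdd 1)) : u = v := by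
  refine MonoidHom.ext fun b => ?_
  refine sub_eq_zero.mp (IsHausdorff.haus (I := J) inferInstance _ fun n => ?_)
  rw [SModEq.zero]
  simp only [smul_eq_mul, Ideal.mul_top]
  obtain ⟨c, hc⟩ := Ideal.mem_span_singleton'.mp
    (PadicInt.appr_spec n (Multiplicative.toAdd b))
  have hb : b = Multiplicative.ofAdd (1 : ℤ_[p]) ^ (PadicInt.appr (Multiplicative.toAdd b) n) *
      Multiplicative.ofAdd c ^ p ^ n := by
    apply Multiplicative.toAdd.injective
    rw [toAdd_mul, toAdd_pow, toAdd_pow, toAdd_ofAdd, toAdd_ofAdd, nsmul_eq_mul, nsmul_eq_mul,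
      Nat.cast_pow, mul_comm _ c, hc]
    ring
  rw [hb, map_mul, map_mul, map_pow, map_pow, map_pow, map_pow, h1, ← mul_sub]
  refine Ideal.mul_mem_left _ _ ?_
  have := Ideal.sub_mem _ (pow_prime_pow_sub_one_mem J hp (hu (Multiplicative.ofAdd c)) n)
    (pow_prime_pow_sub_one_mem J hp (hv (Multiplicative.ofAdd c)) n)
  rw [sub_sub_sub_cancel_right] at this
  exact Ideal.pow_le_pow_right (Nat.le_succ n) this

variable {R : Type*} [CommRing R]

open PowerSeries

/-- The power series `(1 + X) ^ a = ∑ₙ (a choose n) Xⁿ` over `R`, for `a ∈ ℤ_p`. -/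
def qPow (z : ℤ_[p] →+* R) (a : ℤ_[p]) : R⟦X⟧ :=
  PowerSeries.map z (PowerSeries.binomialSeries ℤ_[p] a)

theorem qPow_zero (z : ℤ_[p] →+* R) : qPow z 0 = 1 := by simp [qPow]

theorem qPow_one (z : ℤ_[p] →+* R) : qPow z 1 = 1 + X := by
  have := PowerSeries.binomialSeries_nat (R := ℤ_[p]) (A := ℤ_[p]) 1
  rw [qPow, ← Nat.cast_one, this]
  simp

theorem qPow_add (z : ℤ_[p] →+* R) (a b : ℤ_[p]) : qPow z (a + b) = qPow z a * qPow z b := by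
  simp [qPow]

theorem constantCoeff_qPow (z : ℤ_[p] →+* R) (a : ℤ_[p]) : constantCoeff (qPow z a) = 1 := by
  simp [qPow, ← coeff_zero_eq_constantCoeff_apply]

theorem qPow_sub_one_mem (z : ℤ_[p] →+* R) (a : ℤ_[p]) :
    qPow z a - 1 ∈ Ideal.span {(X : R⟦X⟧)} := by
  rw [Ideal.mem_span_singleton, X_dvd_iff, map_sub, constantCoeff_qPow, map_one, sub_self]

/-- `(1 + X) ^ a` as a unit. -/
def qUnit (z : ℤ_[p] →+* R) (a : ℤ_[p]) : R⟦X⟧ˣ where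
  val := qPow z a
  inv := qPow z (-a)
  val_inv := by rw [← qPow_add, add_neg_cancel, qPow_zero]
  inv_val := by rw [← qPow_add, neg_add_cancel, qPow_zero]

/-- `a ↦ (1 + X) ^ a` as a homomorphism. -/
def qHom (z : ℤ_[p] →+* R) : Multiplicative ℤ_[p] →* R⟦X⟧ where
  toFun a := qPow z (Multiplicative.toAdd a)
  map_one' := qPow_zero z
  map_mul' _ _ := qPow_add z _ _

/-- If `R` is `p`-adically separated, `R⟦X⟧` is `(p, X)`-adically separated. -/
theorem isHausdorff_pX (p : ℕ) [IsHausdorff (Ideal.span {(p : R)}) R] :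
    IsHausdorff (Ideal.span {(p : R⟦X⟧), X}) R⟦X⟧ := by
  have key : ∀ (n : ℕ) (f : R⟦X⟧), f ∈ (Ideal.span {(p : R⟦X⟧), X}) ^ n →
      ∀ k, coeff k f ∈ (Ideal.span {(p : R)}) ^ (n - k) := by
    intro n
    induction n with
    | zero => simp
    | succ n ih =>
      intro f hf
      rw [pow_succ] at hf
      refine Submodule.mul_induction_on hf (fun a ha b hb k => ?_) (fun a b ha hb k => ?_)
      · obtain ⟨s, t, rfl⟩ := Ideal.mem_span_pair.mp hb
        rw [mul_add, map_add, ← mul_assoc, ← mul_assoc]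
        refine Ideal.add_mem _ ?_ ?_
        · rw [← map_natCast (C (R := R)), coeff_mul_C]
          have h1 := ih _ (Ideal.mul_mem_right s _ ha) k
          have h2 := Ideal.mul_mem_mul h1 (Ideal.mem_span_singleton_self (p : R))
          rw [← pow_succ] at h2
          exact Ideal.pow_le_pow_right (by omega) h2
        · cases k with
          | zero => simp
          | succ k =>
            rw [coeff_succ_mul_X]
            have h1 := ih _ (Ideal.mul_mem_right t _ ha) k
            rwa [Nat.add_sub_add_right]
      · rw [map_add]
        exact Ideal.add_mem _ (ha k) (hb k)
  constructor
  intro f hf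
  ext k
  refine IsHausdorff.haus (I := Ideal.span {(p : R)}) inferInstance _ fun n => ?_
  have := hf (n + k)
  rw [SModEq.zero] at this ⊢
  simp only [smul_eq_mul, Ideal.mul_top] at this ⊢
  simpa using key _ _ this k

/-- A ring endomorphism `F` of `R⟦X⟧` with `F(1 + X) = (1 + X) ^ a` and `F(X) ∈ (p, X)` maps
`(1 + X) ^ b` to `(1 + X) ^ (ab)`. -/
theorem map_qPow (z : ℤ_[p] →+* R) [IsHausdorff (Ideal.span {(p : R)}) R] (F : R⟦X⟧ →+* R⟦X⟧)
    (a : ℤ_[p]) (hF : F (1 + X) = qPow z a) (b : ℤ_[p]) :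
    F (qPow z b) = qPow z (a * b) := by
  have := isHausdorff_pX (R := R) p
  have hXJ : Ideal.span {(X : R⟦X⟧)} ≤ Ideal.span {(p : R⟦X⟧), X} :=
    Ideal.span_mono (by simp)
  have hFX : F X ∈ Ideal.span {(X : R⟦X⟧)} := by
    have e : F X = qPow z a - 1 := by rw [← hF]; simp
    rw [e]
    exact qPow_sub_one_mem z a
  let v : Multiplicative ℤ_[p] →* R⟦X⟧ :=
    (qHom z).comp (AddMonoidHom.toMultiplicative (AddMonoidHom.mulLeft a))
  have h := exp_ext (p := p) (Ideal.span {(p : R⟦X⟧), X}) (Ideal.subset_span (by simp))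
    ((F : R⟦X⟧ →* R⟦X⟧).comp (qHom z)) v ?_ ?_ ?_
  · exact congr($h (Multiplicative.ofAdd b))
  · intro c
    apply hXJ
    obtain ⟨g, hg⟩ := Ideal.mem_span_singleton'.mp (qPow_sub_one_mem z (Multiplicative.toAdd c))
    change F (qPow z (Multiplicative.toAdd c)) - 1 ∈ _
    rw [← map_one F, ← map_sub, ← hg, map_mul]
    exact Ideal.mul_mem_left _ _ hFX
  · intro c
    exact hXJ (qPow_sub_one_mem z _)
  · change F (qPow z 1) = qPow z (a * 1)
    rw [qPow_one, hF, mul_one]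

end QPow

/-! ### The ring `A_R = R⟦μ⟧` with its Frobenius and its action of `Γ_R` -/

section AR

open PowerSeries

theorem mem_span_X_iff {R : Type*} [CommRing R] (f : R⟦X⟧) :
    f ∈ Ideal.span {(X : R⟦X⟧)} ↔ constantCoeff f = 0 := by
  rw [Ideal.mem_span_singleton, X_dvd_iff]

variable (p : ℕ) [Fact p.Prime] (κ : Type u) [Field κ] [CharP κ p] (d : ℕ)

/-- The automorphism `(bᵢ) ↦ (a bᵢ)` of `ℤ_p ^ d`. -/
def gammaTwist : ℤ_[p]ˣ →* MulAut (Multiplicative (Fin d → ℤ_[p])) where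
  toFun a := AddEquiv.toMultiplicative (DistribMulAction.toAddEquiv (Fin d → ℤ_[p]) a)
  map_one' := by
    refine MulEquiv.ext fun x => ?_
    change Multiplicative.ofAdd ((1 : ℤ_[p]ˣ) • Multiplicative.toAdd x) = x
    rw [one_smul]
    rfl
  map_mul' a b := by
    refine MulEquiv.ext fun x => ?_
    change Multiplicative.ofAdd ((a * b) • Multiplicative.toAdd x) =
      Multiplicative.ofAdd (a • (b • Multiplicative.toAdd x))
    rw [mul_smul]

/-- The group `Γ_R = ℤ_p(1) ^ d ⋊ ℤ_p^×`. -/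
abbrev GammaR : Type := Multiplicative (Fin d → ℤ_[p]) ⋊[gammaTwist p d] ℤ_[p]ˣ

/-- The component of `g` in `ℤ_p(1) ^ d`. -/
def gB {p d} [Fact p.Prime] (g : GammaR p d) (i : Fin d) : ℤ_[p] := Multiplicative.toAdd g.left i

/-- The cyclotomic character of `g`. -/
def gA {p d} [Fact p.Prime] (g : GammaR p d) : ℤ_[p] := (g.right : ℤ_[p])

/-- The canonical ring homomorphism from `ℤ_p = W(𝔽_p)` to `W(κ)`. -/
def zpW : ℤ_[p] →+* WittVector p κ :=
  (WittVector.map (ZMod.castHom (dvd_refl p) κ)).comp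
    ((WittVector.equiv p).symm : ℤ_[p] →+* WittVector p (ZMod p))

variable (S : Type v) [CommRing S]

/-- The underlying ring of `A_R`: the ring `R⟦μ⟧` of power series in one variable `μ` over `R`.
Here `μ` is `PowerSeries.X`, and `[Xᵢ^♭]` is the constant power series `Xᵢ`. -/
abbrev AA : Type v := PowerSeries (RR p S)

section

variable [Algebra (WittVector p κ) S]

/-- The structure map `ℤ_p → R`. -/
def zpR : ℤ_[p] →+* RR p S := (algebraMap (WittVector p κ) (RR p S)).comp (zpW p κ)

variable [Algebra (RSq p κ d) S] [IsScalarTower (WittVector p κ) (RSq p κ d) S]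

theorem algebraMap_RR (a : WittVector p κ) : algebraMap (RSq p κ d) (RR p S)
    (algebraMap (WittVector p κ) (RSq p κ d) a) = algebraMap (WittVector p κ) (RR p S) a := by
  change AdicCompletion.of _ S (algebraMap (RSq p κ d) S (algebraMap _ _ a)) =
    AdicCompletion.of _ S (algebraMap _ S a)
  rw [← IsScalarTower.algebraMap_apply]

theorem rX_val (i : Fin d) :
    algebraMap (RSq p κ d) (RR p S) (sqX p κ d i) = (rX p κ d S i : RR p S) := rfl

theorem algebraMap_AA (a : WittVector p κ) : algebraMap (WittVector p κ) (AA p S) a =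
    C (algebraMap (WittVector p κ) (RR p S) a) :=
  PowerSeries.algebraMap_apply

/-- The restriction to `R^□` of the action on `A_R` of the element of `Γ_R` with components
`b ∈ ℤ_p(1) ^ d` and `1`: it sends `Xᵢ` to `(1 + μ) ^ bᵢ Xᵢ`. -/
def thetaB (b : Fin d → ℤ_[p]) : RSq p κ d →+* AA p S :=
  sqLift p κ d (algebraMap (WittVector p κ) (AA p S)) fun i =>
    qUnit (zpR p κ S) (b i) * Units.map (C (R := RR p S) : RR p S →* AA p S) (rX p κ d S i)

theorem thetaB_C (b : Fin d → ℤ_[p]) (a : WittVector p κ) :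
    thetaB p κ d S b (algebraMap _ _ a) = C (algebraMap (WittVector p κ) (RR p S) a) := by
  rw [thetaB, sqLift_C, algebraMap_AA]

theorem thetaB_X (b : Fin d → ℤ_[p]) (i : Fin d) :
    thetaB p κ d S b (sqX p κ d i) = qPow (zpR p κ S) (b i) * C (rX p κ d S i : RR p S) := by
  rw [thetaB, sqLift_X]
  rfl

theorem constantCoeff_thetaB (b : Fin d → ℤ_[p]) (a : RSq p κ d) :
    constantCoeff (thetaB p κ d S b a) = algebraMap (RSq p κ d) (RR p S) a := by
  have : (constantCoeff (R := RR p S)).comp (thetaB p κ d S b) =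
      algebraMap (RSq p κ d) (RR p S) := by
    refine sq_hom_ext _ _ (fun a => ?_) fun i => ?_
    · rw [RingHom.comp_apply, thetaB_C, algebraMap_RR]
      exact constantCoeff_C _
    · rw [RingHom.comp_apply, thetaB_X, map_mul, constantCoeff_qPow, rX_val]
      simp
  exact congr($this a)

theorem exists_tauB [Algebra.Etale (RSq p κ d) S] (b : Fin d → ℤ_[p]) :
    ∃ t : RR p S →+* AA p S,
      (∀ a, t (algebraMap (RSq p κ d) (RR p S) a) = thetaB p κ d S b a) ∧
      ∀ x, constantCoeff (t x) = x := by
  obtain ⟨F, hF1, hF2⟩ := exists_lift (P := RSq p κ d) (S := S)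
    (Ideal.span {(X : AA p S)}) (thetaB p κ d S b)
    (((Ideal.Quotient.mk _).comp (C (R := RR p S))).comp (algebraMap S (RR p S))) (by
      intro a
      rw [RingHom.comp_apply, RingHom.comp_apply, Ideal.Quotient.eq, mem_span_X_iff, map_sub,
        constantCoeff_thetaB, constantCoeff_C]
      exact sub_self _)
  refine ⟨adicExtend (Ideal.span {(p : S)}) (Ideal.span {(p : AA p S)}) F
    (map_span_natCast_le _ p), fun a => ?_, fun x => ?_⟩
  · change adicExtend _ _ F _ (AdicCompletion.of _ S (algebraMap (RSq p κ d) S a)) = _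
    rw [adicExtend_of, hF1]
  · have : (constantCoeff (R := RR p S)).comp (adicExtend (Ideal.span {(p : S)})
        (Ideal.span {(p : AA p S)}) F (map_span_natCast_le _ p)) = RingHom.id _ := by
      refine padic_hom_ext _ _ fun a => ?_
      rw [RingHom.comp_apply, adicExtend_of, RingHom.id_apply]
      have h := hF2 a
      rw [RingHom.comp_apply, RingHom.comp_apply, Ideal.Quotient.eq, mem_span_X_iff, map_sub,
        constantCoeff_C, sub_eq_zero] at h
      exact h
    exact congr($this x)

/-- The restriction to `R` of the action on `A_R` of the element of `Γ_R` with components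
`b ∈ ℤ_p(1) ^ d` and `1`: the (unique) ring homomorphism `R → R⟦μ⟧` which is the identity modulo
`μ` and which is given on `R^□` by `Xᵢ ↦ (1 + μ) ^ bᵢ Xᵢ`. -/
def tauB [Algebra.Etale (RSq p κ d) S] (b : Fin d → ℤ_[p]) : RR p S →+* AA p S :=
  (exists_tauB p κ d S b).choose

theorem tauB_algebraMap [Algebra.Etale (RSq p κ d) S] (b : Fin d → ℤ_[p]) (a : RSq p κ d) :
    tauB p κ d S b (algebraMap (RSq p κ d) (RR p S) a) = thetaB p κ d S b a :=
  (exists_tauB p κ d S b).choose_spec.1 a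

theorem constantCoeff_tauB [Algebra.Etale (RSq p κ d) S] (b : Fin d → ℤ_[p]) (x : RR p S) :
    constantCoeff (tauB p κ d S b x) = x :=
  (exists_tauB p κ d S b).choose_spec.2 x

/-- Two ring homomorphisms `R → R⟦μ⟧` which agree on `W(κ)`, on the coordinates and modulo `μ`
are equal. -/
theorem hom_ext_mod_X [Algebra.Etale (RSq p κ d) S] (f g : RR p S →+* AA p S)
    (hC : ∀ a, f (algebraMap (WittVector p κ) (RR p S) a) =
      g (algebraMap (WittVector p κ) (RR p S) a))
    (hX : ∀ i, f (rX p κ d S i) = g (rX p κ d S i))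
    (h0 : ∀ x, constantCoeff (f x) = constantCoeff (g x)) : f = g := by
  refine rr_hom_ext p κ d S (Ideal.span {(X : AA p S)}) f g (fun a => ?_) fun x => ?_
  · have : f.comp (algebraMap (RSq p κ d) (RR p S)) =
        g.comp (algebraMap (RSq p κ d) (RR p S)) := by
      refine sq_hom_ext _ _ (fun a => ?_) fun i => ?_
      · rw [RingHom.comp_apply, RingHom.comp_apply, algebraMap_RR]
        exact hC a
      · exact hX i
    exact congr($this a)
  · rw [mem_span_X_iff, map_sub, h0, sub_self]

/-- The action of `g ∈ Γ_R` on `A_R`: it is given by `tauB` on `R`, and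
`g(1 + μ) = (1 + μ) ^ χ(g)`. -/
def gammaA [Algebra.Etale (RSq p κ d) S] (g : GammaR p d) : AA p S →+* AA p S :=
  psExtend (Ideal.span {(X : AA p S)}) (tauB p κ d S (gB g)) (qPow (zpR p κ S) (gA g) - 1)
    (qPow_sub_one_mem _ _)

/-- The Frobenius `φ` of `A_R`: the Frobenius on `R`, and `φ(1 + μ) = (1 + μ) ^ p`. -/
def frobA [PerfectRing κ p] [Algebra.Etale (RSq p κ d) S] : AA p S →+* AA p S :=
  psExtend (Ideal.span {(X : AA p S)}) ((C (R := RR p S)).comp (frobR p κ d S))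
    ((1 + X) ^ p - 1) (by rw [mem_span_X_iff]; simp)

variable [Algebra.Etale (RSq p κ d) S]

theorem gammaA_C (g : GammaR p d) (r : RR p S) :
    gammaA p κ d S g (C r) = tauB p κ d S (gB g) r := by
  rw [gammaA, psExtend_C]

theorem gammaA_X (g : GammaR p d) :
    gammaA p κ d S g X = qPow (zpR p κ S) (gA g) - 1 := by
  rw [gammaA, psExtend_X]

theorem gammaA_one_add_X (g : GammaR p d) :
    gammaA p κ d S g (1 + X) = qPow (zpR p κ S) (gA g) := by
  rw [map_add, map_one, gammaA_X]
  ring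

theorem gammaA_algebraMap (g : GammaR p d) (a : WittVector p κ) :
    gammaA p κ d S g (algebraMap _ (AA p S) a) = algebraMap _ (AA p S) a := by
  rw [algebraMap_AA, gammaA_C, ← algebraMap_RR p κ d S, tauB_algebraMap, thetaB_C,
    algebraMap_RR p κ d S]

theorem gammaA_rX (g : GammaR p d) (i : Fin d) :
    gammaA p κ d S g (C (rX p κ d S i : RR p S)) =
      qPow (zpR p κ S) (gB g i) * C (rX p κ d S i : RR p S) := by
  rw [gammaA_C, ← rX_val p κ d S, tauB_algebraMap, thetaB_X, rX_val]

theorem gammaA_qPow (g : GammaR p d) (b : ℤ_[p]) :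
    gammaA p κ d S g (qPow (zpR p κ S) b) = qPow (zpR p κ S) (gA g * b) :=
  map_qPow _ _ _ (gammaA_one_add_X p κ d S g) b

theorem constantCoeff_gammaA (g : GammaR p d) (f : AA p S) :
    constantCoeff (gammaA p κ d S g f) = constantCoeff f := by
  have : (constantCoeff (R := RR p S)).comp (gammaA p κ d S g) = constantCoeff := by
    refine ps_hom_ext (⊥ : Ideal (RR p S)) _ _ ?_ (fun r => ?_) ?_
    · rw [RingHom.comp_apply, gammaA_X, map_sub, constantCoeff_qPow]
      simp
    · rw [RingHom.comp_apply, gammaA_C, constantCoeff_tauB, constantCoeff_C]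
    · rw [RingHom.comp_apply, gammaA_X, map_sub, constantCoeff_qPow]
      simp
  exact congr($this f)

/-- `Γ_R` acts trivially on `A_R / μ`. -/
theorem gammaA_sub_mem (g : GammaR p d) (f : AA p S) :
    gammaA p κ d S g f - f ∈ Ideal.span {(X : AA p S)} := by
  rw [mem_span_X_iff, map_sub, constantCoeff_gammaA, sub_self]

theorem hom_ext_A (F G : AA p S →+* AA p S)
    (hW : ∀ a, F (algebraMap (WittVector p κ) (AA p S) a) =
      G (algebraMap (WittVector p κ) (AA p S) a))
    (hX : ∀ i, F (C (rX p κ d S i : RR p S)) = G (C (rX p κ d S i : RR p S)))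
    (h0 : ∀ x, constantCoeff (F x) = constantCoeff (G x))
    (h1 : F (1 + X) = G (1 + X)) (h2 : constantCoeff (F X) = 0) : F = G := by
  refine ps_hom_ext (Ideal.span {(X : AA p S)}) F G ((mem_span_X_iff _).mpr h2) (fun r => ?_) ?_
  · have := hom_ext_mod_X p κ d S (F.comp C) (G.comp C)
      (fun a => by simpa only [algebraMap_AA, RingHom.comp_apply] using hW a) hX fun x => h0 _
    exact congr($this r)
  · simpa using h1

/-- The maps `gammaA g` define an action of the group `Γ_R`. -/
theorem gammaA_one : gammaA p κ d S 1 = RingHom.id _ := by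
  refine hom_ext_A p κ d S _ _ (fun a => ?_) (fun i => ?_) (fun x => ?_) ?_ ?_
  · rw [gammaA_algebraMap, RingHom.id_apply]
  · rw [gammaA_rX, show gB (1 : GammaR p d) i = 0 from rfl, qPow_zero, one_mul, RingHom.id_apply]
  · rw [constantCoeff_gammaA, RingHom.id_apply]
  · rw [gammaA_one_add_X, show gA (1 : GammaR p d) = 1 from rfl, qPow_one, RingHom.id_apply]
  · rw [constantCoeff_gammaA, constantCoeff_X]

theorem gammaA_mul (g h : GammaR p d) :
    gammaA p κ d S (g * h) = (gammaA p κ d S g).comp (gammaA p κ d S h) := by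
  refine hom_ext_A p κ d S _ _ (fun a => ?_) (fun i => ?_) (fun x => ?_) ?_ ?_
  · simp only [gammaA_algebraMap, RingHom.comp_apply]
  · rw [RingHom.comp_apply, gammaA_rX, gammaA_rX, map_mul, gammaA_rX, gammaA_qPow,
      show gB (g * h) i = gB g i + gA g * gB h i from rfl, qPow_add]
    ring
  · simp only [constantCoeff_gammaA, RingHom.comp_apply]
  · rw [RingHom.comp_apply, gammaA_one_add_X, gammaA_one_add_X, gammaA_qPow,
      show gA (g * h) = gA g * gA h from rfl]
  · rw [constantCoeff_gammaA, constantCoeff_X]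

variable [PerfectRing κ p]

theorem frobA_C (r : RR p S) : frobA p κ d S (C r) = C (frobR p κ d S r) := by
  rw [frobA, psExtend_C, RingHom.comp_apply]

theorem frobA_X : frobA p κ d S X = (1 + X) ^ p - 1 := by
  rw [frobA, psExtend_X]

theorem frobA_one_add_X : frobA p κ d S (1 + X) = (1 + X) ^ p := by
  rw [map_add, map_one, frobA_X]
  ring

theorem frobA_algebraMap (a : WittVector p κ) :
    frobA p κ d S (algebraMap _ (AA p S) a) =
      algebraMap _ (AA p S) (WittVector.frobenius a) := by
  rw [algebraMap_AA, frobA_C, ← algebraMap_RR p κ d S, frobR_algebraMap, frobSq, sqLift_C,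
    RingHom.comp_apply, algebraMap_RR, algebraMap_AA]

theorem frobA_rX (i : Fin d) :
    frobA p κ d S (C (rX p κ d S i : RR p S)) = C (rX p κ d S i : RR p S) ^ p := by
  rw [frobA_C, ← rX_val p κ d S, frobR_algebraMap, frobSq, sqLift_X, Units.val_pow_eq_pow_val,
    map_pow, map_pow]

theorem qPow_pow {R : Type*} [CommRing R] (z : ℤ_[p] →+* R) (a : ℤ_[p]) (n : ℕ) :
    qPow z (n * a) = qPow z a ^ n := by
  have := map_pow (qHom z) (Multiplicative.ofAdd a) n
  rw [← ofAdd_nsmul, nsmul_eq_mul] at this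
  exact this

theorem frobA_qPow (b : ℤ_[p]) :
    frobA p κ d S (qPow (zpR p κ S) b) = qPow (zpR p κ S) b ^ p := by
  rw [map_qPow (zpR p κ S) (frobA p κ d S) p _ b, qPow_pow]
  rw [frobA_one_add_X, ← qPow_one (zpR p κ S), ← qPow_pow, mul_one]

theorem constantCoeff_frobA (f : AA p S) :
    constantCoeff (frobA p κ d S f) = frobR p κ d S (constantCoeff f) := by
  have : (constantCoeff (R := RR p S)).comp (frobA p κ d S) =
      (frobR p κ d S).comp constantCoeff := by
    refine ps_hom_ext (⊥ : Ideal (RR p S)) _ _ ?_ (fun r => ?_) ?_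
    · rw [RingHom.comp_apply, frobA_X]
      simp
    · rw [RingHom.comp_apply, RingHom.comp_apply, frobA_C, constantCoeff_C, constantCoeff_C]
    · rw [RingHom.comp_apply, RingHom.comp_apply, frobA_X]
      simp
  exact congr($this f)

theorem gammaA_frobA (g : GammaR p d) (f : AA p S) :
    gammaA p κ d S g (frobA p κ d S f) = frobA p κ d S (gammaA p κ d S g f) := by
  have : (gammaA p κ d S g).comp (frobA p κ d S) = (frobA p κ d S).comp (gammaA p κ d S g) := by
    refine hom_ext_A p κ d S _ _ (fun a => ?_) (fun i => ?_) (fun x => ?_) ?_ ?_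
    · simp only [gammaA_algebraMap, RingHom.comp_apply, frobA_algebraMap]
    · rw [RingHom.comp_apply, RingHom.comp_apply, frobA_rX, map_pow, gammaA_rX, map_mul,
        frobA_qPow, frobA_rX, mul_pow]
    · simp only [constantCoeff_gammaA, constantCoeff_frobA, RingHom.comp_apply]
    · rw [RingHom.comp_apply, RingHom.comp_apply, frobA_one_add_X, map_pow, gammaA_one_add_X,
        frobA_qPow]
    · rw [RingHom.comp_apply, constantCoeff_gammaA, constantCoeff_frobA, constantCoeff_X, map_zero]
  exact congr($this f)

/-- `φ` lifts the absolute Frobenius of `A_R / p`. -/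
theorem frobA_sub_pow_mem (f : AA p S) :
    frobA p κ d S f - f ^ p ∈ Ideal.span {(p : AA p S)} := by
  set π := PowerSeries.map (Ideal.Quotient.mk (Ideal.span {(p : RR p S)}))
  have h0 : (p : PowerSeries (RR p S ⧸ Ideal.span {(p : RR p S)})) = 0 := by
    rw [← map_natCast (C (R := RR p S ⧸ Ideal.span {(p : RR p S)})), quot_natCast_eq_zero,
      map_zero]
  have key : π.comp (frobA p κ d S) = (absFrob p h0).comp π := by
    have h1 : π (frobA p κ d S X) = absFrob p h0 (π X) := by
      rw [frobA_X, map_sub, map_pow, map_one, ← absFrob_apply p h0, map_add, map_add, map_one,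
        map_one, add_sub_cancel_left]
    refine ps_hom_ext (Ideal.span {X}) _ _ ?_ (fun r => ?_) h1
    · rw [RingHom.comp_apply, h1, map_X, absFrob_apply]
      exact Ideal.pow_mem_of_mem _ (Ideal.mem_span_singleton_self _) _
        (Nat.Prime.pos Fact.out)
    · rw [RingHom.comp_apply, RingHom.comp_apply, frobA_C, map_C, map_C, absFrob_apply, ← map_pow,
        ← map_pow]
      congr 1
      exact Ideal.Quotient.eq.mpr (frobR_sub_pow_mem p κ d r)
  have h2 : π (frobA p κ d S f - f ^ p) = 0 := by
    rw [map_sub, map_pow, sub_eq_zero]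
    exact congr($key f)
  have h3 : ∀ k, ∃ c, c * (p : RR p S) = coeff k (frobA p κ d S f - f ^ p) := by
    intro k
    rw [← Ideal.mem_span_singleton', ← Ideal.Quotient.eq_zero_iff_mem, ← coeff_map]
    exact congr(coeff k $h2)
  choose c hc using h3
  rw [Ideal.mem_span_singleton']
  refine ⟨PowerSeries.mk c, ?_⟩
  ext k
  rw [← hc, ← map_natCast (C (R := RR p S)), coeff_mul_C, coeff_mk]

end

end AR

/-! ### The `δ`-subalgebra generated by `J / D` -/

section Envelope

variable (p : ℕ) {B : Type*} [CommRing B] (φ : B →+* B) (D : B) (J : Ideal B)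

/-- The multiplicative set generated by `p` and all `φⁿ(D)`. -/
def envM : Submonoid B := Submonoid.closure ({(p : B)} ∪ Set.range fun n : ℕ => (φ^[n]) D)

/-- The localization `B[1/p, 1/φⁿ(D) for n ≥ 0]`. -/
abbrev EnvL : Type _ := Localization (envM p φ D)

theorem envM_le_comap_frob : envM p φ D ≤ (envM p φ D).comap φ := by
  refine Submonoid.closure_le.mpr ?_
  rintro _ (rfl | ⟨n, rfl⟩)
  · refine Submonoid.subset_closure (Or.inl ?_)
    simp
  · refine Submonoid.subset_closure (Or.inr ⟨n + 1, ?_⟩)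
    exact Function.iterate_succ_apply' φ n D

theorem envM_le_comap (g : B →+* B) (hg : ∀ x, g (φ x) = φ (g x)) (hD : g D = D) :
    envM p φ D ≤ (envM p φ D).comap g := by
  refine Submonoid.closure_le.mpr ?_
  rintro _ (rfl | ⟨n, rfl⟩)
  · refine Submonoid.subset_closure (Or.inl ?_)
    simp
  · refine Submonoid.subset_closure (Or.inr ⟨n, ?_⟩)
    have : Function.Commute g φ := hg
    change (φ^[n]) D = g ((φ^[n]) D)
    rw [(this.iterate_right n).eq, hD]

/-- The endomorphism of the localization induced by `φ`. -/
def envLFrob : EnvL p φ D →+* EnvL p φ D :=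
  IsLocalization.map (EnvL p φ D) φ (envM_le_comap_frob p φ D)

/-- The endomorphism of the localization induced by a ring endomorphism `g` which commutes with
`φ` and fixes `D`. -/
def envLMap (g : B →+* B) (hg : ∀ x, g (φ x) = φ (g x)) (hD : g D = D) :
    EnvL p φ D →+* EnvL p φ D :=
  IsLocalization.map (EnvL p φ D) g (envM_le_comap p φ D g hg hD)

theorem envLMap_frob (g : B →+* B) (hg : ∀ x, g (φ x) = φ (g x)) (hD : g D = D)
    (x : EnvL p φ D) :
    envLMap p φ D g hg hD (envLFrob p φ D x) = envLFrob p φ D (envLMap p φ D g hg hD x) := by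
  have : (envLMap p φ D g hg hD).comp (envLFrob p φ D) =
      (envLFrob p φ D).comp (envLMap p φ D g hg hD) := by
    refine IsLocalization.ringHom_ext (envM p φ D) (RingHom.ext fun b => ?_)
    simp only [RingHom.comp_apply, envLMap, envLFrob, IsLocalization.map_eq, hg]
  exact congr($this x)

/-- A `B`-subalgebra of `B[1/p, 1/φⁿ(D)]` which contains `J / D` and which is closed under
`δ(x) = (φ(x) - x ^ p) / p`. -/
def IsEnv (T : Subalgebra B (EnvL p φ D)) : Prop :=
  (∀ j ∈ J, ∀ y, algebraMap B (EnvL p φ D) D * y = algebraMap B (EnvL p φ D) j → y ∈ T) ∧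
    ∀ x ∈ T, ∀ y, (p : EnvL p φ D) * y = envLFrob p φ D x - x ^ p → y ∈ T

/-- The `δ`-subalgebra over `B` of `B[1/p, 1/φⁿ(D) for n ≥ 0]` generated by `J / D`. -/
def env : Subalgebra B (EnvL p φ D) := sInf {T | IsEnv p φ D J T}

theorem isEnv_env : IsEnv p φ D J (env p φ D J) := by
  constructor
  · intro j hj y hy
    rw [env, Algebra.mem_sInf]
    exact fun T hT => hT.1 j hj y hy
  · intro x hx y hy
    rw [env, Algebra.mem_sInf] at hx ⊢
    exact fun T hT => hT.2 x (hx T hT) y hy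

theorem isUnit_natCast_envL : IsUnit (p : EnvL p φ D) := by
  have := IsLocalization.map_units (EnvL p φ D)
    (⟨(p : B), Submonoid.subset_closure (Or.inl rfl)⟩ : envM p φ D)
  simpa using this

theorem env_frob_mem (x : EnvL p φ D) (hx : x ∈ env p φ D J) :
    envLFrob p φ D x ∈ env p φ D J := by
  obtain ⟨u, hu⟩ := isUnit_natCast_envL p φ D
  have h := (isEnv_env p φ D J).2 x hx (u⁻¹ * (envLFrob p φ D x - x ^ p)) (by rw [← hu]; simp)
  have e : envLFrob p φ D x = x ^ p + (p : EnvL p φ D) *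
      (u⁻¹ * (envLFrob p φ D x - x ^ p)) := by rw [← hu]; simp
  rw [e]
  exact Subalgebra.add_mem _ (Subalgebra.pow_mem _ hx p)
    (Subalgebra.mul_mem _ (natCast_mem _ p) h)

theorem env_map_mem (g : B →+* B) (hg : ∀ x, g (φ x) = φ (g x)) (hD : g D = D)
    (hJ : ∀ j ∈ J, g j ∈ J) (x : EnvL p φ D) (hx : x ∈ env p φ D J) :
    envLMap p φ D g hg hD x ∈ env p φ D J := by
  let T : Subalgebra B (EnvL p φ D) :=
    { (env p φ D J).toSubring.comap (envLMap p φ D g hg hD) with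
      algebraMap_mem' := fun b => by
        change envLMap p φ D g hg hD (algebraMap B _ b) ∈ env p φ D J
        rw [envLMap, IsLocalization.map_eq]
        exact Subalgebra.algebraMap_mem _ _ }
  have hT : IsEnv p φ D J T := by
    constructor
    · intro j hj y hy
      refine (isEnv_env p φ D J).1 (g j) (hJ j hj) _ ?_
      have := congrArg (envLMap p φ D g hg hD) hy
      rw [map_mul] at this
      rw [envLMap, IsLocalization.map_eq, IsLocalization.map_eq, hD] at this
      exact this
    · intro z hz y hy
      refine (isEnv_env p φ D J).2 _ hz _ ?_
      have := congrArg (envLMap p φ D g hg hD) hy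
      rw [map_mul, map_natCast, map_sub, map_pow, envLMap_frob] at this
      exact this
  have hle : env p φ D J ≤ T := sInf_le hT
  exact hle hx

/-- The Frobenius of the `δ`-subalgebra. -/
def envFrob : env p φ D J →+* env p φ D J :=
  ((envLFrob p φ D).comp (algebraMap (env p φ D J) (EnvL p φ D))).codRestrict (env p φ D J)
    fun x => env_frob_mem p φ D J _ x.2

theorem envFrob_algebraMap (b : B) :
    envFrob p φ D J (algebraMap B _ b) = algebraMap B _ (φ b) := by
  apply Subtype.ext
  change envLFrob p φ D (algebraMap B _ b) = algebraMap B _ (φ b)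
  rw [envLFrob, IsLocalization.map_eq]

/-- The endomorphism of the `δ`-subalgebra induced by a ring endomorphism `g` which commutes with
`φ`, fixes `D` and preserves `J`. -/
def envMap (g : B →+* B) (hg : ∀ x, g (φ x) = φ (g x)) (hD : g D = D)
    (hJ : ∀ j ∈ J, g j ∈ J) : env p φ D J →+* env p φ D J :=
  ((envLMap p φ D g hg hD).comp (algebraMap (env p φ D J) (EnvL p φ D))).codRestrict
    (env p φ D J) fun x => env_map_mem p φ D J g hg hD hJ _ x.2

theorem envMap_algebraMap (g : B →+* B) (hg : ∀ x, g (φ x) = φ (g x)) (hD : g D = D)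
    (hJ : ∀ j ∈ J, g j ∈ J) (b : B) :
    envMap p φ D J g hg hD hJ (algebraMap B _ b) = algebraMap B _ (g b) := by
  apply Subtype.ext
  change envLMap p φ D g hg hD (algebraMap B _ b) = algebraMap B _ (g b)
  rw [envLMap, IsLocalization.map_eq]

end Envelope

/-! ### The ring `A_R(1)` and its quotient by `p₁(μ)` -/

section SelfProduct

open PowerSeries

variable (p : ℕ) [Fact p.Prime] (κ : Type u) [Field κ] [CharP κ p] (d : ℕ)
  (S : Type v) [CommRing S] [Algebra (WittVector p κ) S]

/-- The tensor product `A_R ⊗_{W(κ)} A_R`. -/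
def TT : Type _ := AA p S ⊗[WittVector p κ] AA p S

instance : CommRing (TT p κ S) := inferInstanceAs (CommRing (AA p S ⊗[WittVector p κ] AA p S))

/-- The map `a ↦ a ⊗ 1` to the tensor product. -/
def inL : AA p S →+* TT p κ S :=
  (Algebra.TensorProduct.includeLeftRingHom : AA p S →+* AA p S ⊗[WittVector p κ] AA p S)

/-- The map `a ↦ 1 ⊗ a` to the tensor product. -/
def inR : AA p S →+* TT p κ S :=
  ((Algebra.TensorProduct.includeRight : AA p S →ₐ[WittVector p κ]
    AA p S ⊗[WittVector p κ] AA p S) : AA p S →+* AA p S ⊗[WittVector p κ] AA p S)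

theorem tt_induction (P : TT p κ S → Prop) (h0 : P 0) (ha : ∀ x y, P x → P y → P (x + y))
    (hm : ∀ a b, P (inL p κ S a * inR p κ S b)) (x : TT p κ S) : P x := by
  refine TensorProduct.induction_on x h0 (fun a b => ?_) ha
  have e : a ⊗ₜ[WittVector p κ] b = (a ⊗ₜ[WittVector p κ] (1 : AA p S)) *
      ((1 : AA p S) ⊗ₜ[WittVector p κ] b) := by
    rw [Algebra.TensorProduct.tmul_mul_tmul, mul_one, one_mul]
  rw [e]
  exact hm a b

/-- The ideal `(p, μ ⊗ 1)` of `A_R ⊗_{W(κ)} A_R`. -/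
abbrev idTT : Ideal (TT p κ S) :=
  Ideal.span {(p : TT p κ S), inL p κ S X}

theorem idTT_fg : (idTT p κ S).FG :=
  Submodule.fg_span (Set.toFinite _)

/-- The completed tensor product of `A_R` with itself over `W(κ)`: the `(p, μ ⊗ 1)`-adic
completion of `A_R ⊗_{W(κ)} A_R`. -/
def BB : Type _ := AdicCompletion (idTT p κ S) (TT p κ S)

instance : CommRing (BB p κ S) :=
  inferInstanceAs (CommRing (AdicCompletion (idTT p κ S) (TT p κ S)))

/-- The canonical map from `A_R ⊗_{W(κ)} A_R` to its completion. -/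
def ofTT : TT p κ S →+* BB p κ S :=
  algebraMap (TT p κ S) (AdicCompletion (idTT p κ S) (TT p κ S))

/-- The map `a ↦ a ⊗ 1`. -/
def i1 : AA p S →+* BB p κ S :=
  (ofTT p κ S).comp (inL p κ S)

/-- The map `a ↦ 1 ⊗ a`. -/
def i2 : AA p S →+* BB p κ S :=
  (ofTT p κ S).comp (inR p κ S)

/-- Ring homomorphisms out of the completed tensor product sending `p` and `μ ⊗ 1` into its ideal
of definition are determined on pure tensors. -/
theorem bb_hom_ext (F G : BB p κ S →+* BB p κ S)
    (hX : ∃ c, F (i1 p κ S X) = i1 p κ S X * c) (h1 : ∀ a, F (i1 p κ S a) = G (i1 p κ S a))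
    (h2 : ∀ a, F (i2 p κ S a) = G (i2 p κ S a)) : F = G := by
  have hc : IsAdicComplete ((idTT p κ S).map (ofTT p κ S)) (BB p κ S) :=
    isAdicComplete_map (idTT_fg p κ S)
  refine adic_hom_ext (idTT_fg p κ S) ((idTT p κ S).map (ofTT p κ S)) F G ?_ ?_
  · have hle : (idTT p κ S).map (F.comp (ofTT p κ S)) ≤ (idTT p κ S).map (ofTT p κ S) := by
      rw [Ideal.map_span, Ideal.span_le]
      rintro _ ⟨x, rfl | rfl, rfl⟩
      · rw [map_natCast, ← map_natCast (ofTT p κ S)]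
        exact Ideal.mem_map_of_mem _ (Ideal.subset_span (by simp))
      · obtain ⟨c, hc⟩ := hX
        refine Set.mem_of_eq_of_mem hc ?_
        exact Ideal.mul_mem_right _ _ (Ideal.mem_map_of_mem _ (Ideal.subset_span (by simp)))
    exact fun a ha => hle (Ideal.mem_map_of_mem (F.comp (ofTT p κ S)) ha)
  · intro x
    change F (ofTT p κ S x) = G (ofTT p κ S x)
    refine tt_induction p κ S (fun x => F (ofTT p κ S x) = G (ofTT p κ S x)) ?_ ?_ ?_ x
    · simp
    · intro x y hx hy
      simp only [map_add, hx, hy]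
    · intro a b
      rw [map_mul, map_mul, map_mul]
      exact congrArg₂ (· * ·) (h1 a) (h2 b)

variable [Algebra (RSq p κ d) S] [IsScalarTower (WittVector p κ) (RSq p κ d) S]
  [Algebra.Etale (RSq p κ d) S]

/-- The action of `1 × g` on `A_R ⊗_{W(κ)} A_R`. -/
def gammaTT (g : GammaR p d) : TT p κ S →+* TT p κ S :=
  Algebra.TensorProduct.mapRingHom (RingHom.id (WittVector p κ)) (RingHom.id _)
    (gammaA p κ d S g) rfl (RingHom.ext (gammaA_algebraMap p κ d S g))

theorem gammaTT_inL (g : GammaR p d) (a : AA p S) :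
    gammaTT p κ d S g (inL p κ S a) = inL p κ S a :=
  (Algebra.TensorProduct.mapRingHom_tmul _ _ _ _ _ a 1).trans (by rw [map_one]; rfl)

theorem gammaTT_inR (g : GammaR p d) (a : AA p S) :
    gammaTT p κ d S g (inR p κ S a) = inR p κ S (gammaA p κ d S g a) :=
  (Algebra.TensorProduct.mapRingHom_tmul _ _ _ _ _ 1 a).trans (by rw [map_one]; rfl)

theorem gammaTT_idTT (g : GammaR p d) :
    (idTT p κ S).map (gammaTT p κ d S g) ≤ idTT p κ S := by
  rw [Ideal.map_span, Ideal.span_le]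
  rintro _ ⟨x, rfl | rfl, rfl⟩
  · rw [map_natCast]
    exact Ideal.subset_span (by simp)
  · rw [gammaTT_inL]
    exact Ideal.subset_span (by simp)

/-- The action of `1 × g` on the completed tensor product. -/
def gammaBB (g : GammaR p d) : BB p κ S →+* BB p κ S :=
  adicMap (idTT p κ S) (idTT p κ S) (gammaTT p κ d S g) (gammaTT_idTT p κ d S g)

theorem gammaBB_ofTT (g : GammaR p d) (x : TT p κ S) :
    gammaBB p κ d S g (ofTT p κ S x) = ofTT p κ S (gammaTT p κ d S g x) :=
  adicMap_of _ _ _ _ x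

theorem gammaBB_i1 (g : GammaR p d) (a : AA p S) :
    gammaBB p κ d S g (i1 p κ S a) = i1 p κ S a :=
  (gammaBB_ofTT p κ d S g _).trans (congrArg (ofTT p κ S) (gammaTT_inL p κ d S g a))

theorem gammaBB_i2 (g : GammaR p d) (a : AA p S) :
    gammaBB p κ d S g (i2 p κ S a) = i2 p κ S (gammaA p κ d S g a) :=
  (gammaBB_ofTT p κ d S g _).trans (congrArg (ofTT p κ S) (gammaTT_inR p κ d S g a))

theorem gammaA_X_eq (g : GammaR p d) : ∃ c : AA p S, gammaA p κ d S g X = X * c := by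
  have := gammaA_sub_mem p κ d S g X
  have h2 := Ideal.add_mem _ this (Ideal.mem_span_singleton_self (X : AA p S))
  rw [sub_add_cancel] at h2
  obtain ⟨c, hc⟩ := Ideal.mem_span_singleton.mp h2
  exact ⟨c, hc⟩

variable [PerfectRing κ p]

/-- The element `[p]_q = 1 + q + … + q ^ (p - 1)` of `A_R`, where `q = 1 + μ`. -/
def pQ : AA p S := ∑ i ∈ Finset.range p, (1 + X) ^ i

theorem X_mul_pQ : X * pQ p S = frobA p κ d S X := by
  rw [frobA_X, pQ, mul_comm, ← geom_sum_mul, add_sub_cancel_left]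

/-- The tensor product Frobenius. -/
def frobTT : TT p κ S →+* TT p κ S :=
  Algebra.TensorProduct.mapRingHom WittVector.frobenius
    (frobA p κ d S) (frobA p κ d S) (RingHom.ext (frobA_algebraMap p κ d S))
    (RingHom.ext (frobA_algebraMap p κ d S))

theorem frobTT_inL (a : AA p S) :
    frobTT p κ d S (inL p κ S a) = inL p κ S (frobA p κ d S a) :=
  (Algebra.TensorProduct.mapRingHom_tmul _ _ _ _ _ a 1).trans (by rw [map_one]; rfl)

theorem frobTT_inR (a : AA p S) :
    frobTT p κ d S (inR p κ S a) = inR p κ S (frobA p κ d S a) :=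
  (Algebra.TensorProduct.mapRingHom_tmul _ _ _ _ _ 1 a).trans (by rw [map_one]; rfl)

theorem frobTT_idTT : (idTT p κ S).map (frobTT p κ d S) ≤ idTT p κ S := by
  rw [Ideal.map_span, Ideal.span_le]
  rintro _ ⟨x, rfl | rfl, rfl⟩
  · rw [map_natCast]
    exact Ideal.subset_span (by simp)
  · rw [frobTT_inL, ← X_mul_pQ, map_mul]
    exact Ideal.mul_mem_right _ _ (Ideal.subset_span (by simp))

/-- The Frobenius of the completed tensor product. -/
def frobBB : BB p κ S →+* BB p κ S :=
  adicMap (idTT p κ S) (idTT p κ S) (frobTT p κ d S) (frobTT_idTT p κ d S)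

theorem frobBB_ofTT (x : TT p κ S) :
    frobBB p κ d S (ofTT p κ S x) = ofTT p κ S (frobTT p κ d S x) :=
  adicMap_of _ _ _ _ x

theorem frobBB_i1 (a : AA p S) :
    frobBB p κ d S (i1 p κ S a) = i1 p κ S (frobA p κ d S a) :=
  (frobBB_ofTT p κ d S _).trans (congrArg (ofTT p κ S) (frobTT_inL p κ d S a))

theorem frobBB_i2 (a : AA p S) :
    frobBB p κ d S (i2 p κ S a) = i2 p κ S (frobA p κ d S a) :=
  (frobBB_ofTT p κ d S _).trans (congrArg (ofTT p κ S) (frobTT_inR p κ d S a))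

theorem gammaBB_frobBB (g : GammaR p d) (x : BB p κ S) :
    gammaBB p κ d S g (frobBB p κ d S x) = frobBB p κ d S (gammaBB p κ d S g x) := by
  have : (gammaBB p κ d S g).comp (frobBB p κ d S) =
      (frobBB p κ d S).comp (gammaBB p κ d S g) := by
    refine bb_hom_ext p κ S _ _ ⟨i1 p κ S (pQ p S), ?_⟩ (fun a => ?_) fun a => ?_
    · rw [RingHom.comp_apply, frobBB_i1, gammaBB_i1, ← X_mul_pQ, map_mul]
    · simp only [RingHom.comp_apply, frobBB_i1, gammaBB_i1]
    · simp only [RingHom.comp_apply, frobBB_i2, gammaBB_i2, gammaA_frobA]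
  exact congr($this x)

/-- The ideal `J` generated by `[p]_q ⊗ 1`, `1 ⊗ [p]_q` and `φ(r) ⊗ 1 - 1 ⊗ φ(r)` for `r ∈ R`.
It is the kernel of the surjection from the completed tensor product `A_R ⊗_{W(κ)} A_R` to
`A_R / [p]_q ⊗_R A_R / [p]_q`, where `A_R / [p]_q` is an `R`-algebra via `φ`. -/
def idJ : Ideal (BB p κ S) :=
  Ideal.span ({i1 p κ S (pQ p S), i2 p κ S (pQ p S)} ∪ Set.range fun r : RR p S =>
    i1 p κ S (frobA p κ d S (C r)) - i2 p κ S (frobA p κ d S (C r)))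

theorem gammaA_pQ (g : GammaR p d) : pQ p S ∣ gammaA p κ d S g (pQ p S) := by
  obtain ⟨c, hc⟩ := gammaA_X_eq p κ d S g
  obtain ⟨c', hc'⟩ := gammaA_X_eq p κ d S g⁻¹
  have h1 : X * (c * gammaA p κ d S g c') = X * 1 := by
    rw [← mul_assoc, ← hc, ← map_mul, ← hc', ← RingHom.comp_apply, ← gammaA_mul, mul_inv_cancel,
      gammaA_one, mul_one, RingHom.id_apply]
  have h2 : c * gammaA p κ d S g c' = 1 := X_mul_cancel h1
  have h3 : X * (c * gammaA p κ d S g (pQ p S)) = X * (pQ p S * frobA p κ d S c) := by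
    rw [← mul_assoc, ← hc, ← map_mul, X_mul_pQ p κ d, gammaA_frobA, hc, map_mul,
      ← X_mul_pQ p κ d, mul_assoc]
  have h4 : c * gammaA p κ d S g (pQ p S) = pQ p S * frobA p κ d S c := X_mul_cancel h3
  refine ⟨frobA p κ d S c * gammaA p κ d S g c', ?_⟩
  rw [← mul_assoc, ← h4, mul_right_comm, h2, one_mul]

theorem gammaBB_idJ (g : GammaR p d) (j : BB p κ S) (hj : j ∈ idJ p κ d S) :
    gammaBB p κ d S g j ∈ idJ p κ d S := by
  have h1 : i1 p κ S (pQ p S) ∈ idJ p κ d S := Ideal.subset_span (by simp)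
  have h2 : i2 p κ S (pQ p S) ∈ idJ p κ d S := Ideal.subset_span (by simp)
  have hle : idJ p κ d S ≤ (idJ p κ d S).comap (gammaBB p κ d S g) := by
    refine Ideal.span_le.mpr ?_
    rintro _ ((rfl | rfl) | ⟨r, rfl⟩)
    · change gammaBB p κ d S g _ ∈ idJ p κ d S
      rwa [gammaBB_i1]
    · change gammaBB p κ d S g _ ∈ idJ p κ d S
      rw [gammaBB_i2]
      obtain ⟨c, hc⟩ := gammaA_pQ p κ d S g
      rw [hc, map_mul]
      exact Ideal.mul_mem_right _ _ h2
    · change gammaBB p κ d S g _ ∈ idJ p κ d S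
      obtain ⟨s, hs⟩ := Ideal.mem_span_singleton.mp (gammaA_sub_mem p κ d S g (C r))
      rw [map_sub, gammaBB_i1, gammaBB_i2, gammaA_frobA, sub_eq_iff_eq_add.mp hs, map_add,
        map_mul (frobA p κ d S), ← X_mul_pQ, map_add, map_mul, map_mul, add_comm, ← sub_sub]
      refine Ideal.sub_mem _ (Ideal.subset_span (Or.inr ⟨r, rfl⟩)) ?_
      exact Ideal.mul_mem_right _ _ (Ideal.mul_mem_left _ _ h2)
  exact hle hj

/-- The `δ`-subalgebra `E` generated by `J / ([p]_q ⊗ 1)` over the completed tensor product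
`A_R ⊗_{W(κ)} A_R`. -/
def EE : Type _ := env p (frobBB p κ d S) (i1 p κ S (pQ p S)) (idJ p κ d S)

instance : CommRing (EE p κ d S) :=
  inferInstanceAs (CommRing (env p (frobBB p κ d S) (i1 p κ S (pQ p S)) (idJ p κ d S)))

/-- The structure map to `E`. -/
def ofBB : BB p κ S →+* EE p κ d S :=
  algebraMap (BB p κ S) (env p (frobBB p κ d S) (i1 p κ S (pQ p S)) (idJ p κ d S))

/-- The Frobenius of `E`. -/
def frobEE : EE p κ d S →+* EE p κ d S :=
  envFrob p (frobBB p κ d S) (i1 p κ S (pQ p S)) (idJ p κ d S)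

/-- The action of `1 × g` on `E`. -/
def gammaEE (g : GammaR p d) : EE p κ d S →+* EE p κ d S :=
  envMap p (frobBB p κ d S) (i1 p κ S (pQ p S)) (idJ p κ d S) (gammaBB p κ d S g)
    (gammaBB_frobBB p κ d S g) (gammaBB_i1 p κ d S g _) (gammaBB_idJ p κ d S g)

theorem frobEE_ofBB (b : BB p κ S) :
    frobEE p κ d S (ofBB p κ d S b) = ofBB p κ d S (frobBB p κ d S b) :=
  envFrob_algebraMap _ _ _ _ b

theorem gammaEE_ofBB (g : GammaR p d) (b : BB p κ S) :
    gammaEE p κ d S g (ofBB p κ d S b) = ofBB p κ d S (gammaBB p κ d S g b) :=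
  envMap_algebraMap _ _ _ _ _ _ _ _ b

/-- The ideal `(p, μ ⊗ 1)` of `E`. -/
def idEE : Ideal (EE p κ d S) :=
  Ideal.span {(p : EE p κ d S), ofBB p κ d S (i1 p κ S X)}

theorem frobEE_idEE : (idEE p κ d S).map (frobEE p κ d S) ≤ idEE p κ d S := by
  rw [idEE, Ideal.map_span, Ideal.span_le]
  rintro _ ⟨x, rfl | rfl, rfl⟩
  · rw [map_natCast]
    exact Ideal.subset_span (by simp)
  · rw [frobEE_ofBB, frobBB_i1, ← X_mul_pQ, map_mul, map_mul]
    exact Ideal.mul_mem_right _ _ (Ideal.subset_span (by simp))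

theorem gammaEE_idEE (g : GammaR p d) :
    (idEE p κ d S).map (gammaEE p κ d S g) ≤ idEE p κ d S := by
  rw [idEE, Ideal.map_span, Ideal.span_le]
  rintro _ ⟨x, rfl | rfl, rfl⟩
  · rw [map_natCast]
    exact Ideal.subset_span (by simp)
  · rw [gammaEE_ofBB, gammaBB_i1]
    exact Ideal.subset_span (by simp)

/-- The ring `A_R(1)`: the `(p, μ ⊗ 1)`-adic completion of `E`. -/
def A1 : Type _ := AdicCompletion (idEE p κ d S) (EE p κ d S)

instance : CommRing (A1 p κ d S) :=
  inferInstanceAs (CommRing (AdicCompletion (idEE p κ d S) (EE p κ d S)))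

/-- The canonical map from `E` to its completion. -/
def ofEE : EE p κ d S →+* A1 p κ d S :=
  algebraMap (EE p κ d S) (AdicCompletion (idEE p κ d S) (EE p κ d S))

/-- The map `p₁ : A_R → A_R(1)`, `a ↦ a ⊗ 1`. -/
def p1 : AA p S →+* A1 p κ d S := (ofEE p κ d S).comp ((ofBB p κ d S).comp (i1 p κ S))

/-- The map `p₂ : A_R → A_R(1)`, `a ↦ 1 ⊗ a`. -/
def p2 : AA p S →+* A1 p κ d S := (ofEE p κ d S).comp ((ofBB p κ d S).comp (i2 p κ S))

/-- The Frobenius of `A_R(1)`. -/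
def frobA1 : A1 p κ d S →+* A1 p κ d S :=
  adicMap (idEE p κ d S) (idEE p κ d S) (frobEE p κ d S) (frobEE_idEE p κ d S)

/-- The action of `1 × g` on `A_R(1)`. -/
def gammaA1 (g : GammaR p d) : A1 p κ d S →+* A1 p κ d S :=
  adicMap (idEE p κ d S) (idEE p κ d S) (gammaEE p κ d S g) (gammaEE_idEE p κ d S g)

theorem frobA1_ofEE (x : EE p κ d S) :
    frobA1 p κ d S (ofEE p κ d S x) = ofEE p κ d S (frobEE p κ d S x) :=
  adicMap_of _ _ _ _ x

theorem gammaA1_ofEE (g : GammaR p d) (x : EE p κ d S) :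
    gammaA1 p κ d S g (ofEE p κ d S x) = ofEE p κ d S (gammaEE p κ d S g x) :=
  adicMap_of _ _ _ _ x

theorem frobA1_p1 (a : AA p S) :
    frobA1 p κ d S (p1 p κ d S a) = p1 p κ d S (frobA p κ d S a) := by
  simp only [p1, RingHom.comp_apply, frobA1_ofEE, frobEE_ofBB, frobBB_i1]

theorem gammaA1_p1 (g : GammaR p d) (a : AA p S) :
    gammaA1 p κ d S g (p1 p κ d S a) = p1 p κ d S a := by
  simp only [p1, RingHom.comp_apply, gammaA1_ofEE, gammaEE_ofBB, gammaBB_i1]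

/-- The ring `A_R(1) / p₁(μ)`. -/
abbrev A1Mod : Type _ := A1 p κ d S ⧸ Ideal.span {p1 p κ d S X}

/-- The Frobenius of `A_R(1) / p₁(μ)`. -/
def frobA1Mod : A1Mod p κ d S →+* A1Mod p κ d S :=
  Ideal.quotientMap _ (frobA1 p κ d S) (by
    rw [Ideal.span_le]
    rintro _ rfl
    change frobA1 p κ d S (p1 p κ d S X) ∈ Ideal.span _
    rw [frobA1_p1, ← X_mul_pQ, map_mul]
    exact Ideal.mul_mem_right _ _ (Ideal.mem_span_singleton_self _))

/-- The action of `1 × g` on `A_R(1) / p₁(μ)`. -/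
def gammaA1Mod (g : GammaR p d) : A1Mod p κ d S →+* A1Mod p κ d S :=
  Ideal.quotientMap _ (gammaA1 p κ d S g) (by
    rw [Ideal.span_le]
    rintro _ rfl
    change gammaA1 p κ d S g (p1 p κ d S X) ∈ Ideal.span _
    rw [gammaA1_p1]
    exact Ideal.mem_span_singleton_self _)

/-- The composition of `p₁` with the projection `A_R(1) → A_R(1) / p₁(μ)`. -/
def p1Mod : AA p S →+* A1Mod p κ d S := (Ideal.Quotient.mk _).comp (p1 p κ d S)

/-- The composition of `p₂` with the projection `A_R(1) → A_R(1) / p₁(μ)`; it makes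
`A_R(1) / p₁(μ)` an `A_R`-algebra. -/
def p2Mod : AA p S →+* A1Mod p κ d S := (Ideal.Quotient.mk _).comp (p2 p κ d S)

end SelfProduct

/-! ### The divided power algebra -/

section DividedPowers

open PowerSeries

variable (p : ℕ) [Fact p.Prime] (d : ℕ) (S : Type v) [CommRing S]

/-- The ring `A_R[1/p]`. -/
abbrev AL : Type _ := Localization.Away (p : AA p S)

/-- The polynomial ring `A_R[1/p][T₁, …, T_d]`. -/
abbrev MP : Type _ := MvPolynomial (Fin d) (AL p S)

/-- The divided power algebra `A_R[(μ ^ (p - 1) / p)^[k], T₁^[k₁], …, T_d^[k_d]]`: the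
`A_R`-subalgebra of `A_R[1/p][T₁, …, T_d]` generated by the elements
`μ ^ ((p - 1) k) / (p ^ k k!)` and `Tᵢ ^ k / k!`. -/
def pdAlg : Subalgebra (AA p S) (MP p d S) :=
  Algebra.adjoin (AA p S)
    ({x | ∃ k : ℕ, ((p ^ k * k.factorial : ℕ) : MP p d S) * x =
        algebraMap (AA p S) (MP p d S) X ^ ((p - 1) * k)} ∪
      {x | ∃ (i : Fin d) (k : ℕ), (k.factorial : MP p d S) * x = MvPolynomial.X i ^ k})

theorem pdAlg_mu {x : MP p d S} {k : ℕ} (h : ((p ^ k * k.factorial : ℕ) : MP p d S) * x =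
    algebraMap (AA p S) (MP p d S) X ^ ((p - 1) * k)) : x ∈ pdAlg p d S :=
  Algebra.subset_adjoin (Or.inl ⟨k, h⟩)

theorem pdAlg_T {x : MP p d S} {i : Fin d} {k : ℕ}
    (h : (k.factorial : MP p d S) * x = MvPolynomial.X i ^ k) : x ∈ pdAlg p d S :=
  Algebra.subset_adjoin (Or.inr ⟨i, k, h⟩)

theorem pdAlg_X (i : Fin d) : (MvPolynomial.X i : MP p d S) ∈ pdAlg p d S :=
  pdAlg_T p d S (i := i) (k := 1) (by simp)

theorem pdAlg_A (a : AA p S) : algebraMap (AA p S) (MP p d S) a ∈ pdAlg p d S :=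
  Subalgebra.algebraMap_mem _ a

theorem pdAlg_map_mem (F : MP p d S →+* MP p d S)
    (hA : ∀ a, F (algebraMap (AA p S) (MP p d S) a) ∈ pdAlg p d S)
    (hmu : ∀ (k : ℕ) (x : MP p d S), ((p ^ k * k.factorial : ℕ) : MP p d S) * x =
        algebraMap (AA p S) (MP p d S) X ^ ((p - 1) * k) → F x ∈ pdAlg p d S)
    (hT : ∀ (i : Fin d) (k : ℕ) (x : MP p d S),
      (k.factorial : MP p d S) * x = MvPolynomial.X i ^ k → F x ∈ pdAlg p d S) :
    ∀ x ∈ pdAlg p d S, F x ∈ pdAlg p d S := by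
  intro x hx
  refine Algebra.adjoin_induction (p := fun x _ => F x ∈ pdAlg p d S) ?_ hA ?_ ?_ hx
  · rintro x (⟨k, h⟩ | ⟨i, k, h⟩)
    · exact hmu k x h
    · exact hT i k x h
  · intro x y _ _ h1 h2
    rw [map_add]
    exact Subalgebra.add_mem _ h1 h2
  · intro x y _ _ h1 h2
    rw [map_mul]
    exact Subalgebra.mul_mem _ h1 h2

theorem isUnit_natCast_AA (κ : Type u) [Field κ] [CharP κ p] [Algebra (WittVector p κ) S] {n : ℕ} (h : ¬ p ∣ n) : IsUnit (n : AA p S) := by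
  have h1 : IsUnit (n : WittVector p κ) := by
    refine WittVector.isUnit_of_coeff_zero_ne_zero _ ?_
    rw [← WittVector.constantCoeff_apply, map_natCast]
    rwa [Ne, CharP.cast_eq_zero_iff κ p]
  simpa using h1.map (algebraMap (WittVector p κ) (AA p S))

theorem isUnit_natCast_MP (κ : Type u) [Field κ] [CharP κ p]
    [Algebra (WittVector p κ) S] {n : ℕ} (h : n ≠ 0) : IsUnit (n : MP p d S) := by
  obtain ⟨e, m, hm, rfl⟩ := Nat.exists_eq_pow_mul_and_not_dvd h p (Nat.Prime.ne_one Fact.out)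
  have h1 := (isUnit_natCast_AA p S κ hm).map (algebraMap (AA p S) (MP p d S))
  have h2 := (IsLocalization.Away.algebraMap_isUnit (S := AL p S) (p : AA p S)).map
    (algebraMap (AL p S) (MP p d S))
  rw [map_natCast] at h1
  rw [map_natCast, map_natCast] at h2
  rw [Nat.cast_mul, Nat.cast_pow]
  exact (h2.pow e).mul h1

/-- The divided powers of `μ` lie in the divided power algebra. -/
theorem exists_mu_divided (κ : Type u) [Field κ] [CharP κ p]
    [Algebra (WittVector p κ) S] (n : ℕ) : ∃ y ∈ pdAlg p d S,
    (n.factorial : MP p d S) * y = algebraMap (AA p S) (MP p d S) X ^ n := by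
  have hp : 1 < p := Nat.Prime.one_lt Fact.out
  set m := n / (p - 1) with hm
  obtain ⟨u, hu⟩ := pow_padicValNat_dvd (p := p) (n := n.factorial)
  set v := padicValNat p n.factorial with hv
  have hndvd : ¬ p ∣ u := by
    rintro ⟨w, rfl⟩
    refine pow_succ_padicValNat_not_dvd (p := p) (Nat.factorial_ne_zero n) ⟨w, ?_⟩
    rw [hv] at hu
    refine hu.trans ?_
    ring
  have hvm : v ≤ m := by
    rw [hm, Nat.le_div_iff_mul_le (by omega), mul_comm, hv, sub_one_mul_padicValNat_factorial]
    exact Nat.sub_le _ _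
  obtain ⟨u', hu'⟩ := isUnit_natCast_AA p S κ hndvd
  obtain ⟨t, ht⟩ := isUnit_natCast_MP p d S κ (n := p ^ m * m.factorial)
    (Nat.mul_ne_zero (pow_ne_zero _ (by omega)) (Nat.factorial_ne_zero m))
  set x : MP p d S := (t⁻¹ : (MP p d S)ˣ) * algebraMap (AA p S) (MP p d S) X ^ ((p - 1) * m)
  have hx : ((p ^ m * m.factorial : ℕ) : MP p d S) * x =
      algebraMap (AA p S) (MP p d S) X ^ ((p - 1) * m) := by
    rw [← ht, Units.mul_inv_cancel_left]
  refine ⟨algebraMap (AA p S) (MP p d S)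
    (X ^ (n % (p - 1)) * ((u'⁻¹ : (AA p S)ˣ) : AA p S) *
      ((p ^ (m - v) * m.factorial : ℕ) : AA p S)) * x,
    Subalgebra.mul_mem _ (pdAlg_A p d S _) (pdAlg_mu p d S hx), ?_⟩
  have e1 : (n.factorial : MP p d S) = algebraMap (AA p S) (MP p d S)
      (((p ^ v : ℕ) : AA p S) * (u' : AA p S)) := by
    rw [hu', ← Nat.cast_mul, ← hu, map_natCast]
  have e2 : (((p ^ v : ℕ) : AA p S) * (u' : AA p S)) *
      (X ^ (n % (p - 1)) * ((u'⁻¹ : (AA p S)ˣ) : AA p S) *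
        ((p ^ (m - v) * m.factorial : ℕ) : AA p S)) =
      X ^ (n % (p - 1)) * ((p ^ m * m.factorial : ℕ) : AA p S) := by
    have e3 : p ^ m = p ^ v * p ^ (m - v) := by rw [← pow_add, Nat.add_sub_cancel' hvm]
    rw [e3]
    push_cast
    have := u'.mul_inv
    linear_combination ((X : AA p S) ^ (n % (p - 1)) * (p : AA p S) ^ v * (p : AA p S) ^ (m - v) *
      (m.factorial : AA p S)) * this
  rw [e1, ← mul_assoc, ← map_mul, e2, map_mul, map_natCast, mul_assoc, hx, map_pow, ← pow_add,
    hm, Nat.mod_add_div]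

/-- An endomorphism of `A_R` induces one of `A_R[1/p]`. -/
def alMap (f : AA p S →+* AA p S) : AL p S →+* AL p S :=
  IsLocalization.map (AL p S) f (M := Submonoid.powers (p : AA p S))
    (T := Submonoid.powers (p : AA p S)) (by
      rw [Submonoid.powers_le]
      exact ⟨1, by simp⟩)

/-- The endomorphism of `A_R[1/p][T₁, …, T_d]` given by `f` on `A_R` and by `Tᵢ ↦ tᵢ`. -/
def mpMap (f : AA p S →+* AA p S) (t : Fin d → MP p d S) : MP p d S →+* MP p d S :=
  MvPolynomial.eval₂Hom (MvPolynomial.C.comp (alMap p S f)) t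

theorem mpMap_A (f : AA p S →+* AA p S) (t : Fin d → MP p d S) (a : AA p S) :
    mpMap p d S f t (algebraMap (AA p S) (MP p d S) a) = algebraMap (AA p S) (MP p d S) (f a) := by
  change mpMap p d S f t (MvPolynomial.C (algebraMap (AA p S) (AL p S) a)) =
    MvPolynomial.C (algebraMap (AA p S) (AL p S) (f a))
  rw [mpMap, MvPolynomial.coe_eval₂Hom, MvPolynomial.eval₂_C, RingHom.comp_apply, alMap,
    IsLocalization.map_eq]

theorem mpMap_X (f : AA p S →+* AA p S) (t : Fin d → MP p d S) (i : Fin d) :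
    mpMap p d S f t (MvPolynomial.X i) = t i := by
  rw [mpMap, MvPolynomial.coe_eval₂Hom, MvPolynomial.eval₂_X]

theorem mpMap_mu (κ : Type u) [Field κ] [CharP κ p]
    [Algebra (WittVector p κ) S] (f : AA p S →+* AA p S) (t : Fin d → MP p d S) (c : AA p S)
    (hc : f X = X * c) (k : ℕ) (x : MP p d S)
    (h : ((p ^ k * k.factorial : ℕ) : MP p d S) * x =
      algebraMap (AA p S) (MP p d S) X ^ ((p - 1) * k)) : mpMap p d S f t x ∈ pdAlg p d S := by
  have h1 := congrArg (mpMap p d S f t) h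
  rw [map_mul, map_natCast, map_pow, mpMap_A, hc, map_mul, mul_pow, ← h, mul_assoc] at h1
  have hp : 1 < p := Nat.Prime.one_lt Fact.out
  have hu := isUnit_natCast_MP p d S κ (n := p ^ k * k.factorial)
    (Nat.mul_ne_zero (pow_ne_zero _ (by omega)) (Nat.factorial_ne_zero k))
  rw [hu.mul_left_cancel h1]
  exact Subalgebra.mul_mem _ (pdAlg_mu p d S h) (Subalgebra.pow_mem _ (pdAlg_A p d S c) _)

variable (κ : Type u) [Field κ] [CharP κ p] [Algebra (WittVector p κ) S]
  [Algebra (RSq p κ d) S] [IsScalarTower (WittVector p κ) (RSq p κ d) S]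
  [Algebra.Etale (RSq p κ d) S]

/-- The element `Xᵢ` of `A_R[1/p][T₁, …, T_d]`. -/
abbrev mpX (i : Fin d) : MP p d S := algebraMap (AA p S) (MP p d S) (C (rX p κ d S i : RR p S))

theorem gammaMP_mem (g : GammaR p d) (x : MP p d S) (hx : x ∈ pdAlg p d S) :
    mpMap p d S (gammaA p κ d S g) (fun i => algebraMap (AA p S) (MP p d S)
      (gammaA p κ d S g (C (rX p κ d S i : RR p S)) - C (rX p κ d S i : RR p S)) +
        MvPolynomial.X i) x ∈ pdAlg p d S := by
  obtain ⟨c, hc⟩ := gammaA_X_eq p κ d S g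
  refine pdAlg_map_mem p d S _ (fun a => ?_) (fun k x h => mpMap_mu p d S κ _ _ c hc k x h)
    (fun i k x h => ?_) x hx
  · rw [mpMap_A]
    exact pdAlg_A p d S _
  · obtain ⟨s, hs⟩ := Ideal.mem_span_singleton.mp
      (gammaA_sub_mem p κ d S g (C (rX p κ d S i : RR p S)))
    have h1 := congrArg (mpMap p d S (gammaA p κ d S g) (fun i => algebraMap (AA p S) (MP p d S)
      (gammaA p κ d S g (C (rX p κ d S i : RR p S)) - C (rX p κ d S i : RR p S)) +
        MvPolynomial.X i)) h
    rw [map_mul, map_natCast, map_pow, mpMap_X, hs, map_mul, add_pow] at h1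
    have hu : ∀ n : ℕ, IsUnit (n.factorial : MP p d S) := fun n =>
      isUnit_natCast_MP p d S κ (Nat.factorial_ne_zero n)
    choose y hy hy' using exists_mu_divided p d S κ
    have hz : ∀ n : ℕ, ∃ z ∈ pdAlg p d S,
        (n.factorial : MP p d S) * z = MvPolynomial.X i ^ n := by
      intro n
      obtain ⟨w, hw⟩ := hu n
      have e : (n.factorial : MP p d S) * (((w⁻¹ : (MP p d S)ˣ) : MP p d S) *
          (MvPolynomial.X i : MP p d S) ^ n) = MvPolynomial.X i ^ n := by rw [← hw, Units.mul_inv_cancel_left]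
      exact ⟨_, pdAlg_T p d S e, e⟩
    choose z hz hz' using hz
    have e : (k.factorial : MP p d S) * ∑ m ∈ Finset.range (k + 1),
        y m * algebraMap (AA p S) (MP p d S) s ^ m * z (k - m) =
        ∑ m ∈ Finset.range (k + 1), (algebraMap (AA p S) (MP p d S) X *
          algebraMap (AA p S) (MP p d S) s) ^ m * MvPolynomial.X i ^ (k - m) *
            (k.choose m : MP p d S) := by
      rw [Finset.mul_sum]
      refine Finset.sum_congr rfl fun m hm => ?_
      rw [← Nat.choose_mul_factorial_mul_factorial (Nat.lt_succ_iff.mp (Finset.mem_range.mp hm)),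
        mul_pow, ← hy', ← hz']
      push_cast
      ring
    rw [← e] at h1
    rw [(hu k).mul_left_cancel h1]
    exact Subalgebra.sum_mem _ fun m _ => Subalgebra.mul_mem _
      (Subalgebra.mul_mem _ (hy m) (Subalgebra.pow_mem _ (pdAlg_A p d S s) m)) (hz _)

/-- The divided power algebra as a ring. -/
def PD : Type _ := pdAlg p d S

instance : CommRing (PD p d S) := inferInstanceAs (CommRing (pdAlg p d S))

/-- The structure map of the `A_R`-algebra `PD`. -/
def pdA : AA p S →+* PD p d S := algebraMap (AA p S) (pdAlg p d S)

/-- The variable `Tᵢ` in `PD`. -/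
def pdT (i : Fin d) : PD p d S := (⟨MvPolynomial.X i, pdAlg_X p d S i⟩ : pdAlg p d S)

/-- The inclusion of `PD` into the polynomial ring. -/
def pdVal : PD p d S →+* MP p d S := algebraMap (pdAlg p d S) (MP p d S)

theorem pdVal_injective : Function.Injective (pdVal p d S) := Subtype.val_injective

/-- The action of `g ∈ Γ_R` on the divided power algebra: it extends the action on `A_R`, and
`g(Tᵢ) = (g(Xᵢ) - Xᵢ) + Tᵢ`. -/
def gammaPD (g : GammaR p d) : PD p d S →+* PD p d S :=
  ((mpMap p d S (gammaA p κ d S g) (fun i => algebraMap (AA p S) (MP p d S)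
      (gammaA p κ d S g (C (rX p κ d S i : RR p S)) - C (rX p κ d S i : RR p S)) +
        MvPolynomial.X i)).comp (algebraMap (pdAlg p d S) (MP p d S))).codRestrict
    (pdAlg p d S) fun x => gammaMP_mem p d S κ g _ x.2

variable [PerfectRing κ p]

theorem frobMP_mem (x : MP p d S) (hx : x ∈ pdAlg p d S) :
    mpMap p d S (frobA p κ d S)
      (fun i => mpX p d S κ i ^ p - (mpX p d S κ i - MvPolynomial.X i) ^ p) x ∈
      pdAlg p d S := by
  refine pdAlg_map_mem p d S _ (fun a => ?_)
    (fun k x h => mpMap_mu p d S κ _ _ (pQ p S) (X_mul_pQ p κ d S).symm k x h)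
    (fun i k x h => ?_) x hx
  · rw [mpMap_A]
    exact pdAlg_A p d S _
  · have h1 := congrArg (mpMap p d S (frobA p κ d S)
      (fun i => mpX p d S κ i ^ p - (mpX p d S κ i - MvPolynomial.X i) ^ p)) h
    rw [map_mul, map_natCast, map_pow, mpMap_X, ← geom_sum₂_mul, sub_sub_cancel, mul_pow, ← h,
      mul_left_comm] at h1
    rw [(isUnit_natCast_MP p d S κ (Nat.factorial_ne_zero k)).mul_left_cancel h1]
    refine Subalgebra.mul_mem _ (Subalgebra.pow_mem _ ?_ _) (pdAlg_T p d S h)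
    refine Subalgebra.sum_mem _ fun m _ => Subalgebra.mul_mem _
      (Subalgebra.pow_mem _ (pdAlg_A p d S _) _) (Subalgebra.pow_mem _ ?_ _)
    exact Subalgebra.sub_mem _ (pdAlg_A p d S _) (pdAlg_X p d S i)

/-- The Frobenius of the divided power algebra: it extends the Frobenius of `A_R`, and
`φ(Xᵢ - Tᵢ) = (Xᵢ - Tᵢ) ^ p`. -/
def frobPD : PD p d S →+* PD p d S :=
  ((mpMap p d S (frobA p κ d S)
      (fun i => mpX p d S κ i ^ p - (mpX p d S κ i - MvPolynomial.X i) ^ p)).comp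
    (algebraMap (pdAlg p d S) (MP p d S))).codRestrict
    (pdAlg p d S) fun x => frobMP_mem p d S κ _ x.2

theorem pdVal_frobPD (x : PD p d S) : pdVal p d S (frobPD p d S κ x) =
    mpMap p d S (frobA p κ d S)
      (fun i => mpX p d S κ i ^ p - (mpX p d S κ i - MvPolynomial.X i) ^ p) (pdVal p d S x) := rfl

theorem frobPD_pdA (a : AA p S) :
    frobPD p d S κ (pdA p d S a) = pdA p d S (frobA p κ d S a) :=
  Subtype.ext (mpMap_A p d S _ _ a)

theorem frobPD_sub (i : Fin d) :
    frobPD p d S κ (pdA p d S (C (rX p κ d S i : RR p S)) - pdT p d S i) =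
      (pdA p d S (C (rX p κ d S i : RR p S)) - pdT p d S i) ^ p := by
  have hX : pdVal p d S (pdT p d S i) = MvPolynomial.X i := rfl
  have hA : pdVal p d S (pdA p d S (C (rX p κ d S i : RR p S))) = mpX p d S κ i := rfl
  apply pdVal_injective p d S
  rw [map_pow, pdVal_frobPD, map_sub, hX, hA, map_sub, mpMap_A, mpMap_X, frobA_rX, map_pow,
    sub_sub_cancel]

theorem gammaPD_pdA (g : GammaR p d) (a : AA p S) :
    gammaPD p d S κ g (pdA p d S a) = pdA p d S (gammaA p κ d S g a) :=
  Subtype.ext (mpMap_A p d S _ _ a)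

theorem gammaPD_pdT (g : GammaR p d) (i : Fin d) :
    gammaPD p d S κ g (pdT p d S i) = pdA p d S (gammaA p κ d S g (C (rX p κ d S i : RR p S)) -
      C (rX p κ d S i : RR p S)) + pdT p d S i :=
  Subtype.ext (mpMap_X p d S _ _ i)

/-- The `p`-adic completion of the divided power algebra. -/
abbrev PDhat : Type _ := AdicCompletion (Ideal.span {(p : PD p d S)}) (PD p d S)

/-- The canonical map from the divided power algebra to its `p`-adic completion. -/
def ofPD : PD p d S →+* PDhat p d S := algebraMap (PD p d S) (PDhat p d S)

/-- The Frobenius of the `p`-adic completion of the divided power algebra. -/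
def frobPDhat : PDhat p d S →+* PDhat p d S :=
  adicMap _ _ (frobPD p d S κ) (map_span_natCast_le _ p)

/-- The action of `g ∈ Γ_R` on the `p`-adic completion of the divided power algebra. -/
def gammaPDhat (g : GammaR p d) : PDhat p d S →+* PDhat p d S :=
  adicMap _ _ (gammaPD p d S κ g) (map_span_natCast_le _ p)

end DividedPowers

end WachPrism

end

set_option linter.unusedSectionVars false

noncomputable section

universe u v

namespace WachPrism

/-! ### Sequences of iterated divided powers -/

section DigitProd

variable {T : Type*} [CommRing T] (p : ℕ)

/-! Killing p₁(μ) turns the prismatic envelope into a divided power envelope. Modulo μ ⊗ 1 the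
element [p]_q ⊗ 1 becomes p, so one adjoins elements j/p and closes up under δ. In a δ-ring, if φ(x)
= pk, then k − δ(x) serves as x^p/p, and its Frobenius is again divisible by p. Iterating yields all
divided powers of x up to units. This applies to x = μ^(p-1)/p, which arises from (1 ⊗ [p]_q)/([p]_q
⊗ 1) because [p]_q = pu + μ^(p-1), and to Tᵢ = 1 ⊗ Xᵢ − Xᵢ ⊗ 1.

The map. In `PDhat` the powers μ^(p-1) and Tᵢ^p are multiples of p, so `PDhat` is complete for (p,
μ, T₁, …, T_d). Étaleness then gives R → `PDhat` with Xᵢ ↦ Xᵢ − Tᵢ, congruent to the structure map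
modulo that ideal (`exists_hatR`). Together with μ ↦ 0 this is the map on the first factor; on the
second factor the structure map is used. The ideal J lands in (p) (`bbHat_idJ`). As `PDhat` is
p-torsion free with a lift of Frobenius, the map extends to E (`leHat_mem`) and then to A_R(1).
Equivariance follows from uniqueness of étale lifts.

The isomorphism. By p-adic successive approximation (`surjective_and_ker_eq`) it suffices that E/(μ
⊗ 1) → `PDhat` is bijective modulo p. Surjectivity holds because all divided powers are hit
(`emHat_xE`, `emHat_tE`). Injectivity rests on two facts. First, modulo p, E/(μ ⊗ 1) is spanned over
the second factor by divided power monomials (`exists_uE_add`). Second, a relation between these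
monomials in the divided power algebra has coefficients in (p, μ^(p-1)) (`coeff_mem_of_sum_pdMon`),
and μ^(p-1) is p times an element of E/(μ ⊗ 1).

For the first fact, `DeltaStruct.eq_top_of_generated` asks for the generators and for δ of the
spanning ring. Étaleness reduces the elements r ⊗ 1 and (φ(r) ⊗ 1 − 1 ⊗ φ(r))/([p]_q ⊗ 1) to the
coordinates r = Xᵢ (`mem_of_etale`, `derivation_mem_of_etale`).

E/(μ ⊗ 1) is not known in advance to be p-torsion free. Its divided powers are therefore recorded as
sequences with sₙ^p = p sₙ₊₁, and its δ-structure through identities rather than through division by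
p. -/

/-- The product `s₀ ^ a₀ * s₁ ^ a₁ * ⋯` for a list of exponents. -/
def listProd : List ℕ → (ℕ → T) → T
  | [], _ => 1
  | a :: l, s => s 0 ^ a * listProd l fun n => s (n + 1)

/-- The product `∏ sₙ ^ aₙ`, where the `aₙ` are the digits of `k` in base `p`. -/
def digitProd (s : ℕ → T) (k : ℕ) : T := listProd (Nat.digits p k) s

theorem digitProd_zero (s : ℕ → T) : digitProd p s 0 = 1 := by
  simp [digitProd, listProd]

theorem map_digitProd {T' : Type*} [CommRing T'] (f : T →+* T') (s : ℕ → T) (k : ℕ) :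
    f (digitProd p s k) = digitProd p (fun n => f (s n)) k := by
  have : ∀ (l : List ℕ) (s : ℕ → T), f (listProd l s) = listProd l fun n => f (s n) := by
    intro l
    induction l with
    | nil => intro s; simp [listProd]
    | cons a l ih => intro s; simp [listProd, ih]
  exact this _ _

variable [hp : Fact p.Prime]

theorem digitProd_eq (s : ℕ → T) (k : ℕ) :
    digitProd p s k = s 0 ^ (k % p) * digitProd p (fun n => s (n + 1)) (k / p) := by
  rcases Nat.eq_zero_or_pos k with rfl | hk
  · simp [digitProd, listProd]
  · rw [digitProd, Nat.digits_def' hp.out.one_lt hk]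
    rfl

theorem digitProd_one (s : ℕ → T) : digitProd p s 1 = s 0 := by
  rw [digitProd_eq, Nat.mod_eq_of_lt hp.out.one_lt, Nat.div_eq_of_lt hp.out.one_lt,
    digitProd_zero, pow_one, mul_one]

theorem digitProd_prime_pow (s : ℕ → T) (n : ℕ) : digitProd p s (p ^ n) = s n := by
  induction n generalizing s with
  | zero => exact digitProd_one p s
  | succ n ih =>
    rw [digitProd_eq, pow_succ, Nat.mul_mod_left, Nat.mul_div_cancel _ hp.out.pos, ih, pow_zero,
      one_mul]

/-- Sequences satisfying `sₙ ^ p = p sₙ₊₁`. -/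
def IsPSeq (s : ℕ → T) : Prop := ∀ n, s n ^ p = (p : T) * s (n + 1)

variable {p} in
theorem IsPSeq.shift {s : ℕ → T} (h : IsPSeq p s) : IsPSeq p fun n => s (n + 1) :=
  fun n => h (n + 1)

/-- This is addition in base `p`: without a carry in the lowest digit the exponents simply add, and
a carry trades `s 0 ^ p` for `p * s 1`. The argument works in rings with `p`-torsion, where `s 0 ^ k
/ k!` has no meaning. -/
theorem digitProd_mul {s : ℕ → T} (h : IsPSeq p s) (k l : ℕ) :
    ∃ m : ℕ, digitProd p s k * digitProd p s l = m * digitProd p s (k + l) := by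
  have main : ∀ (N k l : ℕ) (s : ℕ → T), IsPSeq p s → k + l = N →
      ∃ m : ℕ, digitProd p s k * digitProd p s l = m * digitProd p s (k + l) := by
    intro N
    induction N using Nat.strong_induction_on with
    | _ N ih =>
      intro k l s h hN
      rcases Nat.eq_zero_or_pos N with h0 | hpos
      · obtain ⟨rfl, rfl⟩ : k = 0 ∧ l = 0 := by omega
        exact ⟨1, by simp [digitProd_zero]⟩
      have hp1 := hp.out.one_lt
      set s' : ℕ → T := fun n => s (n + 1) with hs'
      have hk := Nat.div_add_mod k p
      have hl := Nat.div_add_mod l p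
      have ha : k % p < p := Nat.mod_lt _ hp.out.pos
      have hb : l % p < p := Nat.mod_lt _ hp.out.pos
      generalize k / p = k' at *
      generalize l / p = l' at *
      have e1 : digitProd p s k = s 0 ^ (k % p) * digitProd p s' k' := by
        rw [digitProd_eq, ← hs']
        congr 2
        rw [← hk, Nat.mul_add_div hp.out.pos]
        simp [Nat.div_eq_of_lt ha]
      have e2 : digitProd p s l = s 0 ^ (l % p) * digitProd p s' l' := by
        rw [digitProd_eq, ← hs']
        congr 2
        rw [← hl, Nat.mul_add_div hp.out.pos]
        simp [Nat.div_eq_of_lt hb]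
      generalize k % p = a at *
      generalize l % p = b at *
      have hlt : k' + l' < N := by
        have h2 : 2 * (k' + l') ≤ p * (k' + l') := Nat.mul_le_mul_right _ hp1
        have h3 := mul_add p k' l'
        omega
      obtain ⟨m, hm⟩ := ih (k' + l') hlt k' l' s' h.shift rfl
      by_cases hab : a + b < p
      · refine ⟨m, ?_⟩
        have e3 : digitProd p s (k + l) = s 0 ^ (a + b) * digitProd p s' (k' + l') := by
          have e : k + l = p * (k' + l') + (a + b) := by rw [← hk, ← hl]; ring
          rw [digitProd_eq, ← hs', e, Nat.mul_add_div hp.out.pos, Nat.mul_add_mod,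
            Nat.mod_eq_of_lt hab, Nat.div_eq_of_lt hab, add_zero]
        rw [e1, e2, e3, pow_add]
        linear_combination (s 0 ^ a * s 0 ^ b) * hm
      -- A carry: the extra factor `s 1` is the digit product of `1` for the shifted sequence, so
      -- the induction hypothesis is used a second time, for `(k' + l') + 1`.
      · have hlt2 : k' + l' + 1 < N := by
          have h2 : 2 * (k' + l' + 1) ≤ p * (k' + l' + 1) := Nat.mul_le_mul_right _ hp1
          have h3 : p * (k' + l' + 1) = p * k' + p * l' + p := by ring
          omega
        obtain ⟨m', hm'⟩ := ih (k' + l' + 1) hlt2 (k' + l') 1 s' h.shift rfl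
        obtain ⟨c, hc⟩ : ∃ c, a + b = p + c := ⟨a + b - p, by omega⟩
        have hcp : c < p := by omega
        refine ⟨p * m * m', ?_⟩
        have e3 : digitProd p s (k + l) = s 0 ^ c * digitProd p s' (k' + l' + 1) := by
          have e : k + l = p * (k' + l' + 1) + c := by
            rw [← hk, ← hl]
            linarith
          rw [digitProd_eq, ← hs', e, Nat.mul_add_div hp.out.pos, Nat.mul_add_mod,
            Nat.mod_eq_of_lt hcp, Nat.div_eq_of_lt hcp, add_zero]
        rw [digitProd_one] at hm'
        have e4 : s 0 ^ a * s 0 ^ b = (p : T) * s' 0 * s 0 ^ c := by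
          rw [← pow_add, hc, pow_add, h 0]
        rw [e1, e2, e3]
        push_cast
        linear_combination (digitProd p s' k' * digitProd p s' l') * e4 +
          (p * s' 0 * s 0 ^ c) * hm + (p * s 0 ^ c * m) * hm'
  exact main _ k l s h rfl

/-- Legendre's formula in the recursive form v_p(k!) = ⌊k/p⌋ + v_p(⌊k/p⌋!): the relation `s 0 ^ p =
p * s 1` is used `k / p` times, then the shifted sequence takes over. So the digit product is `s 0 ^
k / k!` up to the prime-to-`p` part of `k!`. -/
theorem digitProd_pow {s : ℕ → T} (h : IsPSeq p s) (k : ℕ) :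
    (p : T) ^ padicValNat p k.factorial * digitProd p s k = s 0 ^ k := by
  induction k using Nat.strong_induction_on generalizing s with
  | _ k ih =>
    rcases Nat.eq_zero_or_pos k with rfl | hpos
    · simp [digitProd_zero]
    have hk := Nat.div_add_mod k p
    have ha : k % p < p := Nat.mod_lt _ hp.out.pos
    have ih' := ih (k / p) (Nat.div_lt_self hpos hp.out.one_lt) h.shift
    have hv : padicValNat p k.factorial = padicValNat p (k / p).factorial + k / p := by
      rw [← padicValNat_factorial_mul, ← padicValNat_factorial_mul_add (k / p) ha, hk]
    rw [digitProd_eq, hv, pow_add]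
    conv_rhs => rw [← hk, pow_add, pow_mul, h 0, mul_pow, ← ih']
    ring

end DigitProd

/-! ### Multi-indexed divided power monomials -/

section PDMon

variable {T : Type*} [CommRing T] (p : ℕ) {d : ℕ}

/-- The divided power monomial with index `k`. -/
def pdMon (x : ℕ → T) (t : Fin d → ℕ → T) (k : ℕ × (Fin d →₀ ℕ)) : T :=
  digitProd p x k.1 * ∏ i, digitProd p (t i) (k.2 i)

theorem map_pdMon {T' : Type*} [CommRing T'] (f : T →+* T') (x : ℕ → T) (t : Fin d → ℕ → T)
    (k : ℕ × (Fin d →₀ ℕ)) :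
    f (pdMon p x t k) = pdMon p (fun n => f (x n)) (fun i n => f (t i n)) k := by
  simp [pdMon, map_digitProd]

theorem pdMon_zero (x : ℕ → T) (t : Fin d → ℕ → T) : pdMon p x t 0 = 1 := by
  simp [pdMon, digitProd_zero]

variable [hp : Fact p.Prime]

theorem pdMon_x (x : ℕ → T) (t : Fin d → ℕ → T) (n : ℕ) : pdMon p x t (p ^ n, 0) = x n := by
  simp [pdMon, digitProd_zero, digitProd_prime_pow]

theorem pdMon_t (x : ℕ → T) (t : Fin d → ℕ → T) (i : Fin d) (n : ℕ) :
    pdMon p x t (0, Finsupp.single i (p ^ n)) = t i n := by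
  rw [pdMon, digitProd_zero, one_mul, Finset.prod_eq_single i]
  · simp [digitProd_prime_pow]
  · intro j _ hj
    simp [Finsupp.single_eq_of_ne hj, digitProd_zero]
  · simp

theorem pdMon_mul {x : ℕ → T} {t : Fin d → ℕ → T} (hx : IsPSeq p x) (ht : ∀ i, IsPSeq p (t i))
    (k l : ℕ × (Fin d →₀ ℕ)) :
    ∃ m : ℕ, pdMon p x t k * pdMon p x t l = m * pdMon p x t (k + l) := by
  obtain ⟨m, hm⟩ := digitProd_mul p hx k.1 l.1
  choose n hn using fun i => digitProd_mul p (ht i) (k.2 i) (l.2 i)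
  refine ⟨m * ∏ i, n i, ?_⟩
  rw [pdMon, pdMon, mul_mul_mul_comm, hm, ← Finset.prod_mul_distrib, Finset.prod_congr rfl
    fun i _ => hn i, Finset.prod_mul_distrib, pdMon]
  push_cast
  simp only [Prod.fst_add, Prod.snd_add, Finsupp.add_apply]
  ring

variable {A : Type*} [CommRing A] (ι : A →+* T)

/-- The subring of linear combinations of divided power monomials. -/
def pdSpan (x : ℕ → T) (t : Fin d → ℕ → T) (hx : IsPSeq p x) (ht : ∀ i, IsPSeq p (t i)) :
    Subring T where
  __ := AddSubgroup.closure {y | ∃ a k, y = ι a * pdMon p x t k}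
  one_mem' := AddSubgroup.subset_closure ⟨1, 0, by rw [map_one, pdMon_zero, one_mul]⟩
  mul_mem' := by
    intro a b ha hb
    change a ∈ AddSubgroup.closure _ at ha
    change b ∈ AddSubgroup.closure _ at hb
    change a * b ∈ AddSubgroup.closure _
    induction ha, hb using AddSubgroup.closure_induction₂ with
    | mem a b ha hb =>
      obtain ⟨a, k, rfl⟩ := ha
      obtain ⟨b, l, rfl⟩ := hb
      obtain ⟨m, hm⟩ := pdMon_mul p hx ht k l
      refine AddSubgroup.subset_closure ⟨a * b * m, k + l, ?_⟩
      rw [mul_mul_mul_comm, hm, map_mul, map_mul, map_natCast]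
      ring
    | zero_left b hb => rw [zero_mul]; exact zero_mem _
    | zero_right a ha => rw [mul_zero]; exact zero_mem _
    | add_left a b c _ _ _ h1 h2 => rw [add_mul]; exact add_mem h1 h2
    | add_right a b c _ _ _ h1 h2 => rw [mul_add]; exact add_mem h1 h2
    | neg_left a b _ _ h => rw [neg_mul]; exact neg_mem h
    | neg_right a b _ _ h => rw [mul_neg]; exact neg_mem h

variable {x : ℕ → T} {t : Fin d → ℕ → T} {hx : IsPSeq p x} {ht : ∀ i, IsPSeq p (t i)}

theorem mul_pdMon_mem (a : A) (k) : ι a * pdMon p x t k ∈ pdSpan p ι x t hx ht :=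
  AddSubgroup.subset_closure ⟨a, k, rfl⟩

theorem map_mem_pdSpan (a : A) : ι a ∈ pdSpan p ι x t hx ht := by
  simpa [pdMon_zero] using mul_pdMon_mem p ι (hx := hx) (ht := ht) a 0

theorem pdMon_mem (k) : pdMon p x t k ∈ pdSpan p ι x t hx ht := by
  simpa using mul_pdMon_mem p ι (hx := hx) (ht := ht) 1 k

theorem x_mem_pdSpan (n : ℕ) : x n ∈ pdSpan p ι x t hx ht := by
  rw [← pdMon_x p x t n]
  exact pdMon_mem p ι _

theorem t_mem_pdSpan (i : Fin d) (n : ℕ) : t i n ∈ pdSpan p ι x t hx ht := by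
  rw [← pdMon_t p x t i n]
  exact pdMon_mem p ι _

theorem digitProd_mem {s : ℕ → T} (V : Subring T) (h : ∀ n, s n ∈ V) (k : ℕ) :
    digitProd p s k ∈ V := by
  have := map_digitProd p V.subtype (fun n => (⟨s n, h n⟩ : V)) k
  rw [show digitProd p s k = digitProd p (fun n => V.subtype ⟨s n, h n⟩) k from rfl, ← this]
  exact Subtype.property _

theorem pdSpan_le (V : Subring T) (hι : ∀ a, ι a ∈ V) (h1 : ∀ n, x n ∈ V)
    (h2 : ∀ i n, t i n ∈ V) : pdSpan p ι x t hx ht ≤ V := by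
  intro y hy
  change y ∈ AddSubgroup.closure _ at hy
  induction hy using AddSubgroup.closure_induction with
  | mem y hy =>
    obtain ⟨a, k, rfl⟩ := hy
    exact V.mul_mem (hι a) (V.mul_mem (digitProd_mem p V h1 _)
      (V.prod_mem fun i _ => digitProd_mem p V (h2 i) _))
  | zero => exact V.zero_mem
  | add a b _ _ h1 h2 => exact V.add_mem h1 h2
  | neg a _ h => exact V.neg_mem h

theorem exists_finsupp {y : T} (hy : y ∈ pdSpan p ι x t hx ht) :
    ∃ c : (ℕ × (Fin d →₀ ℕ)) →₀ A, y = c.sum fun k a => ι a * pdMon p x t k := by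
  change y ∈ AddSubgroup.closure _ at hy
  induction hy using AddSubgroup.closure_induction with
  | mem y hy =>
    obtain ⟨a, k, rfl⟩ := hy
    exact ⟨Finsupp.single k a, by simp⟩
  | zero => exact ⟨0, by simp⟩
  | add a b _ _ h1 h2 =>
    obtain ⟨c, rfl⟩ := h1
    obtain ⟨c', rfl⟩ := h2
    exact ⟨c + c', by rw [Finsupp.sum_add_index' (by simp) (by intros; simp [add_mul])]⟩
  | neg a _ h =>
    obtain ⟨c, rfl⟩ := h
    exact ⟨-c, by rw [Finsupp.sum_neg_index (by simp)]; simp [Finsupp.sum]⟩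

end PDMon

/-- If `m` is regular and `p` is regular modulo `m`, the coefficients of a relation between the
elements `m ^ k / p ^ e(k)` with `e` strictly increasing lie in `(p, m)`. -/
theorem coeff_mem_of_sum_eq_zero {A : Type*} [CommRing A] {p m : A}
    (hm : ∀ a, m * a = 0 → a = 0) (hpm : ∀ a, m ∣ p * a → m ∣ a) (n : ℕ) (c : ℕ → A) (b : ℕ → ℕ)
    (hb : ∀ k < n, b (k + 1) < b k)
    (h : ∑ k ∈ Finset.range (n + 1), c k * p ^ b k * m ^ k = 0) (k : ℕ) (hk : k ≤ n) :
    c k ∈ Ideal.span {p, m} := by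
  have hpm' : ∀ j a, m ∣ p ^ j * a → m ∣ a := by
    intro j
    induction j with
    | zero => simp
    | succ j ih =>
      intro a ha
      rw [pow_succ, mul_assoc] at ha
      exact hpm _ (ih _ ha)
  have hmem : m ∈ Ideal.span {p, m} := Ideal.subset_span (by simp)
  have hmemp : p ∈ Ideal.span {p, m} := Ideal.subset_span (by simp)
  induction n generalizing c b k with
  | zero =>
    obtain rfl : k = 0 := by omega
    simp only [zero_add, Finset.sum_range_one, pow_zero, mul_one] at h
    refine Ideal.mem_of_dvd _ (hpm' (b 0) (c 0) ?_) hmem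
    rw [mul_comm, h]
    exact dvd_zero _
  | succ n ih =>
    rw [Finset.sum_range_succ'] at h
    have e : ∑ k ∈ Finset.range (n + 1), c (k + 1) * p ^ b (k + 1) * m ^ (k + 1) =
        m * ∑ k ∈ Finset.range (n + 1), c (k + 1) * p ^ b (k + 1) * m ^ k := by
      rw [Finset.mul_sum]
      exact Finset.sum_congr rfl fun k _ => by ring
    rw [e, pow_zero, mul_one] at h
    -- Modulo `m` only the constant term of the relation survives, so `m ∣ c 0`.
    obtain ⟨c', hc'⟩ := hpm' (b 0) (c 0) ⟨-∑ k ∈ Finset.range (n + 1),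
      c (k + 1) * p ^ b (k + 1) * m ^ k, by linear_combination h⟩
    obtain ⟨j, hj⟩ := Nat.exists_eq_add_of_lt (hb 0 (Nat.succ_pos n))
    -- Divide the relation by `m`. The old constant term is absorbed in the new one; since `b 0 > b
    -- 1` it changes `c 1` only by a multiple of `p`, which does not matter for membership in `(p,
    -- m)`.
    have h2 : ∑ k ∈ Finset.range (n + 1),
        (c (k + 1) + if k = 0 then c' * p ^ (j + 1) else 0) * p ^ b (k + 1) * m ^ k = 0 := by
      apply hm
      simp only [add_mul, Finset.sum_add_distrib, ite_mul, zero_mul]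
      rw [Finset.sum_ite_eq' (Finset.range (n + 1)) 0
        (fun k => c' * p ^ (j + 1) * p ^ b (k + 1) * m ^ k)]
      simp only [Finset.mem_range, Nat.succ_pos, if_true, pow_zero, mul_one]
      rw [mul_add]
      have hj' : p ^ b 0 = p ^ (j + 1) * p ^ b (0 + 1) := by
        rw [← pow_add]
        congr 1
        omega
      rw [hc', hj'] at h
      linear_combination h
    have ih' := ih _ (fun k => b (k + 1)) (fun k hk => hb (k + 1) (by omega)) h2
    rcases k with _ | k
    · rw [hc']
      exact Ideal.mul_mem_right _ _ hmem
    · have := ih' k (by omega)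
      split_ifs at this with h0
      · have h3 : c' * p ^ (j + 1) ∈ Ideal.span {p, m} :=
          Ideal.mul_mem_left _ _ (Ideal.pow_mem_of_mem _ hmemp _ (Nat.succ_pos _))
        simpa using Ideal.sub_mem _ this h3
      · simpa using this

/-! ### `δ`-structures -/

section Delta

variable {R : Type*} [CommRing R] (p : ℕ)

/-- The polynomial `((x + y) ^ p - x ^ p - y ^ p) / p`. -/
def crossTerm (x y : R) : R :=
  ∑ i ∈ Finset.Ioo 0 p, ((p.choose i / p : ℕ) : R) * x ^ i * y ^ (p - i)

theorem crossTerm_mem (V : Subring R) {x y : R} (hx : x ∈ V) (hy : y ∈ V) :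
    crossTerm p x y ∈ V :=
  V.sum_mem fun i _ => V.mul_mem (V.mul_mem (natCast_mem V _) (V.pow_mem hx i)) (V.pow_mem hy _)

/-- Each term of the cross term contains a positive power of the second argument. The clause on
subrings locates the cofactor, which matters when `y = p` and division by `y` is ambiguous. -/
theorem crossTerm_mul_right (x y z : R) : ∃ w, crossTerm p x (y * z) = y * w ∧
    ∀ V : Subring R, x ∈ V → y ∈ V → z ∈ V → w ∈ V := by
  refine ⟨∑ i ∈ Finset.Ioo 0 p, ((p.choose i / p : ℕ) : R) * x ^ i * (y ^ (p - i - 1) *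
    z ^ (p - i)), ?_, fun V hx hy hz => ?_⟩
  · rw [crossTerm, Finset.mul_sum]
    refine Finset.sum_congr rfl fun i hi => ?_
    obtain ⟨j, hj⟩ : ∃ j, p - i = j + 1 := ⟨p - i - 1, by
      have := (Finset.mem_Ioo.mp hi).2; omega⟩
    rw [hj, Nat.add_sub_cancel]
    ring
  · exact V.sum_mem fun i _ => V.mul_mem (V.mul_mem (natCast_mem V _) (V.pow_mem hx i))
      (V.mul_mem (V.pow_mem hy _) (V.pow_mem hz _))

theorem map_crossTerm {R' : Type*} [CommRing R'] (f : R →+* R') (x y : R) :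
    f (crossTerm p x y) = crossTerm p (f x) (f y) := by
  simp [crossTerm]

/-- A `δ`-structure on a ring, with its Frobenius lift. -/
structure DeltaStruct (R : Type*) [CommRing R] where
  /-- The Frobenius lift. -/
  φ : R →+* R
  /-- The `δ`-map. -/
  δ : R → R
  φ_eq : ∀ x, φ x = x ^ p + p * δ x
  δ_one : δ 1 = 0
  δ_add : ∀ x y, δ (x + y) = δ x + δ y - crossTerm p x y
  δ_mul : ∀ x y, δ (x * y) = x ^ p * δ y + y ^ p * δ x + p * δ x * δ y
  -- This identity and `φ_δ` replace division by `p` throughout; being identities, they pass to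
  -- quotients that may have `p`-torsion.
  δ_p_mul : ∀ x, δ (p * x) = φ x - p ^ (p - 1) * x ^ p
  φ_δ : ∀ x, φ (δ x) = δ (φ x)

variable {p} [hp : Fact p.Prime]

theorem mul_crossTerm (x y : R) : (p : R) * crossTerm p x y = (x + y) ^ p - x ^ p - y ^ p := by
  have h := add_pow_prime_eq hp.out x y
  have e : x * y * ∑ k ∈ Finset.Ioo 0 p, x ^ (k - 1) * y ^ (p - k - 1) *
      ((p.choose k / p : ℕ) : R) = crossTerm p x y := by
    rw [crossTerm, Finset.mul_sum]
    refine Finset.sum_congr rfl fun i hi => ?_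
    obtain ⟨h1, h2⟩ := Finset.mem_Ioo.mp hi
    obtain ⟨j, rfl⟩ : ∃ j, i = j + 1 := ⟨i - 1, by omega⟩
    obtain ⟨l, hl⟩ : ∃ l, p - (j + 1) = l + 1 := ⟨p - (j + 1) - 1, by omega⟩
    rw [hl, Nat.add_sub_cancel, Nat.add_sub_cancel]
    ring
  rw [h, ← e]
  ring

/-- On a `p`-torsion free ring, a lift of Frobenius defines a `δ`-structure. -/
def DeltaStruct.ofLift (hR : ∀ x : R, (p : R) * x = 0 → x = 0) (φ : R →+* R) (δ : R → R)
    (hφ : ∀ x, φ x = x ^ p + p * δ x) : DeltaStruct p R :=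
  have key : ∀ x y : R, (p : R) * x = p * y → x = y := fun x y hxy =>
    sub_eq_zero.mp (hR _ (by rw [mul_sub, hxy, sub_self]))
  have hp' : (p : R) ^ p = p * p ^ (p - 1) := by
    rw [← pow_succ', Nat.sub_add_cancel hp.out.one_lt.le]
  { φ := φ
    δ := δ
    φ_eq := hφ
    δ_one := key _ _ (by linear_combination -hφ 1 + map_one φ - one_pow (M := R) p)
    δ_add := fun x y => key _ _ (by
      linear_combination hφ x + hφ y - hφ (x + y) + mul_crossTerm (p := p) x y + map_add φ x y)
    δ_mul := fun x y => key _ _ (by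
      have := hφ (x * y)
      rw [map_mul, hφ x, hφ y, mul_pow] at this
      linear_combination -this)
    δ_p_mul := fun x => key _ _ (by
      have := hφ (p * x)
      rw [map_mul, map_natCast, mul_pow, hp'] at this
      linear_combination -this)
    φ_δ := fun x => key _ _ (by
      have h1 := congrArg φ (hφ x)
      rw [map_add, map_mul, map_natCast, map_pow] at h1
      linear_combination hφ (φ x) - h1) }

namespace DeltaStruct

variable (D : DeltaStruct p R)

theorem δ_zero : D.δ 0 = 0 := by
  have := D.δ_p_mul 0
  rwa [mul_zero, map_zero, zero_pow hp.out.ne_zero, mul_zero, sub_zero] at this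

theorem δ_neg_one : D.δ (-1) = crossTerm p 1 (-1) := by
  have := D.δ_add 1 (-1)
  rw [add_neg_cancel, D.δ_zero, D.δ_one] at this
  linear_combination -this

/-- The elements of a subring `U` whose `δ` lies in a larger subring `V`. -/
def subring (U V : Subring R) (h : U ≤ V) : Subring R where
  carrier := {x | x ∈ U ∧ D.δ x ∈ V}
  one_mem' := ⟨U.one_mem, by rw [D.δ_one]; exact V.zero_mem⟩
  zero_mem' := ⟨U.zero_mem, by rw [D.δ_zero]; exact V.zero_mem⟩
  mul_mem' := by
    rintro x y ⟨hx, hx'⟩ ⟨hy, hy'⟩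
    refine ⟨U.mul_mem hx hy, ?_⟩
    rw [D.δ_mul]
    exact V.add_mem (V.add_mem (V.mul_mem (V.pow_mem (h hx) p) hy')
      (V.mul_mem (V.pow_mem (h hy) p) hx')) (V.mul_mem (V.mul_mem (natCast_mem V p) hx') hy')
  add_mem' := by
    rintro x y ⟨hx, hx'⟩ ⟨hy, hy'⟩
    refine ⟨U.add_mem hx hy, ?_⟩
    rw [D.δ_add]
    exact V.sub_mem (V.add_mem hx' hy') (crossTerm_mem p V (h hx) (h hy))
  neg_mem' := by
    rintro x ⟨hx, hx'⟩
    refine ⟨U.neg_mem hx, ?_⟩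
    have h1 : (-1 : R) ∈ V := V.neg_mem V.one_mem
    have h2 : D.δ (-1) ∈ V := by rw [D.δ_neg_one]; exact crossTerm_mem p V V.one_mem h1
    rw [neg_eq_neg_one_mul, D.δ_mul]
    exact V.add_mem (V.add_mem (V.mul_mem (V.pow_mem h1 p) hx')
      (V.mul_mem (V.pow_mem (h hx) p) h2)) (V.mul_mem (V.mul_mem (natCast_mem V p) h2) hx')

theorem δ_mul_mem {μ : R} (hμ : D.δ μ ∈ Ideal.span {μ}) (c : R) :
    D.δ (μ * c) ∈ Ideal.span {μ} := by
  have h0 : μ ^ p ∈ Ideal.span {μ} :=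
    Ideal.pow_mem_of_mem _ (Ideal.mem_span_singleton_self μ) _ hp.out.pos
  rw [D.δ_mul]
  exact Ideal.add_mem _ (Ideal.add_mem _ (Ideal.mul_mem_right _ _ h0) (Ideal.mul_mem_left _ _ hμ))
    (Ideal.mul_mem_right _ _ (Ideal.mul_mem_left _ _ hμ))

/-- In `δ (y + μ c) = δ y + δ (μ c) - crossTerm p y (μ c)` both corrections are multiples of `μ`.
This makes `δ` well defined on the quotient. -/
theorem mk_δ_eq {μ : R} (hμ : D.δ μ ∈ Ideal.span {μ}) {x y : R}
    (h : Ideal.Quotient.mk (Ideal.span {μ}) x = Ideal.Quotient.mk (Ideal.span {μ}) y) :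
    Ideal.Quotient.mk (Ideal.span {μ}) (D.δ x) = Ideal.Quotient.mk (Ideal.span {μ}) (D.δ y) := by
  rw [Ideal.Quotient.eq] at h ⊢
  obtain ⟨c, hc⟩ := Ideal.mem_span_singleton.mp h
  obtain ⟨w, hw, -⟩ := crossTerm_mul_right p y μ c
  rw [sub_eq_iff_eq_add'.mp hc, D.δ_add, hw,
    show D.δ y + D.δ (μ * c) - μ * w - D.δ y = D.δ (μ * c) - μ * w by ring]
  exact Ideal.sub_mem _ (D.δ_mul_mem hμ c) (Ideal.mul_mem_right _ _ (Ideal.mem_span_singleton_self μ))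

theorem φ_mem {μ : R} (hμ : D.δ μ ∈ Ideal.span {μ}) :
    Ideal.span {μ} ≤ (Ideal.span {μ}).comap D.φ := by
  rw [Ideal.span_le]
  rintro _ rfl
  change D.φ _ ∈ Ideal.span _
  rw [D.φ_eq]
  exact Ideal.add_mem _ (Ideal.pow_mem_of_mem _ (Ideal.mem_span_singleton_self _) _ hp.out.pos)
    (Ideal.mul_mem_left _ _ hμ)

/-- The `δ`-structure on the quotient by a principal ideal `(μ)` with `δ(μ) ∈ (μ)`. -/
def quot {μ : R} (hμ : D.δ μ ∈ Ideal.span {μ}) : DeltaStruct p (R ⧸ Ideal.span {μ}) :=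
  have hδ : ∀ x : R, Ideal.Quotient.mk (Ideal.span {μ})
      (D.δ (Quotient.out (Ideal.Quotient.mk (Ideal.span {μ}) x))) =
      Ideal.Quotient.mk (Ideal.span {μ}) (D.δ x) := fun x =>
    D.mk_δ_eq hμ (Ideal.Quotient.mk_out _)
  { φ := Ideal.quotientMap _ D.φ (D.φ_mem hμ)
    δ := fun q => Ideal.Quotient.mk _ (D.δ (Quotient.out q))
    φ_eq := fun q => by
      obtain ⟨x, rfl⟩ := Ideal.Quotient.mk_surjective q
      rw [hδ, Ideal.quotientMap_mk, D.φ_eq]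
      simp
    δ_one := by
      rw [← map_one (Ideal.Quotient.mk (Ideal.span {μ})), hδ, D.δ_one, map_zero]
    δ_add := fun q r => by
      obtain ⟨x, rfl⟩ := Ideal.Quotient.mk_surjective q
      obtain ⟨y, rfl⟩ := Ideal.Quotient.mk_surjective r
      rw [← map_add, hδ, hδ, hδ, D.δ_add, map_sub, map_add, map_crossTerm]
    δ_mul := fun q r => by
      obtain ⟨x, rfl⟩ := Ideal.Quotient.mk_surjective q
      obtain ⟨y, rfl⟩ := Ideal.Quotient.mk_surjective r
      rw [← map_mul, hδ, hδ, hδ, D.δ_mul]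
      simp
    δ_p_mul := fun q => by
      obtain ⟨x, rfl⟩ := Ideal.Quotient.mk_surjective q
      rw [← map_natCast (Ideal.Quotient.mk (Ideal.span {μ})), ← map_mul, hδ, D.δ_p_mul,
        Ideal.quotientMap_mk]
      simp
    φ_δ := fun q => by
      obtain ⟨x, rfl⟩ := Ideal.Quotient.mk_surjective q
      rw [hδ, Ideal.quotientMap_mk, Ideal.quotientMap_mk, hδ, D.φ_δ] }

theorem quot_δ_mk {μ : R} (hμ : D.δ μ ∈ Ideal.span {μ}) (x : R) :
    (D.quot hμ).δ (Ideal.Quotient.mk _ x) = Ideal.Quotient.mk _ (D.δ x) :=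
  D.mk_δ_eq hμ (Ideal.Quotient.mk_out _)

/-- The subring `B + p C`. -/
def addPMul (p : ℕ) (B C : Subring R) (h : B ≤ C) : Subring R where
  carrier := {x | ∃ b ∈ B, ∃ a ∈ C, x = b + p * a}
  one_mem' := ⟨1, B.one_mem, 0, C.zero_mem, by simp⟩
  zero_mem' := ⟨0, B.zero_mem, 0, C.zero_mem, by simp⟩
  mul_mem' := by
    rintro _ _ ⟨b, hb, a, ha, rfl⟩ ⟨b', hb', a', ha', rfl⟩
    refine ⟨b * b', B.mul_mem hb hb', a * b' + b * a' + p * a * a', C.add_mem (C.add_mem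
      (C.mul_mem ha (h hb')) (C.mul_mem (h hb) ha'))
      (C.mul_mem (C.mul_mem (natCast_mem C p) ha) ha'), by ring⟩
  add_mem' := by
    rintro _ _ ⟨b, hb, a, ha, rfl⟩ ⟨b', hb', a', ha', rfl⟩
    exact ⟨b + b', B.add_mem hb hb', a + a', C.add_mem ha ha', by ring⟩
  neg_mem' := by
    rintro _ ⟨b, hb, a, ha, rfl⟩
    exact ⟨-b, B.neg_mem hb, -a, C.neg_mem ha, by ring⟩

/-- If a `δ`-ring is generated, as a `δ`-ring, by a `δ`-subring `B` and by elements `y` with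
`p y ∈ B`, then its Frobenius takes values in `B` modulo `p`. -/
theorem φ_mem_of_generated (B : Subring R) (Y : Set R) (hB : ∀ b ∈ B, D.δ b ∈ B)
    (hY : ∀ y ∈ Y, (p : R) * y ∈ B)
    (ind : ∀ V : Subring R, B ≤ V → Y ⊆ V → (∀ x ∈ V, D.δ x ∈ V) → V = ⊤) (x : R) :
    ∃ b ∈ B, ∃ a, D.φ x = b + p * a := by
  have hφB : ∀ b ∈ B, D.φ b ∈ B := fun b hb => by
    rw [D.φ_eq]
    exact B.add_mem (B.pow_mem hb p) (B.mul_mem (natCast_mem B p) (hB b hb))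
  -- The correction term is kept in the subring generated by `B` and `Y`: `φ` has to be applied to
  -- it once more, and only there is `φ` already known to land in `B + p C`.
  set C : Subring R := Subring.closure (B ∪ Y) with hC
  have hBC : B ≤ C := fun b hb => Subring.subset_closure (Or.inl hb)
  set G : Subring R := (addPMul p B C hBC).comap D.φ with hG
  have hpow : (p : R) ^ (p - 1) = p * p ^ (p - 2) := by
    rw [← pow_succ']
    congr 1
    have := hp.out.two_le
    omega
  have hBG : B ≤ G := fun b hb => ⟨_, hφB b hb, 0, C.zero_mem, by simp⟩
  -- `φ y = δ (p y) + p ^ (p - 1) y ^ p` with `p y ∈ B`, and the last term is a multiple of `p`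
  -- because `p ≥ 2`.
  have hYG : Y ⊆ G := fun y hy => by
    refine ⟨D.δ (p * y), hB _ (hY y hy), p ^ (p - 2) * y ^ p, C.mul_mem
      (C.pow_mem (natCast_mem C p) _) (C.pow_mem (Subring.subset_closure (Or.inr hy)) _), ?_⟩
    change D.φ y = _
    rw [D.δ_p_mul, hpow]
    ring
  have hCG : C ≤ G := (Subring.closure_le).mpr (Set.union_subset hBG hYG)
  have hGtop : G = ⊤ := by
    refine ind G hBG hYG fun x hx => ?_
    obtain ⟨b, hb, a, ha, hx⟩ := hx
    change D.φ (D.δ x) ∈ addPMul p B C hBC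
    change D.φ x = _ at hx
    obtain ⟨w, hw, hwC⟩ := crossTerm_mul_right p b (p : R) a
    -- `φ (δ x) = δ (φ x) = δ (b + p a)`, where `δ (p a)` equals `φ a` up to a multiple of `p`; the
    -- membership `a ∈ C` controls `φ a`.
    have e : D.φ (D.δ x) = D.δ b + D.φ a + (0 + p * (-(p ^ (p - 2) * a ^ p) - w)) := by
      rw [D.φ_δ, hx, D.δ_add, D.δ_p_mul, hw, hpow]
      ring
    rw [e]
    refine Subring.add_mem _ (Subring.add_mem _ ⟨_, hB b hb, 0, C.zero_mem, by simp⟩ (hCG ha))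
      ⟨0, B.zero_mem, _, ?_, rfl⟩
    exact C.sub_mem (C.neg_mem (C.mul_mem (C.pow_mem (natCast_mem C p) _) (C.pow_mem ha _)))
      (hwC C (hBC hb) (natCast_mem C p) ha)
  have hx : x ∈ G := by rw [hGtop]; trivial
  obtain ⟨b, hb, a, -, h⟩ := hx
  exact ⟨b, hb, a, h⟩

/-- A subring `V = U + p R` containing the generators and `δ(U)` is everything. -/
theorem eq_top_of_generated (B : Subring R) (Y : Set R) (hB : ∀ b ∈ B, D.δ b ∈ B)
    (hY : ∀ y ∈ Y, (p : R) * y ∈ B)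
    (ind : ∀ V : Subring R, B ≤ V → Y ⊆ V → (∀ x ∈ V, D.δ x ∈ V) → V = ⊤)
    (U : Subring R)
    (hBV : ∀ b ∈ B, ∃ u ∈ U, ∃ a, b = u + p * a) (hYV : ∀ b ∈ Y, ∃ u ∈ U, ∃ a, b = u + p * a)
    (hδ : ∀ u ∈ U, ∃ u' ∈ U, ∃ a, D.δ u = u' + p * a) (x : R) :
    ∃ u ∈ U, ∃ a, x = u + p * a := by
  set V := addPMul p U ⊤ le_top with hV
  have hV' : ∀ x, x ∈ V ↔ ∃ u ∈ U, ∃ a, x = u + p * a := fun x =>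
    ⟨fun ⟨u, hu, a, _, h⟩ => ⟨u, hu, a, h⟩, fun ⟨u, hu, a, h⟩ => ⟨u, hu, a, trivial, h⟩⟩
  have hpV : ∀ a, (p : R) * a ∈ V := fun a => (hV' _).mpr ⟨0, U.zero_mem, a, by simp⟩
  have hUV : U ≤ V := fun u hu => (hV' _).mpr ⟨u, hu, 0, by simp⟩
  have htop : V = ⊤ := by
    refine ind V (fun b hb => (hV' b).mpr (hBV b hb)) (fun b hb => (hV' b).mpr (hYV b hb)) ?_
    intro x hx
    obtain ⟨u, hu, a, rfl⟩ := (hV' x).mp hx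
    -- Modulo `p`, `δ (u + p a)` is `δ u + φ a`, and `φ_mem_of_generated` puts `φ a` in `B + p R`
    -- for an arbitrary `a`.
    obtain ⟨w, hw, -⟩ := crossTerm_mul_right p u (p : R) a
    rw [D.δ_add, hw, D.δ_p_mul]
    obtain ⟨b, hb, c, hc⟩ := D.φ_mem_of_generated B Y hB hY ind a
    refine V.sub_mem (V.add_mem ((hV' _).mpr (hδ u hu)) (V.sub_mem ?_ ?_)) (hpV _)
    · rw [hc]
      exact V.add_mem ((hV' b).mpr (hBV b hb)) (hpV _)
    · have hpow : (p : R) ^ (p - 1) = p * p ^ (p - 2) := by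
        rw [← pow_succ']
        congr 1
        have := hp.out.two_le
        omega
      rw [hpow, mul_assoc]
      exact hpV _
  exact (hV' x).mp (by rw [htop]; trivial)

/-- The sequence with `x₀` given and `p xₙ₊₁ = xₙ ^ p`, when `φ(x₀) = p k`; the second component
satisfies `φ(xₙ) = p kₙ`. -/
def divSeq (x k : R) : ℕ → R × R
  | 0 => (x, k)
  | n + 1 => ((divSeq x k n).2 - D.δ (divSeq x k n).1,
      (p : R) ^ (p - 2) * (divSeq x k n).2 ^ p)

/-- `φ (k - δ x) = φ k - δ (p k) = p ^ (p - 1) * k ^ p` by `φ_δ` and `δ_p_mul`; this dictates the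
second component of `divSeq`. -/
theorem φ_divSeq {x k : R} (h : D.φ x = p * k) (n : ℕ) :
    D.φ (D.divSeq x k n).1 = p * (D.divSeq x k n).2 := by
  induction n with
  | zero => exact h
  | succ n ih =>
    have hpow : (p : R) ^ (p - 1) = p * p ^ (p - 2) := by
      rw [← pow_succ']
      congr 1
      have := hp.out.two_le
      omega
    simp only [divSeq]
    rw [map_sub, D.φ_δ, ih, D.δ_p_mul, hpow]
    ring

/-- From `x ^ p + p * δ x = φ x = p * k` one reads off `p * (k - δ x) = x ^ p`, without any
division. -/
theorem isPSeq_divSeq {x k : R} (h : D.φ x = p * k) : IsPSeq p fun n => (D.divSeq x k n).1 := by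
  intro n
  have h1 := D.φ_divSeq h n
  rw [D.φ_eq] at h1
  simp only [divSeq]
  linear_combination h1

end DeltaStruct

end Delta

/-! ### Complete rings: successive approximation and torsion freeness of completions. -/

section Complete

variable {A T : Type*} [CommRing A] [CommRing T]

theorem exists_of_sub_mem {I : Ideal A} (hI : I.FG) (n : ℕ) (x : AdicCompletion I A) :
    ∃ a, x - AdicCompletion.of I A a ∈ (I.map (algebraMap A (AdicCompletion I A))) ^ n := by
  obtain ⟨a, ha⟩ := Ideal.Quotient.mk_surjective (AdicCompletion.evalₐ I n x)
  refine ⟨a, ?_⟩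
  have h0 : x - AdicCompletion.of I A a ∈ (AdicCompletion.eval I A n).ker := by
    rw [LinearMap.mem_ker, ← AdicCompletion.factor_evalₐ_eq_eval I _
      (le_of_eq (Ideal.mul_top _).symm), map_sub, AdicCompletion.evalₐ_of, ← ha, sub_self,
      map_zero]
  rw [← AdicCompletion.pow_smul_top_eq_ker_eval hI, Ideal.smul_top_eq_map] at h0
  rw [← Ideal.map_pow]
  exact h0

/-- An element of `A` whose image in the completion lies in the ideal generated by `I` is
in `I`. -/
theorem mem_of_of_mem_map {I : Ideal A} {a : A}
    (h : AdicCompletion.of I A a ∈ I.map (algebraMap A (AdicCompletion I A))) : a ∈ I := by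
  have hle : I.map (algebraMap A (AdicCompletion I A)) ≤
      RingHom.ker (AdicCompletion.evalₐ I 1 : AdicCompletion I A →+* A ⧸ I ^ 1) := by
    rw [Ideal.map_le_iff_le_comap]
    intro x hx
    change AdicCompletion.evalₐ I 1 (AdicCompletion.of I A x) = 0
    rw [AdicCompletion.evalₐ_of]
    exact Ideal.Quotient.eq_zero_iff_mem.mpr (by simpa using hx)
  have h1 := hle h
  change AdicCompletion.evalₐ I 1 (AdicCompletion.of I A a) = 0 at h1
  rw [AdicCompletion.evalₐ_of] at h1
  simpa using Ideal.Quotient.eq_zero_iff_mem.mp h1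

theorem eq_zero_of_forall_mem_pow (I : Ideal T) [IsHausdorff I T] {x : T}
    (h : ∀ n, x ∈ I ^ n) : x = 0 := by
  refine IsHausdorff.haus (I := I) inferInstance _ fun n => ?_
  rw [SModEq.zero]
  simpa using h n

theorem isHausdorff_of_forall (I : Ideal T) (h : ∀ x : T, (∀ n, x ∈ I ^ n) → x = 0) :
    IsHausdorff I T := by
  constructor
  intro x hx
  refine h x fun n => ?_
  have := hx n
  rw [SModEq.zero] at this
  simpa using this

theorem isHausdorff_of_isNilpotent (I : Ideal T) (h : IsNilpotent I) : IsHausdorff I T := by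
  obtain ⟨n, hn⟩ := h
  refine isHausdorff_of_forall I fun x hx => ?_
  simpa [hn] using hx n

theorem isAdicComplete_span_natCast_of_eq_zero (p : ℕ) (h : (p : T) = 0) :
    IsAdicComplete (Ideal.span {(p : T)}) T := by
  have h0 : Ideal.span {(p : T)} = ⊥ := by rw [h]; simp
  rw [h0]
  infer_instance

/-- Completeness for an ideal only depends on the topology it defines. -/
theorem isAdicComplete_of_pow_le {I J : Ideal T} [IsAdicComplete J T] (h : J ≤ I) (N : ℕ)
    (hN : I ^ N ≤ J) : IsAdicComplete I T := by
  -- The factor `N + 1` is positive even for `N = 0`, so the subsequence `f ((N + 1) * n)` used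
  -- below never lags behind `f n`.
  have hN' : ∀ n, I ^ ((N + 1) * n) ≤ J ^ n := fun n => by
    rw [pow_mul]
    exact Ideal.pow_right_mono ((Ideal.pow_le_pow_right (Nat.le_succ N)).trans hN) n
  have h1 : IsHausdorff I T := isHausdorff_of_forall I fun x hx =>
    eq_zero_of_forall_mem_pow J fun n => hN' n (hx _)
  have h2 : IsPrecomplete I T := by
    constructor
    intro f hf
    obtain ⟨L, hL⟩ := IsPrecomplete.prec (I := J) (M := T) inferInstance
      (f := fun n => f ((N + 1) * n)) (fun {m n} hmn => by
        have := hf (Nat.mul_le_mul_left (N + 1) hmn)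
        rw [SModEq.sub_mem] at this ⊢
        simp only [smul_eq_mul, Ideal.mul_top] at this ⊢
        exact hN' m this)
    refine ⟨L, fun n => ?_⟩
    have h3 := hf (show n ≤ (N + 1) * n from Nat.le_mul_of_pos_left n (Nat.succ_pos N))
    refine h3.trans ?_
    have h4 := hL n
    rw [SModEq.sub_mem] at h4 ⊢
    simp only [smul_eq_mul, Ideal.mul_top] at h4 ⊢
    exact Ideal.pow_right_mono h n h4
  exact { h1, h2 with }

/-- Summation of the series `∑ aⁿ zₙ` for `a` in an ideal of definition. -/
theorem exists_series (I : Ideal T) [IsAdicComplete I T] {a : T} (ha : a ∈ I) :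
    ∃ L : (ℕ → T) → T, ∀ z, L z = z 0 + a * L fun n => z (n + 1) := by
  have hex : ∀ z : ℕ → T, ∃ l, ∀ n,
      (∑ i ∈ Finset.range n, a ^ i * z i) - l ∈ I ^ n := by
    intro z
    obtain ⟨l, hl⟩ := IsPrecomplete.prec (I := I) (M := T) inferInstance
      (f := fun n => ∑ i ∈ Finset.range n, a ^ i * z i) (fun {m n} hmn => by
        rw [SModEq.comm, SModEq.sub_mem]
        simp only [smul_eq_mul, Ideal.mul_top]
        rw [← Finset.sum_range_add_sum_Ico _ hmn, add_sub_cancel_left]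
        refine Ideal.sum_mem _ fun i hi => Ideal.mul_mem_right _ _ ?_
        exact Ideal.pow_le_pow_right (Finset.mem_Ico.mp hi).1 (Ideal.pow_mem_pow ha i))
    refine ⟨l, fun n => ?_⟩
    have := hl n
    rw [SModEq.sub_mem] at this
    simpa only [smul_eq_mul, Ideal.mul_top] using this
  choose L hL using hex
  refine ⟨L, fun z => sub_eq_zero.mp (eq_zero_of_forall_mem_pow I fun n => ?_)⟩
  have h1 := Ideal.pow_le_pow_right (Nat.le_succ n) (hL z (n + 1))
  have h2 := Ideal.mul_mem_left _ a (hL (fun n => z (n + 1)) n)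
  rw [Finset.sum_range_succ'] at h1
  have e : L z - (z 0 + a * L fun n => z (n + 1)) =
      a * (∑ i ∈ Finset.range n, a ^ i * z (i + 1) - L fun n => z (n + 1)) -
      (∑ i ∈ Finset.range n, a ^ (i + 1) * z (i + 1) + a ^ 0 * z 0 - L z) := by
    have : a * ∑ i ∈ Finset.range n, a ^ i * z (i + 1) =
        ∑ i ∈ Finset.range n, a ^ (i + 1) * z (i + 1) := by
      rw [Finset.mul_sum]
      exact Finset.sum_congr rfl fun i _ => by ring
    rw [mul_sub, this]
    ring
  rw [e]
  exact Ideal.sub_mem _ h2 h1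

/-- A ring homomorphism `f : T → N` from a ring complete for an ideal containing `p` and `μ`
to a `p`-torsion free and `p`-adically separated ring, which is surjective modulo `p` and whose
kernel modulo `p` is generated by `μ`, is surjective with kernel `(μ)`. -/
theorem surjective_and_ker_eq {N : Type*} [CommRing N] (p : ℕ) (I : Ideal T) [IsAdicComplete I T]
    (hp : (p : T) ∈ I) [IsHausdorff (Ideal.span {(p : N)}) N]
    (hN : ∀ x : N, (p : N) * x = 0 → x = 0) (f : T →+* N) (μ : T) (hμ : f μ = 0)
    (hs : ∀ y, ∃ x z, y = f x + p * z)
    (hi : ∀ x z, f x = p * z → ∃ a b, x = p * a + μ * b) :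
    Function.Surjective f ∧ RingHom.ker f = Ideal.span {μ} := by
  obtain ⟨L, hL⟩ := exists_series I hp
  constructor
  · intro y
    -- Write `y = f (e y) + p * z y` and iterate on `z y`; the preimage is the series of the `p ^ n
    -- * e (z^[n] y)`.
    choose e z he using hs
    refine ⟨L fun n => e (z^[n] y), ?_⟩
    refine (sub_eq_zero.mp (eq_zero_of_forall_mem_pow (Ideal.span {(p : N)}) fun n => ?_)).symm
    induction n generalizing y with
    | zero => simp
    | succ n ih =>
      have h1 := ih (z y)
      have h2 : y - f (L fun n => e (z^[n] y)) = p * (z y - f (L fun n => e (z^[n] (z y)))) := by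
        conv_lhs => rw [hL, map_add, map_mul, map_natCast]; enter [1]; rw [he y]
        simp only [Function.iterate_zero, id, Function.iterate_succ_apply]
        ring
      rw [h2, pow_succ']
      exact Ideal.mul_mem_mul (Ideal.mem_span_singleton_self _) h1
  · refine le_antisymm (fun x hx => ?_) ?_
    · rw [RingHom.mem_ker] at hx
      -- Torsion freeness of `N` keeps `a` in the kernel, so the decomposition can be iterated, and
      -- `x` is `μ` times the series of the `p ^ n * bₙ`. Hence the kernel is `(μ)` itself and not
      -- merely its closure.
      have hk : ∀ x : T, f x = 0 → ∃ a b, f a = 0 ∧ x = p * a + μ * b := by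
        intro x hx
        obtain ⟨a, b, h⟩ := hi x 0 (by rw [hx, mul_zero])
        refine ⟨a, b, hN _ ?_, h⟩
        rw [h, map_add, map_mul, map_mul, hμ, zero_mul, add_zero, map_natCast] at hx
        exact hx
      have hk' : ∀ x : {x : T // f x = 0}, ∃ (a : {x : T // f x = 0}) (b : T),
          x.1 = p * a.1 + μ * b := fun x => by
        obtain ⟨a, b, h1, h2⟩ := hk x.1 x.2
        exact ⟨⟨a, h1⟩, b, h2⟩
      choose a b hab using hk'
      rw [Ideal.mem_span_singleton]
      refine ⟨L fun n => b (a^[n] ⟨x, hx⟩), ?_⟩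
      refine sub_eq_zero.mp (eq_zero_of_forall_mem_pow I fun n => ?_)
      generalize hy : (⟨x, hx⟩ : {x : T // f x = 0}) = y
      have hy' : x = y.1 := by rw [← hy]
      rw [hy']
      clear hy hy' hx x
      induction n generalizing y with
      | zero => simp
      | succ n ih =>
        have h1 := ih (a y)
        have h2 : y.1 - μ * (L fun n => b (a^[n] y)) =
            p * ((a y).1 - μ * (L fun n => b (a^[n] (a y)))) := by
          conv_lhs => rw [hL]; enter [1]; rw [hab y]
          simp only [Function.iterate_zero, id, Function.iterate_succ_apply]
          ring
        rw [h2, pow_succ']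
        exact Ideal.mul_mem_mul hp h1
    · rw [Ideal.span_le]
      rintro _ rfl
      exact hμ

/-- The `p`-adic completion of a `p`-torsion free ring is `p`-torsion free. -/
theorem adicCompletion_torsionFree (p : ℕ) (hA : ∀ x : A, (p : A) * x = 0 → x = 0)
    {I : Ideal A} (hI : I = Ideal.span {(p : A)}) (x : AdicCompletion I A)
    (hx : (p : AdicCompletion I A) * x = 0) : x = 0 := by
  refine AdicCompletion.ext_evalₐ (I := I) fun n => ?_
  -- Precision `n + 1` is needed because one power of `p` is lost when `p` is cancelled.
  obtain ⟨a, ha⟩ := exists_of_sub_mem (I := I) (hI ▸ span_natCast_fg p) (n + 1) x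
  rw [← Ideal.map_pow] at ha
  have key : ∀ (m : ℕ) (y : AdicCompletion I A),
      y ∈ (I ^ m).map (algebraMap A (AdicCompletion I A)) → AdicCompletion.evalₐ I m y = 0 := by
    intro m y hy
    have hle : (I ^ m).map (algebraMap A (AdicCompletion I A)) ≤
        RingHom.ker (AdicCompletion.evalₐ I m : AdicCompletion I A →+* A ⧸ I ^ m) := by
      rw [Ideal.map_le_iff_le_comap]
      intro z hz
      change AdicCompletion.evalₐ I m (AdicCompletion.of I A z) = 0
      rw [AdicCompletion.evalₐ_of]
      exact Ideal.Quotient.eq_zero_iff_mem.mpr hz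
    exact hle hy
  have h1 := key (n + 1) _ (Ideal.mul_mem_left _ (p : AdicCompletion I A) ha)
  rw [mul_sub, hx, zero_sub, map_neg, neg_eq_zero, map_mul, map_natCast,
    AdicCompletion.evalₐ_of, ← map_natCast (Ideal.Quotient.mk (I ^ (n + 1))), ← map_mul,
    Ideal.Quotient.eq_zero_iff_mem, hI, Ideal.span_singleton_pow,
    Ideal.mem_span_singleton] at h1
  obtain ⟨b, hb⟩ := h1
  have ha' : a = (p : A) ^ n * b := sub_eq_zero.mp (hA _ (by
    rw [mul_sub, hb, pow_succ']
    ring))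
  have h2 := key n _ (Ideal.map_mono (Ideal.pow_le_pow_right (Nat.le_succ n)) ha)
  rw [map_sub, AdicCompletion.evalₐ_of, sub_eq_zero] at h2
  rw [h2, map_zero, Ideal.Quotient.eq_zero_iff_mem, ha', hI, Ideal.span_singleton_pow]
  exact Ideal.mul_mem_right _ _ (Ideal.mem_span_singleton_self _)

end Complete

/-! ### Étale descent of values to a subring. -/

section EtaleTransfer

variable (p : ℕ) [Fact p.Prime] (κ : Type u) [Field κ] [CharP κ p] (d : ℕ)
  (S : Type v) [CommRing S] [Algebra (WittVector p κ) S] [Algebra (RSq p κ d) S]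
  [IsScalarTower (WittVector p κ) (RSq p κ d) S] [Algebra.Etale (RSq p κ d) S]

/-- Let `f, g : R → T` be ring homomorphisms to a ring of characteristic `p` whose difference is
nilpotent and which agree on `W(κ)`. If a subring contains `g(R)` and the `f(Xᵢ)`, it contains
`f(R)`. -/
theorem mem_of_etale {T : Type*} [CommRing T] (hT : (p : T) = 0) (V : Subring T)
    (f g : RR p S →+* T) (hg : ∀ r, g r ∈ V)
    (hW : ∀ a, f (algebraMap (WittVector p κ) (RR p S) a) =
      g (algebraMap (WittVector p κ) (RR p S) a))
    (hX : ∀ i, f (rX p κ d S i) ∈ V) (hnil : ∀ r, IsNilpotent (f r - g r)) (r : RR p S) :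
    f r ∈ V := by
  have hV0 : (p : V) = 0 := Subtype.ext (by simpa using hT)
  set gV : RR p S →+* V := g.codRestrict V hg with hgV
  set e : Fin d → V := fun i => ⟨f (rX p κ d S i), hX i⟩ with he
  have hnilV : ∀ x : V, IsNilpotent (x : T) → IsNilpotent x := fun x ⟨n, hn⟩ =>
    ⟨n, Subtype.ext (by simpa using hn)⟩
  have he' : ∀ i, IsNilpotent (e i - gV (rX p κ d S i)) := fun i =>
    hnilV _ (hnil (rX p κ d S i))
  -- Generated by finitely many nilpotents, `I` is nilpotent, so lifting from `V ⧸ I` to `V` needs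
  -- no completeness.
  set I : Ideal V := Ideal.span (Set.range fun i => e i - gV (rX p κ d S i)) with hI
  have hIfg : I.FG := Submodule.fg_span (Set.finite_range _)
  have hInil : IsNilpotent I := by
    rw [Ideal.FG.isNilpotent_iff_le_nilradical hIfg, Ideal.span_le]
    rintro _ ⟨i, rfl⟩
    exact he' i
  have hunit : ∀ i, IsUnit (e i) := fun i => by
    have := IsNilpotent.isUnit_add_left_of_commute (he' i)
      ((rX p κ d S i).isUnit.map gV) (Commute.all _ _)
    rwa [add_sub_cancel] at this
  have hcV := isAdicComplete_span_natCast_of_eq_zero p hV0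
  have hcT := isAdicComplete_span_natCast_of_eq_zero p hT
  have hcQ := isAdicComplete_span_natCast_of_eq_zero (T := V ⧸ I) p (by
    rw [← map_natCast (Ideal.Quotient.mk I), hV0, map_zero])
  -- `θ` is `f` on `R^□`, seen as a map to `V`; modulo `I` it agrees with `g`. The existence half of
  -- étaleness then lifts `g` modulo `I` to a map `F : S → V` extending `θ`.
  set θ : RSq p κ d →+* V := sqLift p κ d (gV.comp (algebraMap (WittVector p κ) (RR p S)))
    fun i => (hunit i).unit with hθ
  have hθs : (Ideal.Quotient.mk I).comp θ =
      ((Ideal.Quotient.mk I).comp gV).comp (algebraMap (RSq p κ d) (RR p S)) := by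
    refine sq_hom_ext _ _ (fun a => ?_) fun i => ?_
    · simp only [RingHom.comp_apply, hθ, sqLift_C, algebraMap_RR]
    · simp only [RingHom.comp_apply, hθ, sqLift_X, rX_val]
      exact Ideal.Quotient.eq.mpr (Ideal.subset_span ⟨i, rfl⟩)
  let _ := θ.toAlgebra
  let s : S →ₐ[RSq p κ d] V ⧸ I :=
    { ((Ideal.Quotient.mk I).comp gV).comp (algebraMap S (RR p S)) with
      commutes' := fun a => congr($hθs.symm a) }
  obtain ⟨F, hF⟩ := Algebra.FormallySmooth.exists_lift I hInil s
  have hfθ : f.comp (algebraMap (RSq p κ d) (RR p S)) = V.subtype.comp θ := by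
    refine sq_hom_ext _ _ (fun a => ?_) fun i => ?_
    · simp only [RingHom.comp_apply, hθ, sqLift_C, algebraMap_RR, hW]
      rfl
    · simp only [RingHom.comp_apply, hθ, sqLift_X, rX_val]
      rfl
  let G₁ : S →+* T := f.comp (algebraMap S (RR p S))
  let G₂ : S →+* T := V.subtype.comp (F : S →+* V)
  have hG : ∀ x, IsNilpotent (G₁ x - G₂ x) := by
    intro x
    have h1 : Ideal.Quotient.mk I (F x) = Ideal.Quotient.mk I (gV (algebraMap S (RR p S) x)) :=
      congr($hF x)
    rw [Ideal.Quotient.eq] at h1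
    have h2 : IsNilpotent (F x - gV (algebraMap S (RR p S) x)) :=
      (Ideal.FG.isNilpotent_iff_le_nilradical hIfg).mp hInil h1
    have h3 := h2.map V.subtype
    have h4 := Commute.isNilpotent_sub (Commute.all _ _) (hnil (algebraMap S (RR p S) x)) h3
    rw [map_sub] at h4
    have : G₁ x - G₂ x = f (algebraMap S (RR p S) x) - g (algebraMap S (RR p S) x) -
        (V.subtype (F x) - V.subtype (gV (algebraMap S (RR p S) x))) := by
      change f _ - V.subtype (F x) = _ - (_ - g _)
      ring
    rwa [this]
  -- `f` and `F` differ by nilpotents on `S`. Finite type makes the ideal generated by the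
  -- differences nilpotent, so the uniqueness half of étaleness gives `f = F` on `S`.
  obtain ⟨gen, hgen⟩ := (inferInstance : Algebra.FiniteType (RSq p κ d) S).out
  set K : Ideal T := Ideal.span ((fun x => G₁ x - G₂ x) '' (gen : Set S)) with hK
  have hKnil : IsNilpotent K := by
    rw [Ideal.FG.isNilpotent_iff_le_nilradical
      (Submodule.fg_span (gen.finite_toSet.image _)), Ideal.span_le]
    rintro _ ⟨x, -, rfl⟩
    exact hG x
  have hKh := isHausdorff_of_isNilpotent K hKnil
  have hbase : ∀ a, G₁ (algebraMap (RSq p κ d) S a) = G₂ (algebraMap (RSq p κ d) S a) := by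
    intro a
    have h1 : F (algebraMap (RSq p κ d) S a) = θ a := F.commutes a
    change f (algebraMap (RSq p κ d) (RR p S) a) = V.subtype (F (algebraMap (RSq p κ d) S a))
    rw [h1]
    exact congr($hfθ a)
  have hmem : ∀ x, G₁ x - G₂ x ∈ K := by
    intro x
    have hx : x ∈ Algebra.adjoin (RSq p κ d) (gen : Set S) := by rw [hgen]; trivial
    induction hx using Algebra.adjoin_induction with
    | mem x hx => exact Ideal.subset_span ⟨x, hx, rfl⟩
    | algebraMap a => rw [hbase, sub_self]; exact K.zero_mem
    | add x y _ _ h1 h2 =>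
      rw [map_add, map_add, add_sub_add_comm]
      exact K.add_mem h1 h2
    | mul x y _ _ h1 h2 =>
      rw [map_mul, map_mul, show G₁ x * G₁ y - G₂ x * G₂ y =
        (G₁ x - G₂ x) * G₁ y + G₂ x * (G₁ y - G₂ y) by ring]
      exact K.add_mem (K.mul_mem_right _ h1) (K.mul_mem_left _ h2)
  have hEq : G₁ = G₂ := lift_ext (P := RSq p κ d) K G₁ G₂ hbase hmem
  -- Since `p = 0` in `T`, the value `f r` depends only on `r` modulo `p`, and `r` may be replaced
  -- by an element of `S`.
  obtain ⟨a, ha⟩ := exists_of_sub_mem (span_natCast_fg p) 1 r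
  rw [pow_one, Ideal.map_span, Set.image_singleton, map_natCast, Ideal.mem_span_singleton] at ha
  obtain ⟨c, hc⟩ := ha
  have h1 := congrArg f hc
  rw [map_sub, map_mul, map_natCast, hT, zero_mul, sub_eq_zero] at h1
  rw [h1]
  have h2 : f (AdicCompletion.of _ S a) = G₂ a := congr($hEq a)
  rw [h2]
  exact (F a).2

end EtaleTransfer

/-! ### Torsion freeness of R and A_R, and expansions of [p]_q. -/

section TorsionFree

open PowerSeries

variable (p : ℕ) [Fact p.Prime] (κ : Type u) [Field κ] [CharP κ p] [PerfectRing κ p] (d : ℕ)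
  (S : Type v) [CommRing S] [Algebra (RSq p κ d) S] [Algebra.Etale (RSq p κ d) S]

theorem torsionFree_of_flat {A B : Type*} [CommRing A] [CommRing B] [Algebra A B]
    [Module.Flat A B] (n : ℕ) (hA : ∀ x : A, (n : A) * x = 0 → x = 0) (x : B)
    (hx : (n : B) * x = 0) : x = 0 := by
  have h1 : (n : A) ∈ nonZeroDivisors A :=
    mem_nonZeroDivisors_iff_left.mpr hA
  have h2 := Module.Flat.isSMulRegular_of_nonZeroDivisors (M := B) h1
  refine h2 ?_
  simp only [Algebra.smul_def, map_natCast, mul_zero]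
  exact hx

theorem laurent_torsionFree (x : Laurent p κ d) (hx : (p : Laurent p κ d) * x = 0) : x = 0 := by
  have h1 : ∀ x : WittVector p κ, (p : WittVector p κ) * x = 0 → x = 0 := fun x hx =>
    (mul_eq_zero.mp hx).resolve_left (WittVector.p_nonzero p κ)
  have h2 := torsionFree_of_flat (B := MvPolynomial (Fin d) (WittVector p κ)) p h1
  have : Module.Flat (MvPolynomial (Fin d) (WittVector p κ)) (Laurent p κ d) :=
    IsLocalization.flat _ (Submonoid.powers
      (∏ i : Fin d, (MvPolynomial.X i : MvPolynomial (Fin d) (WittVector p κ))))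
  exact torsionFree_of_flat p h2 x hx

-- Torsion freeness passes from the Laurent polynomial ring to R^□ and from `S` to R by completion,
-- and from R^□ to `S` by flatness of étale algebras.
include κ d in
theorem rr_torsionFree (x : RR p S) (hx : (p : RR p S) * x = 0) : x = 0 := by
  have h1 : ∀ x : RSq p κ d, (p : RSq p κ d) * x = 0 → x = 0 :=
    adicCompletion_torsionFree p (laurent_torsionFree p κ d) rfl
  have : Module.Flat (RSq p κ d) S := Algebra.Smooth.flat _ _
  exact adicCompletion_torsionFree p (torsionFree_of_flat p h1) rfl x hx

theorem coeff_natCast_mul {R : Type*} [CommRing R] (n k : ℕ) (f : R⟦X⟧) :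
    coeff k ((n : R⟦X⟧) * f) = n * coeff k f := by
  rw [← map_natCast (C (R := R)), coeff_C_mul]

include κ d in
theorem aa_torsionFree (x : AA p S) (hx : (p : AA p S) * x = 0) : x = 0 := by
  refine PowerSeries.ext fun k => ?_
  rw [map_zero]
  refine rr_torsionFree p κ d S _ ?_
  rw [← coeff_natCast_mul, hx, map_zero]

include κ d in
theorem aa_X_pow_dvd (j : ℕ) (x : AA p S) (hx : X ^ j ∣ (p : AA p S) * x) : X ^ j ∣ x := by
  rw [X_pow_dvd_iff] at hx ⊢
  intro m hm
  refine rr_torsionFree p κ d S _ ?_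
  rw [← coeff_natCast_mul, hx m hm]

/-- `[p]_q` is `p u + μ ^ (p - 1)`. -/
theorem exists_pQ_eq : ∃ u : AA p S, pQ p S = (p : AA p S) * u + X ^ (p - 1) := by
  have hp : p - 1 + 1 = p := Nat.sub_add_cancel (Nat.Prime.one_lt Fact.out).le
  -- `(1 + μ) ^ p - 1` is `μ ^ p` plus `p` times a cross term with a factor `μ`; dividing by `μ`
  -- gives the expansion. The final argument `1` only serves to match the shape `y * z`.
  obtain ⟨w, hw, -⟩ := crossTerm_mul_right p (1 : AA p S) X 1
  have h := mul_crossTerm (p := p) (1 : AA p S) (X * 1)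
  have h2 := geom_sum_mul (1 + X : AA p S) p
  refine ⟨w, X_mul_cancel ?_⟩
  have h3 : (X : AA p S) ^ p = X * X ^ (p - 1) := by rw [← pow_succ', hp]
  rw [hw, mul_one, h3] at h
  rw [pQ]
  linear_combination h2 - h + one_pow (M := AA p S) p

theorem exists_pQ_eq' : ∃ m : AA p S, pQ p S = (p : AA p S) + X * m := by
  have h : (X : AA p S) ∣ pQ p S - p := by
    rw [X_dvd_iff, pQ]
    simp
  obtain ⟨m, hm⟩ := h
  exact ⟨m, by linear_combination hm⟩

end TorsionFree

/-! ### Divided power sequences where p is invertible, and p-adic valuations of factorials. -/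

section PSeq

variable {T : Type*} [CommRing T] (p : ℕ) [hp : Fact p.Prime]

/-- The sequence with `s₀ = y` and `sₙ₊₁ = c sₙ ^ p`. -/
def pSeq (c y : T) : ℕ → T
  | 0 => y
  | n + 1 => c * pSeq c y n ^ p

variable {p}

theorem isPSeq_pSeq {c : T} (hc : (p : T) * c = 1) (y : T) : IsPSeq p (pSeq p c y) := by
  intro n
  rw [pSeq, ← mul_assoc, hc, one_mul]

/-- If `φ (s n) = p c`, then `p * φ (s (n + 1)) = p ^ p * c ^ p`; cancelling `p` leaves `p ^ (p - 1)
* c ^ p`, still a multiple of `p` as `p ≥ 2`. -/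
theorem IsPSeq.dvd_of_dvd {s : ℕ → T} (h : IsPSeq p s) (hT : ∀ x : T, (p : T) * x = 0 → x = 0)
    (φ : T →+* T) (h0 : (p : T) ∣ φ (s 0)) (n : ℕ) : (p : T) ∣ φ (s n) := by
  induction n with
  | zero => exact h0
  | succ n ih =>
    obtain ⟨c, hc⟩ := ih
    have h1 := congrArg φ (h n)
    rw [map_pow, hc, map_mul, map_natCast, mul_pow] at h1
    have hp2 := hp.out.two_le
    refine ⟨p ^ (p - 2) * c ^ p, sub_eq_zero.mp (hT _ ?_)⟩
    have e : (p : T) ^ p = p * (p * p ^ (p - 2)) := by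
      rw [← pow_succ', ← pow_succ']
      congr 1
      omega
    rw [e] at h1
    linear_combination -h1

theorem factorial_eq (k : ℕ) : ∃ u, ¬ p ∣ u ∧ k.factorial = p ^ padicValNat p k.factorial * u := by
  obtain ⟨u, hu⟩ := pow_padicValNat_dvd (p := p) (n := k.factorial)
  refine ⟨u, ?_, hu⟩
  rintro ⟨w, rfl⟩
  refine pow_succ_padicValNat_not_dvd (p := p) (Nat.factorial_ne_zero k) ⟨w, ?_⟩
  refine hu.trans ?_
  ring

theorem padicValNat_factorial_mono {m n : ℕ} (h : m ≤ n) :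
    padicValNat p m.factorial ≤ padicValNat p n.factorial := by
  obtain ⟨c, hc⟩ := Nat.factorial_dvd_factorial h
  have hc0 : c ≠ 0 := by
    rintro rfl
    exact Nat.factorial_ne_zero n (by simpa using hc)
  rw [hc, padicValNat.mul (Nat.factorial_ne_zero m) hc0]
  exact Nat.le_add_right _ _

end PSeq

/-! ### Monomial spanning set of the divided power algebra. -/

section PDGenerators

open PowerSeries

variable (p : ℕ) [hp : Fact p.Prime] (κ : Type u) [Field κ] [CharP κ p] (d : ℕ)
  (S : Type v) [CommRing S] [Algebra (WittVector p κ) S]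

/-- The inverse of `p` in `A_R[1/p]`. -/
def invP : AL p S := IsLocalization.Away.invSelf (p : AA p S)

theorem p_mul_invP : (p : AL p S) * invP p S = 1 := by
  have := IsLocalization.Away.mul_invSelf (S := AL p S) (p : AA p S)
  rwa [map_natCast] at this

/-- The sequence of iterated divided powers of `μ ^ (p - 1) / p` in `A_R[1/p]`. -/
def xAL : ℕ → AL p S := pSeq p (invP p S) (invP p S * algebraMap (AA p S) (AL p S) X ^ (p - 1))

theorem isPSeq_xAL : IsPSeq p (xAL p S) := isPSeq_pSeq (p_mul_invP p S) _

theorem p_mul_xAL : (p : AL p S) * xAL p S 0 = algebraMap (AA p S) (AL p S) X ^ (p - 1) := by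
  rw [xAL, pSeq, ← mul_assoc, p_mul_invP, one_mul]

/-- The sequence of iterated divided powers of `μ ^ (p - 1) / p` in `A_R[1/p][T₁, …, T_d]`. -/
def xMP (n : ℕ) : MP p d S := MvPolynomial.C (xAL p S n)

/-- The sequence of iterated divided powers of `Tᵢ` in `A_R[1/p][T₁, …, T_d]`. -/
def tMP (i : Fin d) : ℕ → MP p d S := pSeq p (MvPolynomial.C (invP p S)) (MvPolynomial.X i)

theorem isPSeq_xMP : IsPSeq p (xMP p d S) := fun n => by
  rw [xMP, xMP, ← map_pow, isPSeq_xAL p S n, map_mul, map_natCast]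

theorem p_mul_C_invP : (p : MP p d S) * MvPolynomial.C (invP p S) = 1 := by
  rw [← map_natCast (MvPolynomial.C (σ := Fin d)), ← map_mul, p_mul_invP, map_one]

theorem isPSeq_tMP (i : Fin d) : IsPSeq p (tMP p d S i) :=
  isPSeq_pSeq (p_mul_C_invP p d S) _

theorem p_mul_xMP : (p : MP p d S) * xMP p d S 0 = algebraMap (AA p S) (MP p d S) X ^ (p - 1) := by
  rw [xMP, ← map_natCast (MvPolynomial.C (σ := Fin d)), ← map_mul, p_mul_xAL, map_pow]
  rfl

theorem mp_torsionFree {x : MP p d S} (hx : (p : MP p d S) * x = 0) : x = 0 := by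
  have := congrArg (MvPolynomial.C (invP p S) * ·) hx
  simp only [mul_zero, ← mul_assoc] at this
  rwa [mul_comm (MvPolynomial.C (invP p S)), p_mul_C_invP, one_mul] at this

theorem mp_torsionFree_pow {x : MP p d S} (n : ℕ) (hx : (p : MP p d S) ^ n * x = 0) : x = 0 := by
  induction n with
  | zero => simpa using hx
  | succ n ih => exact ih (mp_torsionFree p d S (by rwa [pow_succ', mul_assoc] at hx))

-- The unit is the prime-to-`p` part of `k!`, invertible because A_R is a W(κ)-algebra. Thus digit
-- products and honest divided powers generate the same A_R-modules.
include κ in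
theorem exists_unit_digitProd {s : ℕ → MP p d S} (hs : IsPSeq p s) (k : ℕ) :
    ∃ u : (AA p S)ˣ, ∀ y, (k.factorial : MP p d S) * y = s 0 ^ k ↔
      digitProd p s k = algebraMap (AA p S) (MP p d S) u * y := by
  obtain ⟨u, hu, hk⟩ := factorial_eq (p := p) k
  obtain ⟨u', hu'⟩ := isUnit_natCast_AA p S κ hu
  refine ⟨u', fun y => ?_⟩
  have h1 := digitProd_pow p hs k
  have h2 : (k.factorial : MP p d S) = p ^ padicValNat p k.factorial *
      algebraMap (AA p S) (MP p d S) u' := by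
    rw [hu', map_natCast]
    exact_mod_cast congrArg (Nat.cast (R := MP p d S)) hk
  constructor
  · intro hy
    refine sub_eq_zero.mp (mp_torsionFree_pow p d S (padicValNat p k.factorial) ?_)
    rw [mul_sub, h1, ← hy, h2]
    ring
  · intro hy
    rw [← h1, hy, h2]
    ring

theorem xMP_pow_iff (k : ℕ) (y : MP p d S) :
    (k.factorial : MP p d S) * y = xMP p d S 0 ^ k ↔ ((p ^ k * k.factorial : ℕ) : MP p d S) * y =
        algebraMap (AA p S) (MP p d S) X ^ ((p - 1) * k) := by
  rw [pow_mul, ← p_mul_xMP, mul_pow]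
  push_cast
  constructor
  · intro h
    rw [mul_assoc, h]
  · intro h
    refine sub_eq_zero.mp (mp_torsionFree_pow p d S k ?_)
    linear_combination h

include κ in
theorem pdAlg_digitProd_xMP (k : ℕ) : digitProd p (xMP p d S) k ∈ pdAlg p d S := by
  obtain ⟨u, hu⟩ := exists_unit_digitProd p κ d S (isPSeq_xMP p d S) k
  have h1 : digitProd p (xMP p d S) k = algebraMap (AA p S) (MP p d S) u *
      (algebraMap (AA p S) (MP p d S) (u⁻¹ : (AA p S)ˣ) * digitProd p (xMP p d S) k) := by
    rw [← mul_assoc, ← map_mul, Units.mul_inv, map_one, one_mul]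
  have h2 := (hu _).mpr h1
  rw [h1]
  exact Subalgebra.mul_mem _ (pdAlg_A p d S _) (pdAlg_mu p d S ((xMP_pow_iff p d S k _).mp h2))

include κ in
theorem pdAlg_digitProd_tMP (i : Fin d) (k : ℕ) : digitProd p (tMP p d S i) k ∈ pdAlg p d S := by
  obtain ⟨u, hu⟩ := exists_unit_digitProd p κ d S (isPSeq_tMP p d S i) k
  have h1 : digitProd p (tMP p d S i) k = algebraMap (AA p S) (MP p d S) u *
      (algebraMap (AA p S) (MP p d S) (u⁻¹ : (AA p S)ˣ) * digitProd p (tMP p d S i) k) := by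
    rw [← mul_assoc, ← map_mul, Units.mul_inv, map_one, one_mul]
  have h2 := (hu _).mpr h1
  rw [h1]
  exact Subalgebra.mul_mem _ (pdAlg_A p d S _) (pdAlg_T p d S h2)

/-- The iterated divided powers of `μ ^ (p - 1) / p` in the divided power algebra. -/
def xPD (n : ℕ) : PD p d S := (⟨xMP p d S n, by
  rw [← digitProd_prime_pow p (xMP p d S)]; exact pdAlg_digitProd_xMP p κ d S _⟩ : pdAlg p d S)

/-- The iterated divided powers of `Tᵢ` in the divided power algebra. -/
def tPD (i : Fin d) (n : ℕ) : PD p d S := (⟨tMP p d S i n, by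
  rw [← digitProd_prime_pow p (tMP p d S i)]; exact pdAlg_digitProd_tMP p κ d S _ _⟩ : pdAlg p d S)

theorem pdVal_xPD (n : ℕ) : pdVal p d S (xPD p κ d S n) = xMP p d S n := rfl

theorem pdVal_tPD (i : Fin d) (n : ℕ) : pdVal p d S (tPD p κ d S i n) = tMP p d S i n := rfl

theorem pdVal_pdA (a : AA p S) : pdVal p d S (pdA p d S a) = algebraMap _ _ a := rfl

theorem isPSeq_xPD : IsPSeq p (xPD p κ d S) := fun n => pdVal_injective p d S (by
  rw [map_pow, map_mul, map_natCast]
  exact isPSeq_xMP p d S n)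

theorem isPSeq_tPD (i : Fin d) : IsPSeq p (tPD p κ d S i) := fun n => pdVal_injective p d S (by
  rw [map_pow, map_mul, map_natCast]
  exact isPSeq_tMP p d S i n)

theorem p_mul_xPD : (p : PD p d S) * xPD p κ d S 0 = pdA p d S X ^ (p - 1) :=
  pdVal_injective p d S (by
    rw [map_pow, map_mul, map_natCast]
    exact p_mul_xMP p d S)

theorem tPD_zero (i : Fin d) : tPD p κ d S i 0 = pdT p d S i := rfl

theorem pd_torsionFree (x : PD p d S) (hx : (p : PD p d S) * x = 0) : x = 0 := by
  refine pdVal_injective p d S ?_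
  rw [map_zero]
  refine mp_torsionFree p d S ?_
  rw [← map_natCast (pdVal p d S), ← map_mul, hx, map_zero]

/-- The divided power algebra is spanned by the divided power monomials. -/
theorem mem_pdSpan_PD (y : PD p d S) : y ∈ pdSpan p (pdA p d S) (xPD p κ d S) (tPD p κ d S)
    (isPSeq_xPD p κ d S) (isPSeq_tPD p κ d S) := by
  set V := pdSpan p (pdA p d S) (xPD p κ d S) (tPD p κ d S)
    (isPSeq_xPD p κ d S) (isPSeq_tPD p κ d S) with hV
  have hA : ∀ a, pdA p d S a ∈ V := fun a => map_mem_pdSpan p _ a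
  -- Both families of generators have the form `s 0 ^ k / k!`, which is a unit of A_R times a digit
  -- product.
  have hgen : ∀ (s : ℕ → PD p d S), IsPSeq p s → (∀ n, s n ∈ V) → ∀ (k : ℕ) (x : MP p d S),
      (k.factorial : MP p d S) * x = pdVal p d S (s 0) ^ k → ∃ y ∈ V, pdVal p d S y = x := by
    intro s hs hsV k x hx
    have hs' : IsPSeq p fun n => pdVal p d S (s n) := fun n => by
      rw [← map_pow, hs n, map_mul, map_natCast]
    obtain ⟨u, hu⟩ := exists_unit_digitProd p κ d S hs' k
    have h1 := (hu x).mp hx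
    refine ⟨pdA p d S (u⁻¹ : (AA p S)ˣ) * digitProd p s k,
      V.mul_mem (hA _) (digitProd_mem p V hsV k), ?_⟩
    rw [map_mul, map_digitProd, h1, pdVal_pdA, ← mul_assoc, ← map_mul, Units.inv_mul, map_one,
      one_mul]
  have main : ∀ x ∈ pdAlg p d S, ∃ y ∈ V, pdVal p d S y = x := by
    intro x hx
    induction hx using Algebra.adjoin_induction with
    | mem x hx =>
      rcases hx with ⟨k, h⟩ | ⟨i, k, h⟩
      · exact hgen _ (isPSeq_xPD p κ d S) (fun n => x_mem_pdSpan p _ n) k x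
          ((xMP_pow_iff p d S k x).mpr h)
      · exact hgen _ (isPSeq_tPD p κ d S i) (fun n => t_mem_pdSpan p _ i n) k x h
    | algebraMap a => exact ⟨pdA p d S a, hA a, rfl⟩
    | add x y _ _ h1 h2 =>
      obtain ⟨a, ha, rfl⟩ := h1
      obtain ⟨b, hb, rfl⟩ := h2
      exact ⟨a + b, V.add_mem ha hb, map_add _ _ _⟩
    | mul x y _ _ h1 h2 =>
      obtain ⟨a, ha, rfl⟩ := h1
      obtain ⟨b, hb, rfl⟩ := h2
      exact ⟨a * b, V.mul_mem ha hb, map_mul _ _ _⟩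
  obtain ⟨z, hz, h⟩ := main (pdVal p d S y) y.2
  rwa [← pdVal_injective p d S h]

end PDGenerators

/-! ### Relations between divided power monomials, and the Frobenius lift. -/

section PDStructure

open PowerSeries

variable (p : ℕ) [hp : Fact p.Prime] (κ : Type u) [Field κ] [CharP κ p] (d : ℕ)
  (S : Type v) [CommRing S] [Algebra (WittVector p κ) S]

theorem digitProd_tMP (i : Fin d) (k : ℕ) : digitProd p (tMP p d S i) k =
    MvPolynomial.C (invP p S ^ padicValNat p k.factorial) * MvPolynomial.X i ^ k := by
  have h := digitProd_pow p (isPSeq_tMP p d S i) k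
  rw [show tMP p d S i 0 = MvPolynomial.X i from rfl] at h
  rw [← h, map_pow, ← mul_assoc, ← mul_pow, mul_comm (MvPolynomial.C _), p_mul_C_invP, one_pow,
    one_mul]

theorem prod_digitProd_tMP (l : Fin d →₀ ℕ) : ∏ i, digitProd p (tMP p d S i) (l i) =
    MvPolynomial.monomial l (∏ i, invP p S ^ padicValNat p (l i).factorial) := by
  simp only [digitProd_tMP, Finset.prod_mul_distrib]
  rw [← map_prod, MvPolynomial.monomial_eq, Finsupp.prod_fintype _ _ (by simp)]

/-- The exponent of `p` collects `n` from the denominator of (μ^(p-1)/p)^n and v_p(n!) from the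
divided power. -/
theorem pow_mul_digitProd_xAL (n : ℕ) :
    (p : AL p S) ^ (n + padicValNat p n.factorial) * digitProd p (xAL p S) n =
      algebraMap (AA p S) (AL p S) ((X ^ (p - 1)) ^ n) := by
  rw [pow_add, mul_assoc, digitProd_pow p (isPSeq_xAL p S), ← mul_pow, p_mul_xAL, map_pow, map_pow]

variable [PerfectRing κ p] [Algebra (RSq p κ d) S] [Algebra.Etale (RSq p κ d) S]

include κ d in
theorem algebraMap_AL_injective : Function.Injective (algebraMap (AA p S) (AL p S)) := by
  rw [injective_iff_map_eq_zero]
  intro a ha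
  obtain ⟨⟨_, n, rfl⟩, hm⟩ := (IsLocalization.map_eq_zero_iff
    (Submonoid.powers (p : AA p S)) (AL p S) a).mp ha
  simp only at hm
  induction n with
  | zero => simpa using hm
  | succ n ih =>
    refine ih (aa_torsionFree p κ d S _ ?_)
    rw [← mul_assoc, ← pow_succ', hm]

-- Put e(n) = n + v_p(n!). Multiplication by p^e(N) turns the relation into one between the elements
-- p^(e(N) − e(n)) μ^((p-1)n) of A_R. The summand `n` makes `e` strictly increasing, as
-- `coeff_mem_of_sum_eq_zero` requires.
include κ d in
theorem coeff_mem_of_sum_digitProd (N : ℕ) (c : ℕ → AA p S)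
    (h : ∑ n ∈ Finset.range (N + 1), algebraMap (AA p S) (AL p S) (c n) *
      digitProd p (xAL p S) n = 0) (n : ℕ) (hn : n ≤ N) :
    c n ∈ Ideal.span {(p : AA p S), X ^ (p - 1)} := by
  have hmono : ∀ m n : ℕ, m ≤ n → padicValNat p m.factorial ≤ padicValNat p n.factorial :=
    fun m n h => padicValNat_factorial_mono h
  set e : ℕ → ℕ := fun n => n + padicValNat p n.factorial with he
  have hmul : ∀ n ≤ N, (p : AL p S) ^ e N * digitProd p (xAL p S) n =
      algebraMap (AA p S) (AL p S) ((p : AA p S) ^ (e N - e n) * (X ^ (p - 1)) ^ n) := by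
    intro n hn
    have h1 : e n ≤ e N := add_le_add hn (hmono n N hn)
    have h2 : (p : AL p S) ^ e N = (p : AL p S) ^ (e N - e n) * (p : AL p S) ^ e n := by
      rw [← pow_add, Nat.sub_add_cancel h1]
    have h3 : algebraMap (AA p S) (AL p S) ((p : AA p S) ^ (e N - e n)) =
        (p : AL p S) ^ (e N - e n) := by rw [map_pow, map_natCast]
    rw [h2, mul_assoc, pow_mul_digitProd_xAL, map_mul, h3]
  refine coeff_mem_of_sum_eq_zero (p := (p : AA p S)) (m := X ^ (p - 1)) (fun a ha => ?_)
    (fun a ha => aa_X_pow_dvd p κ d S _ a ha) N c (fun n => e N - e n) (fun k hk => ?_) ?_ n hn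
  · exact X_pow_mul_cancel (k := p - 1) (by rw [ha, mul_zero])
  · have h1 : e (k + 1) ≤ e N := add_le_add hk (hmono _ N hk)
    have h2 := hmono k (k + 1) (Nat.le_succ k)
    simp only [he] at h1 ⊢
    omega
  · refine algebraMap_AL_injective p κ d S ?_
    have h1 := congrArg ((p : AL p S) ^ e N * ·) h
    simp only [mul_zero, Finset.mul_sum] at h1
    rw [map_zero, map_sum, ← h1]
    refine Finset.sum_congr rfl fun n hn => ?_
    rw [mul_left_comm, hmul n (Nat.lt_succ_iff.mp (Finset.mem_range.mp hn)), ← map_mul, mul_assoc]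

/-- The coefficients of a linear relation between the divided power monomials lie in
`(p, μ ^ (p - 1))`. -/
theorem coeff_mem_of_sum_pdMon (c : (ℕ × (Fin d →₀ ℕ)) →₀ AA p S)
    (h : c.sum (fun k a => pdA p d S a * pdMon p (xPD p κ d S) (tPD p κ d S) k) = 0)
    (k : ℕ × (Fin d →₀ ℕ)) : c k ∈ Ideal.span {(p : AA p S), X ^ (p - 1)} := by
  classical
  obtain ⟨N, hN⟩ : ∃ N, ∀ k ∈ c.support, k.1 ≤ N :=
    ⟨c.support.sup Prod.fst, fun k hk => Finset.le_sup (f := Prod.fst) hk⟩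
  by_cases hk : k ∈ c.support
  swap
  · rw [Finsupp.notMem_support_iff.mp hk]
    exact Ideal.zero_mem _
  set L : Finset (Fin d →₀ ℕ) := c.support.image Prod.snd with hL
  have hsub : c.support ⊆ Finset.range (N + 1) ×ˢ L := fun k hk =>
    Finset.mem_product.mpr ⟨Finset.mem_range.mpr (Nat.lt_succ_of_le (hN k hk)),
      Finset.mem_image_of_mem _ hk⟩
  have h1 := congrArg (pdVal p d S) h
  rw [Finsupp.sum_of_support_subset _ hsub _ (by simp), map_zero, map_sum,
    Finset.sum_product_right] at h1
  have hterm : ∀ (n : ℕ) (l : Fin d →₀ ℕ), pdVal p d S (pdA p d S (c (n, l)) *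
      pdMon p (xPD p κ d S) (tPD p κ d S) (n, l)) = MvPolynomial.monomial l
      (algebraMap (AA p S) (AL p S) (c (n, l)) * digitProd p (xAL p S) n *
        ∏ i, invP p S ^ padicValNat p (l i).factorial) := by
    intro n l
    rw [map_mul, map_pdMon, pdVal_pdA, pdMon]
    simp only [pdVal_xPD, pdVal_tPD]
    rw [prod_digitProd_tMP, show digitProd p (fun n => xMP p d S n) n =
      MvPolynomial.C (digitProd p (xAL p S) n) from (map_digitProd p _ _ _).symm,
      show algebraMap (AA p S) (MP p d S) (c (n, l)) =
        MvPolynomial.C (algebraMap (AA p S) (AL p S) (c (n, l))) from rfl,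
      ← mul_assoc, ← map_mul, MvPolynomial.C_mul_monomial]
  simp only [hterm] at h1
  -- Monomials in the `Tᵢ` are independent over A_R[1/p], so each exponent of `T` carries its own
  -- relation; the remaining common factor is a product of powers of 1/p, hence a unit.
  have h2 := congrArg (MvPolynomial.coeff k.2) h1
  rw [MvPolynomial.coeff_sum, MvPolynomial.coeff_zero, Finset.sum_eq_single k.2] at h2
  rotate_left
  · intro l _ hl
    rw [MvPolynomial.coeff_sum]
    exact Finset.sum_eq_zero fun n _ => by rw [MvPolynomial.coeff_monomial, if_neg hl]
  · exact fun hn => absurd (Finset.mem_image_of_mem _ hk) hn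
  rw [MvPolynomial.coeff_sum] at h2
  simp only [MvPolynomial.coeff_monomial, if_true] at h2
  rw [← Finset.sum_mul] at h2
  have hu : IsUnit (∏ i, invP p S ^ padicValNat p (k.2 i).factorial) := by
    rw [IsUnit.prod_iff]
    intro i _
    exact (IsUnit.of_mul_eq_one (p : AL p S) (by rw [mul_comm, p_mul_invP])).pow _
  have h3 := (hu.mul_left_eq_zero).mp h2
  exact coeff_mem_of_sum_digitProd p κ d S N (fun n => c (n, k.2)) h3 k.1 (hN k hk)

variable [IsScalarTower (WittVector p κ) (RSq p κ d) S]

-- `[p]_q = p u + μ ^ (p - 1)`, and here `μ ^ (p - 1)` is `p` times the generator μ^(p-1)/p.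
include κ in
theorem pdA_pQ : ∃ y, pdA p d S (pQ p S) = (p : PD p d S) * y := by
  obtain ⟨u, hu⟩ := exists_pQ_eq p S
  refine ⟨pdA p d S u + xPD p κ d S 0, ?_⟩
  rw [hu, map_add, map_mul, map_natCast, map_pow, ← p_mul_xPD p κ d S, mul_add]

/-- As φ(μ) = μ [p]_q, the first term is multiplied by [p]_q^(p-1), which `p` divides by `pdA_pQ`.
`IsPSeq.dvd_of_dvd` carries this along the sequence. -/
theorem p_dvd_frobPD_x (n : ℕ) : (p : PD p d S) ∣ frobPD p d S κ (xPD p κ d S n) := by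
  refine (isPSeq_xPD p κ d S).dvd_of_dvd (pd_torsionFree p d S) _ ?_ n
  obtain ⟨y, hy⟩ := pdA_pQ p κ d S
  have h1 := congrArg (frobPD p d S κ) (p_mul_xPD p κ d S)
  rw [map_mul, map_natCast, map_pow, frobPD_pdA, ← X_mul_pQ, map_mul, mul_pow,
    ← p_mul_xPD p κ d S, mul_assoc] at h1
  have h2 : frobPD p d S κ (xPD p κ d S 0) = xPD p κ d S 0 * pdA p d S (pQ p S) ^ (p - 1) :=
    sub_eq_zero.mp (pd_torsionFree p d S _ (by rw [mul_sub, h1, sub_self]))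
  rw [h2, hy]
  have : p - 1 ≠ 0 := by
    have := hp.out.two_le
    omega
  exact Dvd.dvd.mul_left (dvd_pow (Dvd.intro _ rfl) this) _

/-- φ(Tᵢ) = Xᵢ^p − (Xᵢ − Tᵢ)^p is congruent to Tᵢ^p modulo p, and Tᵢ^p is `p` times the next term of
the sequence. -/
theorem p_dvd_frobPD_t (i : Fin d) (n : ℕ) :
    (p : PD p d S) ∣ frobPD p d S κ (tPD p κ d S i n) := by
  refine (isPSeq_tPD p κ d S i).dvd_of_dvd (pd_torsionFree p d S) _ ?_ n
  rw [tPD_zero]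
  have h1 := frobPD_sub p d S κ i
  rw [map_sub, frobPD_pdA, frobA_rX, map_pow] at h1
  set x := pdA p d S (C (rX p κ d S i : RR p S))
  have h2 := mul_crossTerm (p := p) (x - pdT p d S i) (pdT p d S i)
  rw [sub_add_cancel, ← tPD_zero p κ d S, isPSeq_tPD p κ d S i 0, tPD_zero] at h2
  exact ⟨crossTerm p (x - pdT p d S i) (pdT p d S i) + tPD p κ d S i 1, by
    linear_combination -h1 - h2⟩

/-- `frobPD` lifts the absolute Frobenius modulo `p`. -/
theorem frobPD_sub_pow_mem (y : PD p d S) :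
    frobPD p d S κ y - y ^ p ∈ Ideal.span {(p : PD p d S)} := by
  set π := Ideal.Quotient.mk (Ideal.span {(p : PD p d S)}) with hπ
  set W : Subring (PD p d S) := RingHom.eqLocus (π.comp (frobPD p d S κ))
    ((absFrob p (quot_natCast_eq_zero _ p)).comp π) with hW
  have hmem : ∀ y, y ∈ W ↔ frobPD p d S κ y - y ^ p ∈ Ideal.span {(p : PD p d S)} := by
    intro y
    rw [← Ideal.Quotient.eq, map_pow]
    rfl
  -- On A_R this is `frobA_sub_pow_mem`. On a divided power `s n` both `φ (s n)` and `s n ^ p = p *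
  -- s (n + 1)` vanish modulo `p`.
  have hle := pdSpan_le p (pdA p d S) (hx := isPSeq_xPD p κ d S) (ht := isPSeq_tPD p κ d S) W
    (fun a => ?_) (fun n => ?_) (fun i n => ?_)
  · exact (hmem y).mp (hle (mem_pdSpan_PD p κ d S y))
  · rw [hmem, frobPD_pdA, ← map_pow, ← map_sub]
    exact map_span_natCast_le (pdA p d S) p
      (Ideal.mem_map_of_mem _ (frobA_sub_pow_mem p κ d S a))
  · rw [hmem, isPSeq_xPD p κ d S n, Ideal.mem_span_singleton]
    exact dvd_sub (p_dvd_frobPD_x p κ d S n) (Dvd.intro _ rfl)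
  · rw [hmem, isPSeq_tPD p κ d S i n, Ideal.mem_span_singleton]
    exact dvd_sub (p_dvd_frobPD_t p κ d S i n) (Dvd.intro _ rfl)

theorem frobPDhat_ofPD (y : PD p d S) :
    frobPDhat p d S κ (ofPD p d S y) = ofPD p d S (frobPD p d S κ y) :=
  adicMap_of _ _ _ _ y

theorem gammaPDhat_ofPD (g : GammaR p d) (y : PD p d S) :
    gammaPDhat p d S κ g (ofPD p d S y) = ofPD p d S (gammaPD p d S κ g y) :=
  adicMap_of _ _ _ _ y

theorem isHausdorff_natCast (A : Type*) [CommRing A] (p : ℕ) : IsHausdorff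
    (Ideal.span {(p : AdicCompletion (Ideal.span {(p : A)}) A)})
    (AdicCompletion (Ideal.span {(p : A)}) A) :=
  (isAdicComplete_natCast p).toIsHausdorff

theorem pdhat_torsionFree (y : PDhat p d S) (hy : (p : PDhat p d S) * y = 0) : y = 0 :=
  adicCompletion_torsionFree p (pd_torsionFree p d S) rfl y hy

theorem frobPDhat_sub_pow_mem (y : PDhat p d S) :
    frobPDhat p d S κ y - y ^ p ∈ Ideal.span {(p : PDhat p d S)} := by
  set I := Ideal.span {(p : PDhat p d S)} with hI
  have h0 := isAdicComplete_span_natCast_of_eq_zero (T := PDhat p d S ⧸ I) p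
    (quot_natCast_eq_zero _ p)
  have key : (Ideal.Quotient.mk I).comp (frobPDhat p d S κ) =
      (absFrob p (quot_natCast_eq_zero _ p)).comp (Ideal.Quotient.mk I) := by
    refine padic_hom_ext _ _ fun a => ?_
    change Ideal.Quotient.mk I (frobPDhat p d S κ (ofPD p d S a)) =
      (Ideal.Quotient.mk I (ofPD p d S a)) ^ p
    rw [frobPDhat_ofPD, ← map_pow, ← map_pow, Ideal.Quotient.eq, ← map_sub]
    exact map_span_natCast_le (ofPD p d S) p
      (Ideal.mem_map_of_mem _ (frobPD_sub_pow_mem p κ d S a))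
  rw [← Ideal.Quotient.eq, map_pow]
  exact congr($key y)

theorem p_dvd_of_ofPD {y : PD p d S} {z : PDhat p d S} (h : ofPD p d S y = p * z) :
    ∃ w, y = (p : PD p d S) * w := by
  rw [← dvd_def, ← Ideal.mem_span_singleton]
  refine mem_of_of_mem_map ?_
  rw [Ideal.map_span, Set.image_singleton, map_natCast, Ideal.mem_span_singleton]
  exact ⟨z, h⟩

theorem exists_ofPD_add (y : PDhat p d S) : ∃ (a : PD p d S) (z : PDhat p d S),
    y = ofPD p d S a + p * z := by
  obtain ⟨a, ha⟩ := exists_of_sub_mem (span_natCast_fg p) 1 y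
  rw [pow_one, Ideal.map_span, Set.image_singleton, map_natCast, Ideal.mem_span_singleton] at ha
  obtain ⟨z, hz⟩ := ha
  exact ⟨a, z, sub_eq_iff_eq_add'.mp hz⟩

end PDStructure

/-! ### The map from the first factor A_R to the completed divided power algebra. -/

section FirstFactor

open PowerSeries

variable (p : ℕ) [hp : Fact p.Prime] (κ : Type u) [Field κ] [CharP κ p] [PerfectRing κ p] (d : ℕ)
  (S : Type v) [CommRing S] [Algebra (WittVector p κ) S]
  [Algebra (RSq p κ d) S] [Algebra.Etale (RSq p κ d) S]
  [IsScalarTower (WittVector p κ) (RSq p κ d) S]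

/-- The structure map of the `A_R`-algebra `PDhat`. -/
def hatA : AA p S →+* PDhat p d S := (ofPD p d S).comp (pdA p d S)

/-- The ideal `(p, μ, T₁, …, T_d)` of `PDhat`. -/
def idT : Ideal (PDhat p d S) :=
  Ideal.span ({(p : PDhat p d S), hatA p d S X} ∪ Set.range fun i => ofPD p d S (pdT p d S i))

theorem idT_fg : (idT p d S).FG :=
  Submodule.fg_span ((Set.toFinite _).union (Set.finite_range _))

theorem p_mem_idT : (p : PDhat p d S) ∈ idT p d S := Ideal.subset_span (by simp)

theorem X_mem_idT : hatA p d S X ∈ idT p d S := Ideal.subset_span (by simp)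

theorem T_mem_idT (i : Fin d) : ofPD p d S (pdT p d S i) ∈ idT p d S :=
  Ideal.subset_span (Or.inr ⟨i, rfl⟩)

include κ in
theorem hatA_X_pow : ∃ y, hatA p d S X ^ (p - 1) = p * y := by
  refine ⟨ofPD p d S (xPD p κ d S 0), ?_⟩
  rw [hatA, RingHom.comp_apply, ← map_pow, ← p_mul_xPD p κ d S, map_mul, map_natCast]

include κ in
theorem idT_pow (x : PDhat p d S)
    (hx : x ∈ ({(p : PDhat p d S), hatA p d S X} ∪
      Set.range fun i => ofPD p d S (pdT p d S i) : Set (PDhat p d S))) :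
    x ^ p ∈ Ideal.span {(p : PDhat p d S)} := by
  rw [Ideal.mem_span_singleton]
  rcases hx with (rfl | rfl) | ⟨i, rfl⟩
  · exact dvd_pow_self _ hp.out.ne_zero
  · obtain ⟨y, hy⟩ := hatA_X_pow p κ d S
    have h : p = (p - 1) + 1 := (Nat.sub_add_cancel hp.out.one_lt.le).symm
    have h2 : hatA p d S X ^ p = hatA p d S X ^ (p - 1) * hatA p d S X := by
      rw [← pow_succ, ← h]
    rw [h2, hy, mul_assoc]
    exact Dvd.intro _ rfl
  · simp only
    rw [← map_pow, ← tPD_zero p κ d S, isPSeq_tPD p κ d S i 0, map_mul, map_natCast]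
    exact Dvd.intro _ rfl

-- The finitely many generators of `idT` have `p`-th powers divisible by `p`, so the `idT`-adic
-- topology is the `p`-adic one.
include κ in
theorem isAdicComplete_idT : IsAdicComplete (idT p d S) (PDhat p d S) := by
  have h1 : idT p d S ≤ (Ideal.span {(p : PDhat p d S)}).radical := by
    rw [idT, Ideal.span_le]
    exact fun x hx => ⟨p, idT_pow p κ d S x hx⟩
  obtain ⟨N, hN⟩ := Ideal.exists_pow_le_of_le_radical_of_fg h1 (idT_fg p d S)
  have := isAdicComplete_natCast (A := PD p d S) p
  exact isAdicComplete_of_pow_le (J := Ideal.span {(p : PDhat p d S)})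
    (by rw [Ideal.span_le]; rintro _ rfl; exact p_mem_idT p d S) N hN

/-- Modulo `p` the Frobenius is the `p`-th power, which kills the generators of `idT`. This is what
gives (φ(r) ⊗ 1 − 1 ⊗ φ(r))/([p]_q ⊗ 1) an image in `PDhat`. -/
theorem frobPDhat_mem (x : PDhat p d S) (hx : x ∈ idT p d S) :
    frobPDhat p d S κ x ∈ Ideal.span {(p : PDhat p d S)} := by
  have hle : idT p d S ≤ (Ideal.span {(p : PDhat p d S)}).comap (frobPDhat p d S κ) := by
    rw [idT, Ideal.span_le]
    intro x hx
    have := Ideal.add_mem _ (frobPDhat_sub_pow_mem p κ d S x) (idT_pow p κ d S x hx)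
    rwa [sub_add_cancel] at this
  exact hle hx

theorem frobPDhat_hatA (a : AA p S) :
    frobPDhat p d S κ (hatA p d S a) = hatA p d S (frobA p κ d S a) := by
  rw [hatA, RingHom.comp_apply, frobPDhat_ofPD, frobPD_pdA, RingHom.comp_apply]

theorem gammaPDhat_hatA (g : GammaR p d) (a : AA p S) :
    gammaPDhat p d S κ g (hatA p d S a) = hatA p d S (gammaA p κ d S g a) := by
  rw [hatA, RingHom.comp_apply, gammaPDhat_ofPD, gammaPD_pdA, RingHom.comp_apply]

theorem hatA_gammaA_sub (g : GammaR p d) (a : AA p S) :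
    hatA p d S (gammaA p κ d S g a) - hatA p d S a ∈ idT p d S := by
  obtain ⟨c, hc⟩ := Ideal.mem_span_singleton.mp (gammaA_sub_mem p κ d S g a)
  rw [← map_sub, hc, map_mul]
  exact Ideal.mul_mem_right _ _ (X_mem_idT p d S)

theorem gammaPDhat_idT (g : GammaR p d) (x : PDhat p d S) (hx : x ∈ idT p d S) :
    gammaPDhat p d S κ g x ∈ idT p d S := by
  have hle : idT p d S ≤ (idT p d S).comap (gammaPDhat p d S κ g) := by
    conv_lhs => rw [idT]
    rw [Ideal.span_le]
    rintro x ((rfl | rfl) | ⟨i, rfl⟩)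
    · change gammaPDhat p d S κ g _ ∈ idT p d S
      rw [map_natCast]
      exact p_mem_idT p d S
    · change gammaPDhat p d S κ g _ ∈ idT p d S
      obtain ⟨c, hc⟩ := gammaA_X_eq p κ d S g
      rw [gammaPDhat_hatA, hc, map_mul]
      exact Ideal.mul_mem_right _ _ (X_mem_idT p d S)
    · change gammaPDhat p d S κ g (ofPD p d S (pdT p d S i)) ∈ idT p d S
      rw [gammaPDhat_ofPD, gammaPD_pdT, map_add, map_sub, map_sub]
      exact Ideal.add_mem _ (hatA_gammaA_sub p κ d S g _) (T_mem_idT p d S i)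
  exact hle hx

/-- The element `Xᵢ - Tᵢ` of `PDhat`. -/
abbrev hatXT (i : Fin d) : PDhat p d S :=
  ofPD p d S (pdA p d S (C (rX p κ d S i : RR p S)) - pdT p d S i)

/-- `Xᵢ - Tᵢ = Xᵢ (1 - Xᵢ⁻¹ Tᵢ)`, and `Tᵢ` lies in the Jacobson radical by completeness for `idT`.
-/
theorem isUnit_hatXT (i : Fin d) : IsUnit (hatXT p κ d S i) := by
  have := isAdicComplete_idT p κ d S
  have hT := IsAdicComplete.le_jacobson_bot (idT p d S) (T_mem_idT p d S i)
  obtain ⟨x, hx⟩ : IsUnit (hatA p d S (C (rX p κ d S i : RR p S))) :=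
    (rX p κ d S i).isUnit.map ((hatA p d S).comp (C (R := RR p S)))
  have h1 := (Ideal.mem_jacobson_bot.mp hT) (-((x⁻¹ : (PDhat p d S)ˣ) : PDhat p d S))
  have h2 := x.isUnit.mul h1
  rw [mul_add, mul_one, mul_neg, mul_neg, mul_left_comm, Units.mul_inv, mul_one, hx] at h2
  rw [hatXT, map_sub]
  rwa [neg_add_eq_sub] at h2

/-- Étale lifting along `PDhat → PDhat ⧸ idT`: the assignment Xᵢ ↦ Xᵢ − Tᵢ on R^□ reduces to the
structure map modulo `idT`, which is defined on all of `S`. The lift on `S` then extends to its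
p-adic completion. -/
theorem exists_hatR : ∃ s : RR p S →+* PDhat p d S,
    (∀ a, s (algebraMap (WittVector p κ) (RR p S) a) =
      hatA p d S (C (algebraMap (WittVector p κ) (RR p S) a))) ∧
    (∀ i, s (rX p κ d S i) = hatXT p κ d S i) ∧
    ∀ r, s r - hatA p d S (C r) ∈ idT p d S := by
  have hc := isAdicComplete_idT p κ d S
  have hcp := isAdicComplete_natCast (A := PD p d S) p
  set I := idT p d S with hI
  set θ : RSq p κ d →+* PDhat p d S := sqLift p κ d
    (((hatA p d S).comp (C (R := RR p S))).comp (algebraMap (WittVector p κ) (RR p S)))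
    fun i => (isUnit_hatXT p κ d S i).unit with hθ
  have hQ := isAdicComplete_span_natCast_of_eq_zero (T := PDhat p d S ⧸ I) p (by
    rw [← map_natCast (Ideal.Quotient.mk I)]
    exact Ideal.Quotient.eq_zero_iff_mem.mpr (p_mem_idT p d S))
  have hθs : (Ideal.Quotient.mk I).comp θ =
      (((Ideal.Quotient.mk I).comp (hatA p d S)).comp (C (R := RR p S))).comp
        (algebraMap (RSq p κ d) (RR p S)) := by
    refine sq_hom_ext _ _ (fun a => ?_) fun i => ?_
    · simp only [RingHom.comp_apply, hθ, sqLift_C, algebraMap_RR]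
    · simp only [RingHom.comp_apply, hθ, sqLift_X, rX_val]
      refine Ideal.Quotient.eq.mpr ?_
      change hatXT p κ d S i - _ ∈ I
      rw [hatXT, map_sub, sub_right_comm]
      change hatA p d S _ - hatA p d S _ - _ ∈ I
      rw [sub_self, zero_sub]
      exact I.neg_mem (T_mem_idT p d S i)
  obtain ⟨F, hF1, hF2⟩ := exists_lift (P := RSq p κ d) (S := S) I θ
    ((((Ideal.Quotient.mk I).comp (hatA p d S)).comp (C (R := RR p S))).comp
      (algebraMap S (RR p S))) (fun a => congr($hθs.symm a))
  set s : RR p S →+* PDhat p d S := adicExtend (Ideal.span {(p : S)})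
    (Ideal.span {(p : PDhat p d S)}) F (map_span_natCast_le _ p) with hs
  have hs1 : ∀ a, s (algebraMap (RSq p κ d) (RR p S) a) = θ a := fun a => by
    change adicExtend _ _ F _ (AdicCompletion.of _ S (algebraMap (RSq p κ d) S a)) = _
    rw [adicExtend_of, hF1]
  refine ⟨s, fun a => ?_, fun i => ?_, fun r => ?_⟩
  · rw [← algebraMap_RR p κ d S, hs1, hθ, sqLift_C, algebraMap_RR]
    rfl
  · rw [← rX_val, hs1, hθ, sqLift_X]
    rfl
  · have key : (Ideal.Quotient.mk I).comp s =
        ((Ideal.Quotient.mk I).comp (hatA p d S)).comp (C (R := RR p S)) := by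
      refine padic_hom_ext _ _ fun a => ?_
      rw [RingHom.comp_apply, hs, adicExtend_of, hF2]
      rfl
    exact Ideal.Quotient.eq.mp congr($key r)

/-- The homomorphism `R → PDhat` with `Xᵢ ↦ Xᵢ - Tᵢ` which is the identity modulo
`(p, μ, T₁, …, T_d)`. -/
def hatR : RR p S →+* PDhat p d S := (exists_hatR p κ d S).choose

theorem hatR_W (a : WittVector p κ) : hatR p κ d S (algebraMap (WittVector p κ) (RR p S) a) =
    hatA p d S (C (algebraMap (WittVector p κ) (RR p S) a)) :=
  (exists_hatR p κ d S).choose_spec.1 a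

theorem hatR_rX (i : Fin d) : hatR p κ d S (rX p κ d S i) = hatXT p κ d S i :=
  (exists_hatR p κ d S).choose_spec.2.1 i

theorem hatR_sub_mem (r : RR p S) : hatR p κ d S r - hatA p d S (C r) ∈ idT p d S :=
  (exists_hatR p κ d S).choose_spec.2.2 r

/-- Uniqueness of homomorphisms `R → PDhat` with given values on the coordinates and modulo
`(p, μ, T₁, …, T_d)`. -/
theorem rr_hom_ext_idT (f g : RR p S →+* PDhat p d S)
    (hW : ∀ a, f (algebraMap (WittVector p κ) (RR p S) a) =
      g (algebraMap (WittVector p κ) (RR p S) a))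
    (hX : ∀ i, f (rX p κ d S i) = g (rX p κ d S i))
    (hI : ∀ x, f x - g x ∈ idT p d S) : f = g := by
  have hc := isAdicComplete_idT p κ d S
  have hcp := isAdicComplete_natCast (A := PD p d S) p
  refine rr_hom_ext p κ d S (idT p d S) f g (fun a => ?_) hI
  have : f.comp (algebraMap (RSq p κ d) (RR p S)) = g.comp (algebraMap (RSq p κ d) (RR p S)) := by
    refine sq_hom_ext _ _ (fun a => ?_) fun i => hX i
    rw [RingHom.comp_apply, RingHom.comp_apply, algebraMap_RR]
    exact hW a
  exact congr($this a)

/-- Uniqueness of étale lifts: modulo `p` both sides are the `p`-th power of `hatR r`, and on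
coordinates the claim is φ(Xᵢ − Tᵢ) = (Xᵢ − Tᵢ)^p. -/
theorem frobPDhat_hatR (r : RR p S) :
    frobPDhat p d S κ (hatR p κ d S r) = hatR p κ d S (frobR p κ d S r) := by
  have hW : ∀ a, frobR p κ d S (algebraMap (WittVector p κ) (RR p S) a) =
      algebraMap (WittVector p κ) (RR p S) (WittVector.frobenius a) := fun a => by
    have := frobA_algebraMap p κ d S a
    rw [algebraMap_AA, frobA_C, algebraMap_AA] at this
    exact C_injective this
  have : (frobPDhat p d S κ).comp (hatR p κ d S) =
      (hatR p κ d S).comp (frobR p κ d S) := by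
    refine rr_hom_ext_idT p κ d S _ _ (fun a => ?_) (fun i => ?_) fun x => ?_
    · rw [RingHom.comp_apply, RingHom.comp_apply, hW, hatR_W, hatR_W, frobPDhat_hatA, frobA_C, hW]
    · have h : frobR p κ d S (rX p κ d S i) = (rX p κ d S i : RR p S) ^ p := by
        have := frobA_rX p κ d S i
        rw [frobA_C, ← map_pow] at this
        exact C_injective this
      rw [RingHom.comp_apply, RingHom.comp_apply, h, map_pow, hatR_rX, hatXT, frobPDhat_ofPD,
        frobPD_sub, map_pow]
    · have hle : Ideal.span {(p : PDhat p d S)} ≤ idT p d S := by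
        rw [Ideal.span_le]; rintro _ rfl; exact p_mem_idT p d S
      have h1 := frobPDhat_sub_pow_mem p κ d S (hatR p κ d S x)
      have h2 := map_span_natCast_le (hatR p κ d S) p
        (Ideal.mem_map_of_mem _ (frobR_sub_pow_mem p κ d x))
      rw [map_sub, map_pow] at h2
      have := hle (Ideal.sub_mem _ h1 h2)
      rwa [sub_sub_sub_cancel_right] at this
  exact congr($this r)

/-- The formula for g(Tᵢ) is chosen so that Xᵢ − Tᵢ is invariant; as `g` moves A_R only by multiples
of μ, uniqueness of lifts modulo `idT` applies. This matches the trivial action of 1 × Γ_R on the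
first factor. -/
theorem gammaPDhat_hatR (g : GammaR p d) (r : RR p S) :
    gammaPDhat p d S κ g (hatR p κ d S r) = hatR p κ d S r := by
  have : (gammaPDhat p d S κ g).comp (hatR p κ d S) = hatR p κ d S := by
    refine rr_hom_ext_idT p κ d S _ _ (fun a => ?_) (fun i => ?_) fun x => ?_
    · rw [RingHom.comp_apply, hatR_W, gammaPDhat_hatA, ← algebraMap_AA, gammaA_algebraMap]
    · rw [RingHom.comp_apply, hatR_rX, hatXT, gammaPDhat_ofPD, map_sub, gammaPD_pdA, gammaPD_pdT]
      congr 1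
      rw [map_sub]
      ring
    · have h1 := gammaPDhat_idT p κ d S g _ (hatR_sub_mem p κ d S x)
      have h2 := hatA_gammaA_sub p κ d S g (C x)
      have h3 := hatR_sub_mem p κ d S x
      rw [map_sub, gammaPDhat_hatA] at h1
      rw [RingHom.comp_apply, show gammaPDhat p d S κ g (hatR p κ d S x) - hatR p κ d S x =
        (gammaPDhat p d S κ g (hatR p κ d S x) - hatA p d S (gammaA p κ d S g (C x))) +
        (hatA p d S (gammaA p κ d S g (C x)) - hatA p d S (C x)) -
        (hatR p κ d S x - hatA p d S (C x)) by ring]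
      exact Ideal.sub_mem _ (Ideal.add_mem _ h1 h2) h3
  exact congr($this r)

/-- The restriction of the comparison map to the first factor. -/
def hatL : AA p S →+* PDhat p d S := (hatR p κ d S).comp (constantCoeff (R := RR p S))

theorem hatL_C (r : RR p S) : hatL p κ d S (C r) = hatR p κ d S r := by
  rw [hatL, RingHom.comp_apply, constantCoeff_C]

theorem hatL_X : hatL p κ d S X = 0 := by
  rw [hatL, RingHom.comp_apply, constantCoeff_X, map_zero]

theorem frobPDhat_hatL (a : AA p S) :
    frobPDhat p d S κ (hatL p κ d S a) = hatL p κ d S (frobA p κ d S a) := by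
  rw [hatL, RingHom.comp_apply, frobPDhat_hatR, RingHom.comp_apply, constantCoeff_frobA]

theorem gammaPDhat_hatL (g : GammaR p d) (a : AA p S) :
    gammaPDhat p d S κ g (hatL p κ d S a) = hatL p κ d S a := by
  rw [hatL, RingHom.comp_apply, gammaPDhat_hatR]

theorem hatL_pQ : hatL p κ d S (pQ p S) = p := by
  obtain ⟨m, hm⟩ := exists_pQ_eq' p S
  rw [hm, map_add, map_mul, hatL_X, zero_mul, add_zero, map_natCast]

theorem hatL_W (a : WittVector p κ) : hatL p κ d S (algebraMap _ (AA p S) a) =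
    hatA p d S (algebraMap _ (AA p S) a) := by
  rw [algebraMap_AA, hatL_C, hatR_W]

end FirstFactor

/-! ### The comparison map on A_R(1) and its equivariance. -/

section Comparison

open PowerSeries

variable (p : ℕ) [hp : Fact p.Prime] (κ : Type u) [Field κ] [CharP κ p] [PerfectRing κ p] (d : ℕ)
  (S : Type v) [CommRing S] [Algebra (WittVector p κ) S]
  [Algebra (RSq p κ d) S] [Algebra.Etale (RSq p κ d) S]
  [IsScalarTower (WittVector p κ) (RSq p κ d) S]

/-- The comparison map on `A_R ⊗ A_R`. -/
def ttHat : TT p κ S →+* PDhat p d S :=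
  letI : Algebra (WittVector p κ) (PDhat p d S) :=
    ((hatA p d S).comp (algebraMap (WittVector p κ) (AA p S))).toAlgebra
  let f : AA p S →ₐ[WittVector p κ] PDhat p d S :=
    { hatL p κ d S with commutes' := hatL_W p κ d S }
  let g : AA p S →ₐ[WittVector p κ] PDhat p d S :=
    { hatA p d S with commutes' := fun _ => rfl }
  ((Algebra.TensorProduct.lift f g fun _ _ => Commute.all _ _ :
    AA p S ⊗[WittVector p κ] AA p S →ₐ[WittVector p κ] PDhat p d S) :
    AA p S ⊗[WittVector p κ] AA p S →+* PDhat p d S)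

theorem ttHat_inL (a : AA p S) : ttHat p κ d S (inL p κ S a) = hatL p κ d S a := by
  let _ : Algebra (WittVector p κ) (PDhat p d S) :=
    ((hatA p d S).comp (algebraMap (WittVector p κ) (AA p S))).toAlgebra
  refine (Algebra.TensorProduct.lift_tmul (R := WittVector p κ) (S := WittVector p κ) _ _
    (fun _ _ => Commute.all _ _) a
    (1 : AA p S)).trans ?_
  rw [map_one, mul_one]
  rfl

theorem ttHat_inR (a : AA p S) : ttHat p κ d S (inR p κ S a) = hatA p d S a := by
  let _ : Algebra (WittVector p κ) (PDhat p d S) :=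
    ((hatA p d S).comp (algebraMap (WittVector p κ) (AA p S))).toAlgebra
  refine (Algebra.TensorProduct.lift_tmul (R := WittVector p κ) (S := WittVector p κ) _ _
    (fun _ _ => Commute.all _ _) (1 : AA p S) a).trans ?_
  rw [map_one, one_mul]
  rfl

theorem ttHat_idTT : (idTT p κ S).map (ttHat p κ d S) ≤ Ideal.span {(p : PDhat p d S)} := by
  rw [Ideal.map_span, Ideal.span_le]
  rintro _ ⟨x, rfl | rfl, rfl⟩
  · rw [map_natCast]
    exact Ideal.mem_span_singleton_self _
  · rw [ttHat_inL, hatL_X]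
    exact Ideal.zero_mem _

/-- The comparison map on the completed tensor product. -/
def bbHat : BB p κ S →+* PDhat p d S :=
  adicExtend (idTT p κ S) (Ideal.span {(p : PDhat p d S)}) (ttHat p κ d S) (ttHat_idTT p κ d S)

theorem bbHat_ofTT (x : TT p κ S) : bbHat p κ d S (ofTT p κ S x) = ttHat p κ d S x :=
  adicExtend_of _ _ _ _ x

theorem bbHat_i1 (a : AA p S) : bbHat p κ d S (i1 p κ S a) = hatL p κ d S a :=
  (bbHat_ofTT p κ d S _).trans (ttHat_inL p κ d S a)

theorem bbHat_i2 (a : AA p S) : bbHat p κ d S (i2 p κ S a) = hatA p d S a :=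
  (bbHat_ofTT p κ d S _).trans (ttHat_inR p κ d S a)

theorem bb_hom_ext_hat (F G : BB p κ S →+* PDhat p d S) (hX : F (i1 p κ S X) = 0)
    (h1 : ∀ a, F (i1 p κ S a) = G (i1 p κ S a))
    (h2 : ∀ a, F (i2 p κ S a) = G (i2 p κ S a)) : F = G := by
  have := isHausdorff_natCast (PD p d S) p
  refine adic_hom_ext (idTT_fg p κ S) (Ideal.span {(p : PDhat p d S)}) F G ?_ ?_
  · have hle : (idTT p κ S).map (F.comp (ofTT p κ S)) ≤ Ideal.span {(p : PDhat p d S)} := by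
      rw [Ideal.map_span, Ideal.span_le]
      rintro _ ⟨x, rfl | rfl, rfl⟩
      · rw [map_natCast]
        exact Ideal.mem_span_singleton_self _
      · exact Set.mem_of_eq_of_mem hX (Ideal.zero_mem _)
    exact fun a ha => hle (Ideal.mem_map_of_mem (F.comp (ofTT p κ S)) ha)
  · intro x
    change F (ofTT p κ S x) = G (ofTT p κ S x)
    refine tt_induction p κ S (fun x => F (ofTT p κ S x) = G (ofTT p κ S x)) ?_ ?_ ?_ x
    · simp
    · intro x y hx hy
      simp only [map_add, hx, hy]
    · intro a b
      rw [map_mul, map_mul, map_mul]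
      exact congrArg₂ (· * ·) (h1 a) (h2 b)

theorem bbHat_frobBB (b : BB p κ S) :
    bbHat p κ d S (frobBB p κ d S b) = frobPDhat p d S κ (bbHat p κ d S b) := by
  have : (bbHat p κ d S).comp (frobBB p κ d S) = (frobPDhat p d S κ).comp (bbHat p κ d S) := by
    refine bb_hom_ext_hat p κ d S _ _ ?_ (fun a => ?_) fun a => ?_
    · rw [RingHom.comp_apply, frobBB_i1, bbHat_i1, ← frobPDhat_hatL, hatL_X, map_zero]
    · rw [RingHom.comp_apply, RingHom.comp_apply, frobBB_i1, bbHat_i1, bbHat_i1, frobPDhat_hatL]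
    · rw [RingHom.comp_apply, RingHom.comp_apply, frobBB_i2, bbHat_i2, bbHat_i2, frobPDhat_hatA]
  exact congr($this b)

theorem bbHat_gammaBB (g : GammaR p d) (b : BB p κ S) :
    bbHat p κ d S (gammaBB p κ d S g b) = gammaPDhat p d S κ g (bbHat p κ d S b) := by
  have : (bbHat p κ d S).comp (gammaBB p κ d S g) =
      (gammaPDhat p d S κ g).comp (bbHat p κ d S) := by
    refine bb_hom_ext_hat p κ d S _ _ ?_ (fun a => ?_) fun a => ?_
    · rw [RingHom.comp_apply, gammaBB_i1, bbHat_i1, hatL_X]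
    · rw [RingHom.comp_apply, RingHom.comp_apply, gammaBB_i1, bbHat_i1, gammaPDhat_hatL]
    · rw [RingHom.comp_apply, RingHom.comp_apply, gammaBB_i2, bbHat_i2, bbHat_i2, gammaPDhat_hatA]
  exact congr($this b)

/-- The generators go to `p`, to [p]_q, which is a multiple of `p` by `pdA_pQ`, and to the Frobenius
of `hatR r` minus `r`, a multiple of `p` by `frobPDhat_mem`. -/
theorem bbHat_idJ (j : BB p κ S) (hj : j ∈ idJ p κ d S) :
    ∃ z, bbHat p κ d S j = p * z := by
  have hle : idJ p κ d S ≤ (Ideal.span {(p : PDhat p d S)}).comap (bbHat p κ d S) := by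
    rw [idJ, Ideal.span_le]
    rintro _ ((rfl | rfl) | ⟨r, rfl⟩)
    · change bbHat p κ d S _ ∈ Ideal.span _
      rw [bbHat_i1, hatL_pQ]
      exact Ideal.mem_span_singleton_self _
    · change bbHat p κ d S _ ∈ Ideal.span _
      obtain ⟨y, hy⟩ := pdA_pQ p κ d S
      rw [bbHat_i2, hatA, RingHom.comp_apply, hy, map_mul, map_natCast]
      exact Ideal.mul_mem_right _ _ (Ideal.mem_span_singleton_self _)
    · change bbHat p κ d S _ ∈ Ideal.span _
      rw [map_sub, bbHat_i1, bbHat_i2, ← frobPDhat_hatL, ← frobPDhat_hatA, ← map_sub, hatL_C]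
      exact frobPDhat_mem p κ d S _ (hatR_sub_mem p κ d S r)
  exact Ideal.mem_span_singleton.mp (hle hj)

/-- The multiplicative set inverted in the localization containing `E`. -/
abbrev mE : Submonoid (BB p κ S) := envM p (frobBB p κ d S) (i1 p κ S (pQ p S))

/-- The localization containing `E`. -/
abbrev LE : Type _ := EnvL p (frobBB p κ d S) (i1 p κ S (pQ p S))

/-- [p]_q ⊗ 1 goes to `p` because μ ⊗ 1 goes to 0, and Frobenius fixes `p`. Hence inverting `p` in
the target already inverts everything needed. -/
theorem bbHat_mE (m : BB p κ S) (hm : m ∈ mE p κ d S) : ∃ k, bbHat p κ d S m = p ^ k := by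
  induction hm using Submonoid.closure_induction with
  | mem x hx =>
    rcases hx with rfl | ⟨n, rfl⟩
    · exact ⟨1, by rw [map_natCast, pow_one]⟩
    · refine ⟨1, ?_⟩
      simp only
      rw [pow_one]
      induction n with
      | zero => exact (bbHat_i1 p κ d S _).trans (hatL_pQ p κ d S)
      | succ n ih => rw [Function.iterate_succ_apply', bbHat_frobBB, ih, map_natCast]
  | one => exact ⟨0, by rw [map_one, pow_zero]⟩
  | mul x y _ _ h1 h2 =>
    obtain ⟨k, hk⟩ := h1
    obtain ⟨l, hl⟩ := h2
    exact ⟨k + l, by rw [map_mul, hk, hl, pow_add]⟩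

theorem pdhat_torsionFree_pow (k : ℕ) (y : PDhat p d S) (hy : (p : PDhat p d S) ^ k * y = 0) :
    y = 0 := by
  induction k with
  | zero => simpa using hy
  | succ k ih => exact ih (pdhat_torsionFree p d S _ (by rwa [pow_succ', mul_assoc] at hy))

/-- The ring `PDhat[1/p]`. -/
abbrev HL : Type _ := Localization.Away (p : PDhat p d S)

theorem isUnit_p_HL : IsUnit (p : HL p d S) := by
  have := IsLocalization.Away.algebraMap_isUnit (S := HL p d S) (p : PDhat p d S)
  rwa [map_natCast] at this

theorem algebraMap_HL_injective : Function.Injective (algebraMap (PDhat p d S) (HL p d S)) := by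
  rw [injective_iff_map_eq_zero]
  intro a ha
  obtain ⟨⟨_, n, rfl⟩, hm⟩ := (IsLocalization.map_eq_zero_iff
    (Submonoid.powers (p : PDhat p d S)) (HL p d S) a).mp ha
  exact pdhat_torsionFree_pow p d S n a hm

/-- The comparison map on the localization. -/
def leHat : LE p κ d S →+* HL p d S :=
  IsLocalization.lift (M := mE p κ d S) (S := LE p κ d S)
    (g := (algebraMap (PDhat p d S) (HL p d S)).comp (bbHat p κ d S)) fun m => by
      obtain ⟨k, hk⟩ := bbHat_mE p κ d S m.1 m.2
      rw [RingHom.comp_apply, hk, map_pow, map_natCast]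
      exact (isUnit_p_HL p d S).pow k

theorem leHat_algebraMap (b : BB p κ S) : leHat p κ d S (algebraMap _ (LE p κ d S) b) =
    algebraMap (PDhat p d S) (HL p d S) (bbHat p κ d S b) :=
  IsLocalization.lift_eq _ b

/-- The Frobenius of `PDhat[1/p]`. -/
def frobHL : HL p d S →+* HL p d S :=
  IsLocalization.map (HL p d S) (frobPDhat p d S κ) (M := Submonoid.powers (p : PDhat p d S))
    (T := Submonoid.powers (p : PDhat p d S)) (by
      rw [Submonoid.powers_le]
      exact ⟨1, by simp⟩)

theorem frobHL_algebraMap (y : PDhat p d S) : frobHL p κ d S (algebraMap _ (HL p d S) y) =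
    algebraMap (PDhat p d S) (HL p d S) (frobPDhat p d S κ y) :=
  IsLocalization.map_eq _ y

theorem leHat_frob (x : LE p κ d S) :
    leHat p κ d S (envLFrob p (frobBB p κ d S) (i1 p κ S (pQ p S)) x) =
      frobHL p κ d S (leHat p κ d S x) := by
  have : (leHat p κ d S).comp (envLFrob p (frobBB p κ d S) (i1 p κ S (pQ p S))) =
      (frobHL p κ d S).comp (leHat p κ d S) := by
    refine IsLocalization.ringHom_ext (mE p κ d S) (RingHom.ext fun b => ?_)
    simp only [RingHom.comp_apply]
    rw [envLFrob, IsLocalization.map_eq, leHat_algebraMap, leHat_algebraMap, frobHL_algebraMap,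
      bbHat_frobBB]
  exact congr($this x)

/-- The elements with image in `PDhat` form a subalgebra that contains the quotients j/([p]_q ⊗ 1),
by `bbHat_idJ`, and is stable under δ, because `frobPDhat` lifts the Frobenius modulo `p`.
Minimality of `env` concludes. -/
theorem leHat_mem (x : LE p κ d S)
    (hx : x ∈ env p (frobBB p κ d S) (i1 p κ S (pQ p S)) (idJ p κ d S)) :
    leHat p κ d S x ∈ (algebraMap (PDhat p d S) (HL p d S)).range := by
  let T : Subalgebra (BB p κ S) (LE p κ d S) :=
    { (algebraMap (PDhat p d S) (HL p d S)).range.comap (leHat p κ d S) with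
      algebraMap_mem' := fun b => ⟨bbHat p κ d S b, (leHat_algebraMap p κ d S b).symm⟩ }
  have hT : IsEnv p (frobBB p κ d S) (i1 p κ S (pQ p S)) (idJ p κ d S) T := by
    constructor
    · intro j hj y hy
      obtain ⟨z, hz⟩ := bbHat_idJ p κ d S j hj
      have h1 := congrArg (leHat p κ d S) hy
      rw [map_mul, leHat_algebraMap, leHat_algebraMap, bbHat_i1, hatL_pQ, hz, map_mul,
        map_natCast] at h1
      exact ⟨z, ((isUnit_p_HL p d S).mul_left_cancel h1).symm⟩
    · intro x hx y hy
      obtain ⟨z, hz⟩ := hx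
      have h1 := congrArg (leHat p κ d S) hy
      obtain ⟨w, hw⟩ := Ideal.mem_span_singleton.mp (frobPDhat_sub_pow_mem p κ d S z)
      change _ = leHat p κ d S x at hz
      rw [map_mul, map_natCast, map_sub, map_pow, leHat_frob, ← hz, frobHL_algebraMap, ← map_pow,
        ← map_sub, hw, map_mul, map_natCast] at h1
      exact ⟨w, ((isUnit_p_HL p d S).mul_left_cancel h1).symm⟩
  have hle : env p (frobBB p κ d S) (i1 p κ S (pQ p S)) (idJ p κ d S) ≤ T := sInf_le hT
  exact hle hx

/-- The inclusion of `E` into the localization. -/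
def eeVal : EE p κ d S →+* LE p κ d S :=
  algebraMap (env p (frobBB p κ d S) (i1 p κ S (pQ p S)) (idJ p κ d S)) (LE p κ d S)

theorem eeVal_injective : Function.Injective (eeVal p κ d S) := Subtype.val_injective

theorem eeVal_ofBB (b : BB p κ S) :
    eeVal p κ d S (ofBB p κ d S b) = algebraMap (BB p κ S) (LE p κ d S) b := rfl

/-- The comparison map on `E`. -/
def eeHat : EE p κ d S →+* PDhat p d S :=
  ((RingEquiv.ofBijective (algebraMap (PDhat p d S) (HL p d S)).rangeRestrict
    ⟨fun _ _ h => algebraMap_HL_injective p d S congr(Subtype.val $h),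
      RingHom.rangeRestrict_surjective _⟩).symm :
    (algebraMap (PDhat p d S) (HL p d S)).range →+* PDhat p d S).comp
  (((leHat p κ d S).comp (eeVal p κ d S)).codRestrict
    (algebraMap (PDhat p d S) (HL p d S)).range fun x => leHat_mem p κ d S _ x.2)

theorem algebraMap_eeHat (x : EE p κ d S) :
    algebraMap (PDhat p d S) (HL p d S) (eeHat p κ d S x) = leHat p κ d S (eeVal p κ d S x) := by
  have := (RingEquiv.ofBijective (algebraMap (PDhat p d S) (HL p d S)).rangeRestrict
    ⟨fun _ _ h => algebraMap_HL_injective p d S congr(Subtype.val $h),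
      RingHom.rangeRestrict_surjective _⟩).apply_symm_apply
    (((leHat p κ d S).comp (eeVal p κ d S)).codRestrict
    (algebraMap (PDhat p d S) (HL p d S)).range (fun x => leHat_mem p κ d S _ x.2) x)
  exact congr(Subtype.val $this)

theorem eeHat_ofBB (b : BB p κ S) : eeHat p κ d S (ofBB p κ d S b) = bbHat p κ d S b := by
  refine algebraMap_HL_injective p d S ?_
  rw [algebraMap_eeHat, eeVal_ofBB, leHat_algebraMap]

/-- Homomorphisms from `E` to `PDhat` sending the inverted elements to powers of `p` are
determined on the completed tensor product. -/
theorem ee_hom_ext (F G : EE p κ d S →+* PDhat p d S)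
    (hm : ∀ m ∈ mE p κ d S, ∃ k, F (ofBB p κ d S m) = p ^ k)
    (h : ∀ b, F (ofBB p κ d S b) = G (ofBB p κ d S b)) : F = G := by
  refine RingHom.ext fun x => ?_
  -- Clear the denominator of `x`: both maps send it to the same power of `p`, a nonzerodivisor of
  -- `PDhat`.
  obtain ⟨⟨b, m⟩, hbm⟩ := IsLocalization.surj (mE p κ d S) (eeVal p κ d S x)
  have h1 : x * ofBB p κ d S m = ofBB p κ d S b := by
    refine eeVal_injective p κ d S ?_
    rw [map_mul, eeVal_ofBB, eeVal_ofBB]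
    exact hbm
  obtain ⟨k, hk⟩ := hm m.1 m.2
  have h2 := congrArg F h1
  have h3 := congrArg G h1
  rw [map_mul, hk] at h2
  rw [map_mul, ← h m, hk, ← h b] at h3
  refine sub_eq_zero.mp (pdhat_torsionFree_pow p d S k _ ?_)
  linear_combination h2 - h3

theorem eeHat_frobEE (x : EE p κ d S) :
    eeHat p κ d S (frobEE p κ d S x) = frobPDhat p d S κ (eeHat p κ d S x) := by
  have : (frobPDhat p d S κ).comp (eeHat p κ d S) = (eeHat p κ d S).comp (frobEE p κ d S) := by
    refine ee_hom_ext p κ d S _ _ (fun m hm => ?_) fun b => ?_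
    · obtain ⟨k, hk⟩ := bbHat_mE p κ d S m hm
      exact ⟨k, by rw [RingHom.comp_apply, eeHat_ofBB, hk, map_pow, map_natCast]⟩
    · rw [RingHom.comp_apply, RingHom.comp_apply, frobEE_ofBB, eeHat_ofBB, eeHat_ofBB,
        bbHat_frobBB]
  exact congr($this.symm x)

theorem eeHat_gammaEE (g : GammaR p d) (x : EE p κ d S) :
    eeHat p κ d S (gammaEE p κ d S g x) = gammaPDhat p d S κ g (eeHat p κ d S x) := by
  have : (gammaPDhat p d S κ g).comp (eeHat p κ d S) =
      (eeHat p κ d S).comp (gammaEE p κ d S g) := by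
    refine ee_hom_ext p κ d S _ _ (fun m hm => ?_) fun b => ?_
    · obtain ⟨k, hk⟩ := bbHat_mE p κ d S m hm
      exact ⟨k, by rw [RingHom.comp_apply, eeHat_ofBB, hk, map_pow, map_natCast]⟩
    · rw [RingHom.comp_apply, RingHom.comp_apply, gammaEE_ofBB, eeHat_ofBB, eeHat_ofBB,
        bbHat_gammaBB]
  exact congr($this.symm x)

theorem idEE_fg : (idEE p κ d S).FG := Submodule.fg_span (Set.toFinite _)

theorem eeHat_idEE : (idEE p κ d S).map (eeHat p κ d S) ≤ Ideal.span {(p : PDhat p d S)} := by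
  rw [idEE, Ideal.map_span, Ideal.span_le]
  rintro _ ⟨x, rfl | rfl, rfl⟩
  · rw [map_natCast]
    exact Ideal.mem_span_singleton_self _
  · rw [eeHat_ofBB, bbHat_i1, hatL_X]
    exact Ideal.zero_mem _

/-- The comparison map on `A_R(1)`. -/
def a1Hat : A1 p κ d S →+* PDhat p d S :=
  adicExtend (idEE p κ d S) (Ideal.span {(p : PDhat p d S)}) (eeHat p κ d S) (eeHat_idEE p κ d S)

theorem a1Hat_ofEE (x : EE p κ d S) : a1Hat p κ d S (ofEE p κ d S x) = eeHat p κ d S x :=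
  adicExtend_of _ _ _ _ x

theorem a1Hat_p1 (a : AA p S) : a1Hat p κ d S (p1 p κ d S a) = hatL p κ d S a := by
  rw [p1, RingHom.comp_apply, a1Hat_ofEE, RingHom.comp_apply, eeHat_ofBB, bbHat_i1]

theorem a1Hat_p2 (a : AA p S) : a1Hat p κ d S (p2 p κ d S a) = hatA p d S a := by
  rw [p2, RingHom.comp_apply, a1Hat_ofEE, RingHom.comp_apply, eeHat_ofBB, bbHat_i2]

theorem a1_hom_ext (F G : A1 p κ d S →+* PDhat p d S)
    (hF : ∀ x ∈ idEE p κ d S, F (ofEE p κ d S x) ∈ Ideal.span {(p : PDhat p d S)})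
    (h : ∀ x, F (ofEE p κ d S x) = G (ofEE p κ d S x)) : F = G :=
  have := isHausdorff_natCast (PD p d S) p
  adic_hom_ext (idEE_fg p κ d S) (Ideal.span {(p : PDhat p d S)}) F G hF h

theorem eeHat_mem (x : EE p κ d S) (hx : x ∈ idEE p κ d S) :
    eeHat p κ d S x ∈ Ideal.span {(p : PDhat p d S)} :=
  eeHat_idEE p κ d S (Ideal.mem_map_of_mem _ hx)

theorem a1Hat_frobA1 (x : A1 p κ d S) :
    a1Hat p κ d S (frobA1 p κ d S x) = frobPDhat p d S κ (a1Hat p κ d S x) := by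
  have : (a1Hat p κ d S).comp (frobA1 p κ d S) =
      (frobPDhat p d S κ).comp (a1Hat p κ d S) := by
    refine a1_hom_ext p κ d S _ _ (fun x hx => ?_) fun x => ?_
    · rw [RingHom.comp_apply, frobA1_ofEE, a1Hat_ofEE]
      exact eeHat_mem p κ d S _ (frobEE_idEE p κ d S (Ideal.mem_map_of_mem _ hx))
    · rw [RingHom.comp_apply, RingHom.comp_apply, frobA1_ofEE, a1Hat_ofEE, a1Hat_ofEE,
        eeHat_frobEE]
  exact congr($this x)

theorem a1Hat_gammaA1 (g : GammaR p d) (x : A1 p κ d S) :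
    a1Hat p κ d S (gammaA1 p κ d S g x) = gammaPDhat p d S κ g (a1Hat p κ d S x) := by
  have : (a1Hat p κ d S).comp (gammaA1 p κ d S g) =
      (gammaPDhat p d S κ g).comp (a1Hat p κ d S) := by
    refine a1_hom_ext p κ d S _ _ (fun x hx => ?_) fun x => ?_
    · rw [RingHom.comp_apply, gammaA1_ofEE, a1Hat_ofEE]
      exact eeHat_mem p κ d S _ (gammaEE_idEE p κ d S g (Ideal.mem_map_of_mem _ hx))
    · rw [RingHom.comp_apply, RingHom.comp_apply, gammaA1_ofEE, a1Hat_ofEE, a1Hat_ofEE,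
        eeHat_gammaEE]
  exact congr($this x)

end Comparison

/-! ### The δ-ring E/(μ ⊗ 1) and its generators. -/

section Source

open PowerSeries

variable (p : ℕ) [hp : Fact p.Prime] (κ : Type u) [Field κ] [CharP κ p] [PerfectRing κ p] (d : ℕ)
  (S : Type v) [CommRing S] [Algebra (WittVector p κ) S]
  [Algebra (RSq p κ d) S] [Algebra.Etale (RSq p κ d) S]
  [IsScalarTower (WittVector p κ) (RSq p κ d) S]

theorem eeVal_frobEE (x : EE p κ d S) : eeVal p κ d S (frobEE p κ d S x) =
    envLFrob p (frobBB p κ d S) (i1 p κ S (pQ p S)) (eeVal p κ d S x) := rfl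

theorem isUnit_p_LE : IsUnit (p : LE p κ d S) := isUnit_natCast_envL p _ _

theorem isUnit_D_LE : IsUnit (algebraMap (BB p κ S) (LE p κ d S) (i1 p κ S (pQ p S))) :=
  IsLocalization.map_units (LE p κ d S)
    (⟨i1 p κ S (pQ p S), Submonoid.subset_closure (Or.inr ⟨0, rfl⟩)⟩ : mE p κ d S)

theorem ee_torsionFree (x : EE p κ d S) (hx : (p : EE p κ d S) * x = 0) : x = 0 := by
  refine eeVal_injective p κ d S ((isUnit_p_LE p κ d S).mul_left_cancel ?_)
  rw [← map_natCast (eeVal p κ d S), ← map_mul, hx, map_zero, mul_zero]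

theorem exists_eeDelta (x : EE p κ d S) :
    ∃ y, frobEE p κ d S x = x ^ p + (p : EE p κ d S) * y := by
  obtain ⟨u, hu⟩ := isUnit_p_LE p κ d S
  have h := (isEnv_env p (frobBB p κ d S) (i1 p κ S (pQ p S)) (idJ p κ d S)).2
    (eeVal p κ d S x) x.2 (u⁻¹ * (eeVal p κ d S (frobEE p κ d S x) - eeVal p κ d S x ^ p))
    (by rw [← hu, Units.mul_inv_cancel_left]; rfl)
  let y : EE p κ d S := (⟨_, h⟩ : env p (frobBB p κ d S) (i1 p κ S (pQ p S)) (idJ p κ d S))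
  refine ⟨y, eeVal_injective p κ d S ?_⟩
  have hy : eeVal p κ d S y =
      u⁻¹ * (eeVal p κ d S (frobEE p κ d S x) - eeVal p κ d S x ^ p) := rfl
  rw [map_add, map_mul, map_natCast, map_pow, hy, ← hu, Units.mul_inv_cancel_left]
  ring

/-- The `δ`-structure of `E`. -/
def eeDelta : DeltaStruct p (EE p κ d S) :=
  DeltaStruct.ofLift (ee_torsionFree p κ d S) (frobEE p κ d S)
    (fun x => (exists_eeDelta p κ d S x).choose) fun x => (exists_eeDelta p κ d S x).choose_spec

theorem eeDelta_φ (x : EE p κ d S) : (eeDelta p κ d S).φ x = frobEE p κ d S x := rfl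

theorem eeDelta_ofBB {b c : BB p κ S} (h : frobBB p κ d S b = b ^ p + (p : BB p κ S) * c) :
    (eeDelta p κ d S).δ (ofBB p κ d S b) = ofBB p κ d S c := by
  have h1 := (eeDelta p κ d S).φ_eq (ofBB p κ d S b)
  rw [eeDelta_φ, frobEE_ofBB, h, map_add, map_pow, map_mul, map_natCast] at h1
  refine sub_eq_zero.mp (ee_torsionFree p κ d S _ ?_)
  linear_combination -h1

theorem exists_frobA_eq (a : AA p S) :
    ∃ c, frobA p κ d S a = a ^ p + (p : AA p S) * c := by
  obtain ⟨c, hc⟩ := Ideal.mem_span_singleton.mp (frobA_sub_pow_mem p κ d S a)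
  exact ⟨c, sub_eq_iff_eq_add'.mp hc⟩

theorem eeDelta_i1 {a c : AA p S} (h : frobA p κ d S a = a ^ p + (p : AA p S) * c) :
    (eeDelta p κ d S).δ (ofBB p κ d S (i1 p κ S a)) = ofBB p κ d S (i1 p κ S c) := by
  refine eeDelta_ofBB p κ d S ?_
  rw [frobBB_i1, h, map_add, map_mul, map_natCast, map_pow]

theorem eeDelta_i2 {a c : AA p S} (h : frobA p κ d S a = a ^ p + (p : AA p S) * c) :
    (eeDelta p κ d S).δ (ofBB p κ d S (i2 p κ S a)) = ofBB p κ d S (i2 p κ S c) := by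
  refine eeDelta_ofBB p κ d S ?_
  rw [frobBB_i2, h, map_add, map_mul, map_natCast, map_pow]

/-- The element `μ ⊗ 1` of `E`. -/
abbrev mu1 : EE p κ d S := ofBB p κ d S (i1 p κ S X)

/-- φ(μ) = μ [p]_q = μ^p + p μ u, so δ(μ) = μ u. This is the condition for δ to descend modulo μ ⊗
1. -/
theorem eeDelta_mu1 : (eeDelta p κ d S).δ (mu1 p κ d S) ∈ Ideal.span {mu1 p κ d S} := by
  obtain ⟨u, hu⟩ := exists_pQ_eq p S
  have h : frobA p κ d S X = X ^ p + (p : AA p S) * (X * u) := by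
    have h3 : (X : AA p S) ^ p = X * X ^ (p - 1) := by
      rw [← pow_succ', Nat.sub_add_cancel hp.out.one_lt.le]
    rw [← X_mul_pQ, hu, h3]
    ring
  rw [mu1, eeDelta_i1 p κ d S h, map_mul, map_mul]
  exact Ideal.mul_mem_right _ _ (Ideal.mem_span_singleton_self _)

/-- The ring `E / (μ ⊗ 1)`. -/
abbrev EM : Type _ := EE p κ d S ⧸ Ideal.span {mu1 p κ d S}

/-- The projection `E → E / (μ ⊗ 1)`. -/
def mkE : EE p κ d S →+* EM p κ d S := Ideal.Quotient.mk _

theorem mkE_surjective : Function.Surjective (mkE p κ d S) := Ideal.Quotient.mk_surjective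

/-- The `δ`-structure of `E / (μ ⊗ 1)`. -/
def emDelta : DeltaStruct p (EM p κ d S) := (eeDelta p κ d S).quot (eeDelta_mu1 p κ d S)

theorem emDelta_φ (x : EE p κ d S) :
    (emDelta p κ d S).φ (mkE p κ d S x) = mkE p κ d S (frobEE p κ d S x) := rfl

theorem emDelta_δ (x : EE p κ d S) :
    (emDelta p κ d S).δ (mkE p κ d S x) = mkE p κ d S ((eeDelta p κ d S).δ x) :=
  DeltaStruct.quot_δ_mk _ _ _

/-- The map from the completed tensor product to `E / (μ ⊗ 1)`. -/
def eB : BB p κ S →+* EM p κ d S := (mkE p κ d S).comp (ofBB p κ d S)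

/-- The map from the first factor to `E / (μ ⊗ 1)`. -/
def e1 : AA p S →+* EM p κ d S := (eB p κ d S).comp (i1 p κ S)

/-- The map from the second factor to `E / (μ ⊗ 1)`. -/
def e2 : AA p S →+* EM p κ d S := (eB p κ d S).comp (i2 p κ S)

theorem e1_X : e1 p κ d S X = 0 :=
  Ideal.Quotient.eq_zero_iff_mem.mpr (Ideal.mem_span_singleton_self _)

theorem e1_eq (a : AA p S) : e1 p κ d S a = e1 p κ d S (C (constantCoeff a)) := by
  have h : (X : AA p S) ∣ a - C (constantCoeff a) := by
    rw [X_dvd_iff]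
    simp
  obtain ⟨m, hm⟩ := h
  rw [sub_eq_iff_eq_add'.mp hm, map_add, map_mul, e1_X, zero_mul, add_zero]
  simp

theorem e1_pQ : e1 p κ d S (pQ p S) = p := by
  obtain ⟨m, hm⟩ := exists_pQ_eq' p S
  rw [hm, map_add, map_mul, e1_X, zero_mul, add_zero, map_natCast]

theorem e1_W (a : WittVector p κ) :
    i1 p κ S (algebraMap _ (AA p S) a) = i2 p κ S (algebraMap _ (AA p S) a) := by
  have : inL p κ S (algebraMap _ (AA p S) a) = inR p κ S (algebraMap _ (AA p S) a) :=
    Algebra.TensorProduct.tmul_one_eq_one_tmul a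
  rw [i1, i2, RingHom.comp_apply, RingHom.comp_apply, this]

theorem emφ_eB (b : BB p κ S) :
    (emDelta p κ d S).φ (eB p κ d S b) = eB p κ d S (frobBB p κ d S b) := by
  rw [eB, RingHom.comp_apply, emDelta_φ, frobEE_ofBB, RingHom.comp_apply]

theorem emφ_e1 (a : AA p S) :
    (emDelta p κ d S).φ (e1 p κ d S a) = e1 p κ d S (frobA p κ d S a) := by
  rw [e1, RingHom.comp_apply, emφ_eB, frobBB_i1, RingHom.comp_apply]

theorem emφ_e2 (a : AA p S) :
    (emDelta p κ d S).φ (e2 p κ d S a) = e2 p κ d S (frobA p κ d S a) := by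
  rw [e2, RingHom.comp_apply, emφ_eB, frobBB_i2, RingHom.comp_apply]

theorem emδ_e1 {a c : AA p S} (h : frobA p κ d S a = a ^ p + (p : AA p S) * c) :
    (emDelta p κ d S).δ (e1 p κ d S a) = e1 p κ d S c := by
  rw [e1, RingHom.comp_apply, eB, RingHom.comp_apply, emDelta_δ, eeDelta_i1 p κ d S h]
  rfl

theorem emδ_e2 {a c : AA p S} (h : frobA p κ d S a = a ^ p + (p : AA p S) * c) :
    (emDelta p κ d S).δ (e2 p κ d S a) = e2 p κ d S c := by
  rw [e2, RingHom.comp_apply, eB, RingHom.comp_apply, emDelta_δ, eeDelta_i2 p κ d S h]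
  rfl

/-- Every element of the completed tensor product is, in `E / (μ ⊗ 1)`, an element of
`A_R ⊗ A_R` modulo `p`. -/
theorem exists_eB_eq (b : BB p κ S) : ∃ (t : TT p κ S) (c : BB p κ S),
    eB p κ d S b = eB p κ d S (ofTT p κ S t) + (p : EM p κ d S) * eB p κ d S c := by
  obtain ⟨t, ht⟩ := exists_of_sub_mem (idTT_fg p κ S) 1 b
  have ht' : b - ofTT p κ S t ∈ (idTT p κ S).map (ofTT p κ S) := by
    rw [pow_one] at ht
    exact ht
  rw [idTT, Ideal.map_span, Set.image_pair, map_natCast, Ideal.mem_span_pair] at ht'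
  obtain ⟨c, c', hc⟩ := ht'
  refine ⟨t, c, ?_⟩
  have h1 : b = ofTT p κ S t + (p : BB p κ S) * c + i1 p κ S X * c' := by
    have : i1 p κ S X = ofTT p κ S (inL p κ S X) := rfl
    rw [this]
    linear_combination -hc
  have h2 : eB p κ d S (i1 p κ S X) = 0 := e1_X p κ d S
  rw [h1, map_add, map_add, map_mul, map_mul, h2, zero_mul, add_zero, map_natCast]

/-- The elements of `A_R ⊗ A_R` lie in any subring containing the two factors. -/
theorem eB_ofTT_mem (V : Subring (EM p κ d S)) (h1 : ∀ a, e1 p κ d S a ∈ V)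
    (h2 : ∀ a, e2 p κ d S a ∈ V) (t : TT p κ S) : eB p κ d S (ofTT p κ S t) ∈ V := by
  refine tt_induction p κ S (fun t => eB p κ d S (ofTT p κ S t) ∈ V) ?_ ?_ ?_ t
  · rw [map_zero, map_zero]
    exact V.zero_mem
  · intro x y hx hy
    rw [map_add, map_add]
    exact V.add_mem hx hy
  · intro a b
    rw [map_mul, map_mul]
    exact V.mul_mem (h1 a) (h2 b)

/-- δ preserves both factors, hence sends the ring they generate into the image. A general element
of the image differs from that ring by some `p c`, and `δ (p c) = φ c - p ^ (p - 1) * c ^ p` stays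
in the image. -/
theorem eB_range_δ (x : EM p κ d S) (hx : x ∈ (eB p κ d S).range) :
    (emDelta p κ d S).δ x ∈ (eB p κ d S).range := by
  set B := (eB p κ d S).range with hB
  set D := emDelta p κ d S with hD
  have h1 : ∀ a, e1 p κ d S a ∈ D.subring B B le_rfl := fun a => by
    obtain ⟨c, hc⟩ := exists_frobA_eq p κ d S a
    exact ⟨⟨i1 p κ S a, rfl⟩, by rw [hD, emδ_e1 p κ d S hc]; exact ⟨i1 p κ S c, rfl⟩⟩
  have h2 : ∀ a, e2 p κ d S a ∈ D.subring B B le_rfl := fun a => by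
    obtain ⟨c, hc⟩ := exists_frobA_eq p κ d S a
    exact ⟨⟨i2 p κ S a, rfl⟩, by rw [hD, emδ_e2 p κ d S hc]; exact ⟨i2 p κ S c, rfl⟩⟩
  obtain ⟨b, rfl⟩ := hx
  obtain ⟨t, c, h⟩ := exists_eB_eq p κ d S b
  have ht := eB_ofTT_mem p κ d S _ h1 h2 t
  have hc : eB p κ d S c ∈ B := ⟨c, rfl⟩
  rw [h, D.δ_add, D.δ_p_mul, emφ_eB]
  exact B.sub_mem (B.add_mem ht.2 (B.sub_mem ⟨_, rfl⟩ (B.mul_mem (B.pow_mem (natCast_mem B p) _)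
    (B.pow_mem hc _)))) (crossTerm_mem p B ht.1 (B.mul_mem (natCast_mem B p) hc))

/-- The generators of the ideal `J`. -/
def genJ : Set (BB p κ S) :=
  {i1 p κ S (pQ p S), i2 p κ S (pQ p S)} ∪ Set.range fun r : RR p S =>
    i1 p κ S (frobA p κ d S (C r)) - i2 p κ S (frobA p κ d S (C r))

theorem exists_div (j : BB p κ S) (hj : j ∈ idJ p κ d S) :
    ∃ y, ofBB p κ d S (i1 p κ S (pQ p S)) * y = ofBB p κ d S j := by
  obtain ⟨u, hu⟩ := isUnit_D_LE p κ d S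
  have h := (isEnv_env p (frobBB p κ d S) (i1 p κ S (pQ p S)) (idJ p κ d S)).1 j hj
    (u⁻¹ * algebraMap (BB p κ S) (LE p κ d S) j) (by rw [← hu, Units.mul_inv_cancel_left])
  let y : EE p κ d S := (⟨_, h⟩ : env p (frobBB p κ d S) (i1 p κ S (pQ p S)) (idJ p κ d S))
  refine ⟨y, eeVal_injective p κ d S ?_⟩
  have hy : eeVal p κ d S y = u⁻¹ * algebraMap (BB p κ S) (LE p κ d S) j := rfl
  rw [map_mul, eeVal_ofBB, hy, ← hu, Units.mul_inv_cancel_left, eeVal_ofBB]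

/-- Quotients by [p]_q ⊗ 1 are unique in E, inside the localization. Identities between them must be
proved here, since modulo μ ⊗ 1 the divisor becomes `p`, which is not known to be regular. -/
theorem div_unique {x y : EE p κ d S} (h : ofBB p κ d S (i1 p κ S (pQ p S)) * x =
    ofBB p κ d S (i1 p κ S (pQ p S)) * y) : x = y := by
  refine eeVal_injective p κ d S ((isUnit_D_LE p κ d S).mul_left_cancel ?_)
  have := congrArg (eeVal p κ d S) h
  rwa [map_mul, map_mul, eeVal_ofBB] at this

/-- The images in `E / (μ ⊗ 1)` of the elements `j / ([p]_q ⊗ 1)` for the generators `j` of `J`. -/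
def genY : Set (EM p κ d S) :=
  {y | ∃ j ∈ genJ p κ d S, ∃ x, ofBB p κ d S (i1 p κ S (pQ p S)) * x = ofBB p κ d S j ∧
    mkE p κ d S x = y}

theorem p_mul_mkE {j : BB p κ S} {x : EE p κ d S}
    (h : ofBB p κ d S (i1 p κ S (pQ p S)) * x = ofBB p κ d S j) :
    (p : EM p κ d S) * mkE p κ d S x = eB p κ d S j := by
  rw [← e1_pQ p κ d S, eB, RingHom.comp_apply, ← h, map_mul]
  rfl

/-- The quotient `E / (μ ⊗ 1)` is generated, as a `δ`-ring over the completed tensor product, by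
the elements `j / ([p]_q ⊗ 1)`. -/
theorem em_generated (V : Subring (EM p κ d S)) (hB : (eB p κ d S).range ≤ V)
    (hY : genY p κ d S ⊆ V) (hδ : ∀ x ∈ V, (emDelta p κ d S).δ x ∈ V) : V = ⊤ := by
  -- The preimage of `V` in E, placed in the localization; minimality of `env` reduces the claim to
  -- `IsEnv` for it.
  let T : Subalgebra (BB p κ S) (LE p κ d S) :=
    { (V.comap (mkE p κ d S)).map (eeVal p κ d S) with
      algebraMap_mem' := fun b => ⟨ofBB p κ d S b, hB ⟨b, rfl⟩, eeVal_ofBB p κ d S b⟩ }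
  have hmem : ∀ x : LE p κ d S, x ∈ T ↔ ∃ e, mkE p κ d S e ∈ V ∧ eeVal p κ d S e = x :=
    fun x => Iff.rfl
  have hT : IsEnv p (frobBB p κ d S) (i1 p κ S (pQ p S)) (idJ p κ d S) T := by
    constructor
    · intro j hj y hy
      -- For general `j ∈ J` the quotient is a linear combination, over the completed tensor
      -- product, of the quotients of the generators of `J`.
      have h1 : ∃ e, ofBB p κ d S (i1 p κ S (pQ p S)) * e = ofBB p κ d S j ∧
          mkE p κ d S e ∈ V := by
        have hj' : j ∈ Submodule.span (BB p κ S) (genJ p κ d S) := hj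
        induction hj' using Submodule.span_induction generalizing y with
        | mem j hgen =>
          obtain ⟨e, he⟩ := exists_div p κ d S j hj
          exact ⟨e, he, hY ⟨j, hgen, e, he, rfl⟩⟩
        | zero => exact ⟨0, by rw [mul_zero, map_zero], by rw [map_zero]; exact V.zero_mem⟩
        | add a b ha hb h1 h2 =>
          obtain ⟨y1, hy1⟩ := exists_div p κ d S a ha
          obtain ⟨y2, hy2⟩ := exists_div p κ d S b hb
          obtain ⟨e, he, heV⟩ := h1 ha (eeVal p κ d S y1) (congrArg (eeVal p κ d S) hy1)
          obtain ⟨e', he', heV'⟩ := h2 hb (eeVal p κ d S y2) (congrArg (eeVal p κ d S) hy2)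
          exact ⟨e + e', by rw [mul_add, he, he', map_add], by
            rw [map_add]; exact V.add_mem heV heV'⟩
        | smul c a ha h1 =>
          obtain ⟨y1, hy1⟩ := exists_div p κ d S a ha
          obtain ⟨e, he, heV⟩ := h1 ha (eeVal p κ d S y1) (congrArg (eeVal p κ d S) hy1)
          refine ⟨ofBB p κ d S c * e, by rw [mul_left_comm, he, smul_eq_mul, map_mul], ?_⟩
          rw [map_mul]
          exact V.mul_mem (hB ⟨c, rfl⟩) heV
      obtain ⟨e, he, heV⟩ := h1
      refine ⟨e, heV, (isUnit_D_LE p κ d S).mul_left_cancel ?_⟩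
      exact (congrArg (eeVal p κ d S) he).trans hy.symm
    · rintro _ ⟨e, he, rfl⟩ y hy
      refine ⟨(eeDelta p κ d S).δ e, ?_, (isUnit_p_LE p κ d S).mul_left_cancel ?_⟩
      · change mkE p κ d S _ ∈ V
        rw [← emDelta_δ]
        exact hδ _ he
      · have h1 := congrArg (eeVal p κ d S) ((eeDelta p κ d S).φ_eq e)
        rw [eeDelta_φ, eeVal_frobEE, map_add, map_pow, map_mul, map_natCast] at h1
        refine Eq.trans ?_ hy.symm
        change _ = _ - (eeVal p κ d S e) ^ p
        rw [show envLFrob p (frobBB p κ d S) (i1 p κ S (pQ p S)) ((eeVal p κ d S : _ →+* _) e) = _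
          from h1]
        ring
  have hle : env p (frobBB p κ d S) (i1 p κ S (pQ p S)) (idJ p κ d S) ≤ T := sInf_le hT
  refine eq_top_iff.mpr fun x _ => ?_
  obtain ⟨e, rfl⟩ := mkE_surjective p κ d S x
  obtain ⟨e', he', h⟩ := hle e.2
  rwa [← eeVal_injective p κ d S h]

end Source

/-! ### Divided powers span E/(μ ⊗ 1) modulo p. -/

section Generation

open PowerSeries

variable (p : ℕ) [hp : Fact p.Prime] (κ : Type u) [Field κ] [CharP κ p] [PerfectRing κ p] (d : ℕ)
  (S : Type v) [CommRing S] [Algebra (WittVector p κ) S]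
  [Algebra (RSq p κ d) S] [Algebra.Etale (RSq p κ d) S]
  [IsScalarTower (WittVector p κ) (RSq p κ d) S]

/-- An element `x` of `E / (μ ⊗ 1)` with `p x = 1 ⊗ μ ^ (p - 1)` and `p ∣ φ(x)`. -/
theorem exists_xE : ∃ x k : EM p κ d S, (p : EM p κ d S) * x = e2 p κ d S (X ^ (p - 1)) ∧
    (emDelta p κ d S).φ x = p * k ∧ (∃ u, ∀ y, ofBB p κ d S (i1 p κ S (pQ p S)) * y =
      ofBB p κ d S (i2 p κ S (pQ p S)) → mkE p κ d S y = x + e2 p κ d S u) ∧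
    ∃ a, k = x * e2 p κ d S a + (p : EM p κ d S) ^ (p - 2) * x ^ p := by
  obtain ⟨u, hu⟩ := exists_pQ_eq p S
  obtain ⟨y, hy⟩ := exists_div p κ d S (i2 p κ S (pQ p S))
    (Ideal.subset_span (Or.inl (Or.inr rfl)))
  set D := emDelta p κ d S with hD
  -- Modulo μ ⊗ 1 the element `y` is a quotient of `[p]_q = p u + μ ^ (p - 1)` by `p`; removing `u`
  -- leaves a quotient of `μ ^ (p - 1)`.
  set x := mkE p κ d S y - e2 p κ d S u with hx
  have hpx : (p : EM p κ d S) * x = e2 p κ d S (X ^ (p - 1)) := by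
    have h1 : eB p κ d S (i2 p κ S (pQ p S)) = e2 p κ d S (pQ p S) := rfl
    rw [hx, mul_sub, p_mul_mkE p κ d S hy, h1, hu, map_add, map_mul, map_natCast]
    ring
  obtain ⟨w, hw⟩ := sub_dvd_pow_sub_pow (pQ p S) (X ^ (p - 1)) (p - 1)
  -- φ(μ^(p-1)) = μ^(p-1) [p]_q^(p-1) with [p]_q ≡ μ^(p-1) modulo p, so δ(μ^(p-1)) is again a
  -- multiple of μ^(p-1), that is, of `p x`.
  have hfrob : frobA p κ d S (X ^ (p - 1)) =
      (X ^ (p - 1)) ^ p + (p : AA p S) * (X ^ (p - 1) * (u * w)) := by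
    have h2 : pQ p S ^ (p - 1) = (X ^ (p - 1)) ^ (p - 1) + (p : AA p S) * (u * w) := by
      have : pQ p S - X ^ (p - 1) = (p : AA p S) * u := by rw [hu]; ring
      rw [this] at hw
      linear_combination hw
    have h3 : ((X : AA p S) ^ (p - 1)) ^ p = X ^ (p - 1) * (X ^ (p - 1)) ^ (p - 1) := by
      rw [← pow_succ', Nat.sub_add_cancel hp.out.one_lt.le]
    rw [map_pow, ← X_mul_pQ, mul_pow, h2, h3]
    ring
  refine ⟨x, x * e2 p κ d S (u * w) + (p : EM p κ d S) ^ (p - 2) * x ^ p, hpx, ?_,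
    ⟨u, fun y' hy' => ?_⟩, u * w, rfl⟩
  -- `φ x` is read off from `δ (p x)`, the known δ(μ^(p-1)), so `p` is never cancelled.
  · have h4 := D.δ_p_mul x
    rw [hpx, hD, emδ_e2 p κ d S hfrob, map_mul, ← hpx] at h4
    have hpow : (p : EM p κ d S) ^ (p - 1) = p * p ^ (p - 2) := by
      rw [← pow_succ']
      congr 1
      have := hp.out.two_le
      omega
    rw [hpow] at h4
    linear_combination -h4
  · rw [div_unique p κ d S (hy'.trans hy.symm), hx, sub_add_cancel]

/-- The element `(μ ^ (p - 1) / p)` of `E / (μ ⊗ 1)`. -/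
def xE0 : EM p κ d S := (exists_xE p κ d S).choose

/-- The quotient `φ(μ ^ (p - 1) / p) / p`. -/
def kE0 : EM p κ d S := (exists_xE p κ d S).choose_spec.choose

theorem p_mul_xE0 : (p : EM p κ d S) * xE0 p κ d S = e2 p κ d S (X ^ (p - 1)) :=
  (exists_xE p κ d S).choose_spec.choose_spec.1

theorem φ_xE0 : (emDelta p κ d S).φ (xE0 p κ d S) = p * kE0 p κ d S :=
  (exists_xE p κ d S).choose_spec.choose_spec.2.1

theorem mkE_div_pQ : ∃ u, ∀ y, ofBB p κ d S (i1 p κ S (pQ p S)) * y =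
      ofBB p κ d S (i2 p κ S (pQ p S)) → mkE p κ d S y = xE0 p κ d S + e2 p κ d S u :=
  (exists_xE p κ d S).choose_spec.choose_spec.2.2.1

theorem kE0_eq : ∃ a, kE0 p κ d S =
    xE0 p κ d S * e2 p κ d S a + (p : EM p κ d S) ^ (p - 2) * xE0 p κ d S ^ p :=
  (exists_xE p κ d S).choose_spec.choose_spec.2.2.2

theorem exists_zEE (r : RR p S) : ∃ z, ofBB p κ d S (i1 p κ S (pQ p S)) * z =
    ofBB p κ d S (i1 p κ S (frobA p κ d S (C r)) - i2 p κ S (frobA p κ d S (C r))) :=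
  exists_div p κ d S _ (Ideal.subset_span (Or.inr ⟨r, rfl⟩))

/-- The element `(φ(r) ⊗ 1 - 1 ⊗ φ(r)) / ([p]_q ⊗ 1)` of `E`. -/
def zEE (r : RR p S) : EE p κ d S := (exists_zEE p κ d S r).choose

theorem mul_zEE (r : RR p S) : ofBB p κ d S (i1 p κ S (pQ p S)) * zEE p κ d S r =
    ofBB p κ d S (i1 p κ S (frobA p κ d S (C r)) - i2 p κ S (frobA p κ d S (C r))) :=
  (exists_zEE p κ d S r).choose_spec

theorem zEE_add (r s : RR p S) : zEE p κ d S (r + s) = zEE p κ d S r + zEE p κ d S s := by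
  refine div_unique p κ d S ?_
  rw [mul_add, mul_zEE, mul_zEE, mul_zEE]
  simp only [map_add, map_sub]
  ring

/-- Twisted Leibniz rule for the difference of two ring homomorphisms. Modulo `p` the two agree
(`mkQ_e1_frobA`), and `zEE` becomes a derivation. -/
theorem zEE_mul (r s : RR p S) : zEE p κ d S (r * s) =
    ofBB p κ d S (i1 p κ S (frobA p κ d S (C r))) * zEE p κ d S s +
      zEE p κ d S r * ofBB p κ d S (i2 p κ S (frobA p κ d S (C s))) := by
  refine div_unique p κ d S ?_
  rw [mul_add, mul_left_comm, ← mul_assoc _ (zEE p κ d S r), mul_zEE, mul_zEE, mul_zEE]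
  simp only [map_mul, map_sub]
  ring

theorem zEE_W (a : WittVector p κ) : zEE p κ d S (algebraMap _ _ a) = 0 := by
  refine div_unique p κ d S ?_
  rw [mul_zEE, ← algebraMap_AA, frobA_algebraMap, e1_W p κ S, sub_self, map_zero, mul_zero]

theorem p_mul_zEE (r : RR p S) : (p : EM p κ d S) * mkE p κ d S (zEE p κ d S r) =
    e1 p κ d S (frobA p κ d S (C r)) - e2 p κ d S (frobA p κ d S (C r)) := by
  rw [p_mul_mkE p κ d S (mul_zEE p κ d S r), map_sub]
  rfl

/-- The element `Tᵢ` of `E / (μ ⊗ 1)`. -/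
def tE0 (i : Fin d) : EM p κ d S :=
  e2 p κ d S (C (rX p κ d S i : RR p S)) - e1 p κ d S (C (rX p κ d S i : RR p S))

/-- φ(Tᵢ) = 1 ⊗ φ(Xᵢ) − φ(Xᵢ) ⊗ 1, and [p]_q ⊗ 1 has become `p`. This is the input that starts
`divSeq`. -/
theorem φ_tE0 (i : Fin d) : (emDelta p κ d S).φ (tE0 p κ d S i) =
    p * -mkE p κ d S (zEE p κ d S (rX p κ d S i : RR p S)) := by
  rw [mul_neg, p_mul_zEE, tE0, map_sub, emφ_e1, emφ_e2]
  ring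

/-- The iterated divided powers of `μ ^ (p - 1) / p` in `E / (μ ⊗ 1)`. -/
def xE (n : ℕ) : EM p κ d S := ((emDelta p κ d S).divSeq (xE0 p κ d S) (kE0 p κ d S) n).1

/-- The iterated divided powers of `Tᵢ` in `E / (μ ⊗ 1)`. -/
def tE (i : Fin d) (n : ℕ) : EM p κ d S := ((emDelta p κ d S).divSeq (tE0 p κ d S i)
  (-mkE p κ d S (zEE p κ d S (rX p κ d S i : RR p S))) n).1

theorem isPSeq_xE : IsPSeq p (xE p κ d S) := (emDelta p κ d S).isPSeq_divSeq (φ_xE0 p κ d S)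

theorem isPSeq_tE (i : Fin d) : IsPSeq p (tE p κ d S i) :=
  (emDelta p κ d S).isPSeq_divSeq (φ_tE0 p κ d S i)

/-- The subring of `E / (μ ⊗ 1)` spanned over the second factor by the divided powers. -/
abbrev uE : Subring (EM p κ d S) :=
  pdSpan p (e2 p κ d S) (xE p κ d S) (tE p κ d S) (isPSeq_xE p κ d S) (isPSeq_tE p κ d S)

/-- The subring of `E / (μ ⊗ 1)` spanned over the second factor by the divided powers and by the
multiples of `p`. -/
abbrev vE : Subring (EM p κ d S) := DeltaStruct.addPMul p (uE p κ d S) ⊤ le_top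

theorem uE_le : uE p κ d S ≤ vE p κ d S := fun u hu => ⟨u, hu, 0, trivial, by simp⟩

theorem p_mul_mem_vE (a : EM p κ d S) : (p : EM p κ d S) * a ∈ vE p κ d S :=
  ⟨0, Subring.zero_mem _, a, trivial, by simp⟩

theorem e2_mem_vE (a : AA p S) : e2 p κ d S a ∈ vE p κ d S :=
  uE_le p κ d S (map_mem_pdSpan p _ a)

/-- The projection to the quotient of `E / (μ ⊗ 1)` by `p`. -/
abbrev mkQ : EM p κ d S →+* EM p κ d S ⧸ Ideal.span {(p : EM p κ d S)} := Ideal.Quotient.mk _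

theorem mkQ_p_mul (a : EM p κ d S) : mkQ p κ d S (p * a) = 0 :=
  Ideal.Quotient.eq_zero_iff_mem.mpr (Ideal.mul_mem_right _ _ (Ideal.mem_span_singleton_self _))

theorem mem_vE_of_mkQ {x : EM p κ d S} (h : mkQ p κ d S x ∈ (vE p κ d S).map (mkQ p κ d S)) :
    x ∈ vE p κ d S := by
  obtain ⟨y, hy, hxy⟩ := h
  obtain ⟨c, hc⟩ := Ideal.mem_span_singleton.mp (Ideal.Quotient.eq.mp hxy.symm)
  rw [sub_eq_iff_eq_add'.mp hc]
  exact Subring.add_mem _ hy (p_mul_mem_vE p κ d S c)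

theorem mkQ_e1_frobA (r : RR p S) : mkQ p κ d S (e1 p κ d S (frobA p κ d S (C r))) =
    mkQ p κ d S (e2 p κ d S (frobA p κ d S (C r))) := by
  rw [← sub_eq_zero, ← map_sub, ← p_mul_zEE, mkQ_p_mul]

/-- Modulo `p`, φ(r) ⊗ 1 and 1 ⊗ φ(r) agree, so r ⊗ 1 − 1 ⊗ r has vanishing `p`-th power. Hence
`mem_of_etale` reduces the claim to the coordinates, where Xᵢ ⊗ 1 = 1 ⊗ Xᵢ − Tᵢ. -/
theorem e1_C_mem_vE (r : RR p S) : e1 p κ d S (C r) ∈ vE p κ d S := by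
  have h0 : ((p : EM p κ d S ⧸ Ideal.span {(p : EM p κ d S)})) = 0 := quot_natCast_eq_zero _ p
  refine mem_vE_of_mkQ p κ d S (mem_of_etale p κ d S h0
    ((vE p κ d S).map (mkQ p κ d S)) ((mkQ p κ d S).comp ((e1 p κ d S).comp C)) ((mkQ p κ d S).comp ((e2 p κ d S).comp C))
    (fun r => ⟨_, e2_mem_vE p κ d S (C r), rfl⟩) (fun a => ?_) (fun i => ?_) (fun r => ⟨p, ?_⟩) r)
  · simp only [RingHom.comp_apply]
    rw [← algebraMap_AA, e1, RingHom.comp_apply, e1_W]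
    rfl
  · refine ⟨e2 p κ d S (C (rX p κ d S i : RR p S)) - tE0 p κ d S i, ?_, ?_⟩
    · exact Subring.sub_mem _ (e2_mem_vE p κ d S _) (uE_le p κ d S (t_mem_pdSpan p _ i 0))
    · rw [tE0, sub_sub_cancel]
      rfl
  · obtain ⟨c, hc⟩ := exists_frobA_eq p κ d S (C r)
    have h := mkQ_e1_frobA p κ d S r
    rw [hc] at h
    simp only [map_add, map_mul, map_natCast, map_pow, h0, zero_mul, add_zero] at h
    have h1 := map_sub (absFrob p h0) (mkQ p κ d S (e1 p κ d S (C r)))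
      (mkQ p κ d S (e2 p κ d S (C r)))
    simp only [absFrob_apply] at h1
    exact h1.trans (sub_eq_zero.mpr h)

theorem eB_range_le : (eB p κ d S).range ≤ vE p κ d S := by
  rintro _ ⟨b, rfl⟩
  obtain ⟨t, c, h⟩ := exists_eB_eq p κ d S b
  rw [h]
  refine Subring.add_mem _ (eB_ofTT_mem p κ d S _ (fun a => ?_) (e2_mem_vE p κ d S) t)
    (p_mul_mem_vE p κ d S _)
  rw [e1_eq]
  exact e1_C_mem_vE p κ d S _

theorem δ_e2_mem (a : AA p S) : (emDelta p κ d S).δ (e2 p κ d S a) ∈ vE p κ d S := by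
  obtain ⟨c, hc⟩ := exists_frobA_eq p κ d S a
  rw [emδ_e2 p κ d S hc]
  exact e2_mem_vE p κ d S c

/-- The term after `Tᵢ` in its divided power sequence is minus this element minus δ(Tᵢ), and δ(Tᵢ)
comes from the completed tensor product. -/
theorem zEE_rX_mem (i : Fin d) :
    mkE p κ d S (zEE p κ d S (rX p κ d S i : RR p S)) ∈ vE p κ d S := by
  have h : tE p κ d S i 1 = -mkE p κ d S (zEE p κ d S (rX p κ d S i : RR p S)) -
    (emDelta p κ d S).δ (tE0 p κ d S i) := rfl
  have h1 : (emDelta p κ d S).δ (tE0 p κ d S i) ∈ vE p κ d S :=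
    eB_range_le p κ d S (eB_range_δ p κ d S _ ⟨i2 p κ S _ - i1 p κ S _, by rw [map_sub]; rfl⟩)
  have h2 : mkE p κ d S (zEE p κ d S (rX p κ d S i : RR p S)) =
      -(tE p κ d S i 1 + (emDelta p κ d S).δ (tE0 p κ d S i)) := by
    rw [h]
    ring
  rw [h2]
  exact Subring.neg_mem _ (Subring.add_mem _ (uE_le p κ d S (t_mem_pdSpan p _ i 1)) h1)

/-- The elements of the dual numbers over a ring with both components in a subring. -/
def dualSubring {Q : Type*} [CommRing Q] (V : Subring Q) : Subring (DualNumber Q) where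
  carrier := {x | TrivSqZeroExt.fst x ∈ V ∧ TrivSqZeroExt.snd x ∈ V}
  one_mem' := ⟨V.one_mem, V.zero_mem⟩
  zero_mem' := ⟨V.zero_mem, V.zero_mem⟩
  add_mem' := fun hx hy => ⟨V.add_mem hx.1 hy.1, V.add_mem hx.2 hy.2⟩
  neg_mem' := fun hx => ⟨V.neg_mem hx.1, V.neg_mem hx.2⟩
  mul_mem' := fun hx hy => ⟨V.mul_mem hx.1 hy.1,
    V.add_mem (V.mul_mem hx.1 hy.2) (V.mul_mem hx.2 hy.1)⟩

/-- The homomorphism `r ↦ f(r) + ε z(r)` to the dual numbers defined by a derivation `z`. -/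
def dualHom {R Q : Type*} [CommRing R] [CommRing Q] (f : R →+* Q) (z : R → Q) (h1 : z 1 = 0)
    (hadd : ∀ r s, z (r + s) = z r + z s) (hmul : ∀ r s, z (r * s) = f r * z s + z r * f s) :
    R →+* DualNumber Q where
  toFun r := (f r, z r)
  map_one' := Prod.ext (map_one f) h1
  map_zero' := Prod.ext (map_zero f) (show z 0 = 0 by simpa using hadd 0 0)
  map_add' r s := Prod.ext (map_add f r s) (hadd r s)
  map_mul' r s := Prod.ext (map_mul f r s) (hmul r s)

/-- A derivation on `R`, vanishing on `W(κ)`, with values in a ring in which `p = 0` takes values in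
any subring containing its values on the coordinates and the image of `R`. -/
theorem derivation_mem_of_etale {Q : Type*} [CommRing Q] (hQ : (p : Q) = 0) (V : Subring Q)
    (f : RR p S →+* Q) (z : RR p S → Q) (hadd : ∀ r s, z (r + s) = z r + z s)
    (hmul : ∀ r s, z (r * s) = f r * z s + z r * f s)
    (hW : ∀ a : WittVector p κ, z (algebraMap _ _ a) = 0) (hf : ∀ r, f r ∈ V)
    (hX : ∀ i, z (rX p κ d S i : RR p S) ∈ V) (r : RR p S) : z r ∈ V := by
  have hQ' : (p : DualNumber Q) = 0 := by
    rw [← map_natCast (TrivSqZeroExt.inlHom Q Q), hQ, map_zero]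
  -- `r ↦ f r + ε z r` and `r ↦ f r` are ring homomorphisms with square-zero difference, so
  -- `mem_of_etale` applies to them.
  let F := dualHom f z (by simpa using hW 1) hadd hmul
  let G := dualHom f 0 rfl (fun _ _ => (add_zero _).symm) (fun r s => by simp)
  have hFG : ∀ r, F r - G r = TrivSqZeroExt.inr (z r) := fun r =>
    TrivSqZeroExt.ext (sub_self _) (sub_zero _)
  have h1 : ∀ r, G r ∈ dualSubring V := fun r => ⟨hf r, V.zero_mem⟩
  have h2 : ∀ i, F (rX p κ d S i : RR p S) ∈ dualSubring V := fun i => ⟨hf _, hX i⟩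
  have hFW : ∀ a : WittVector p κ, F (algebraMap _ _ a) = G (algebraMap _ _ a) := fun a =>
    TrivSqZeroExt.ext rfl (hW a)
  have hnil : ∀ r, IsNilpotent (F r - G r) := fun r =>
    ⟨2, by rw [hFG, pow_two, TrivSqZeroExt.inr_mul_inr]⟩
  have h : F r ∈ dualSubring V := mem_of_etale p κ d S hQ' (dualSubring V) F G h1 hFW h2 hnil r
  exact h.2

/-- Modulo `p` this is a derivation over r ↦ 1 ⊗ φ(r), so its values on coordinates, settled by
`zEE_rX_mem`, decide. -/
theorem zEE_mem_vE (r : RR p S) : mkE p κ d S (zEE p κ d S r) ∈ vE p κ d S := by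
  refine mem_vE_of_mkQ p κ d S (derivation_mem_of_etale p κ d S (quot_natCast_eq_zero _ p)
    ((vE p κ d S).map (mkQ p κ d S))
    ((mkQ p κ d S).comp ((e2 p κ d S).comp ((frobA p κ d S).comp C)))
    (fun r => mkQ p κ d S (mkE p κ d S (zEE p κ d S r))) (fun r s => ?_) (fun r s => ?_)
    (fun a => ?_) (fun r => ⟨_, e2_mem_vE p κ d S _, rfl⟩)
    (fun i => ⟨_, zEE_rX_mem p κ d S i, rfl⟩) r)
  · simp only [zEE_add, map_add]
  · change mkQ p κ d S (mkE p κ d S _) = mkQ p κ d S (e2 p κ d S (frobA p κ d S (C r))) * _ + _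
    rw [zEE_mul, map_add, map_add, map_mul, map_mul, map_mul, map_mul, ← mkQ_e1_frobA]
    rfl
  · simp only [zEE_W, map_zero]

/-- The quotients of the three kinds of generators are 1, μ^(p-1)/p plus an element of the second
factor, and the `zEE r`. -/
theorem genY_subset : genY p κ d S ⊆ vE p κ d S := by
  rintro _ ⟨j, (rfl | rfl) | ⟨r, rfl⟩, x, hx, rfl⟩
  · rw [div_unique p κ d S (hx.trans (mul_one _).symm), map_one]
    exact Subring.one_mem _
  · obtain ⟨u, hu⟩ := mkE_div_pQ p κ d S
    rw [hu x hx]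
    exact Subring.add_mem _ (uE_le p κ d S (x_mem_pdSpan p _ 0)) (e2_mem_vE p κ d S u)
  · rw [div_unique p κ d S (hx.trans (mul_zEE p κ d S r).symm)]
    exact zEE_mem_vE p κ d S r

theorem divSeq_snd_mem {x k : EM p κ d S} (hk : k ∈ vE p κ d S) (n : ℕ) :
    ((emDelta p κ d S).divSeq x k n).2 ∈ vE p κ d S := by
  induction n with
  | zero => exact hk
  | succ n ih =>
    exact Subring.mul_mem _ (Subring.pow_mem _ (natCast_mem _ p) _) (Subring.pow_mem _ ih _)

/-- By the recursion, δ(xₙ) = kₙ − xₙ₊₁: δ of a divided power is controlled by the next one. -/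
theorem δ_divSeq_mem {x k : EM p κ d S} (hk : k ∈ vE p κ d S)
    (hx : ∀ n, ((emDelta p κ d S).divSeq x k n).1 ∈ vE p κ d S) (n : ℕ) :
    (emDelta p κ d S).δ ((emDelta p κ d S).divSeq x k n).1 ∈ vE p κ d S := by
  have h : ((emDelta p κ d S).divSeq x k (n + 1)).1 = ((emDelta p κ d S).divSeq x k n).2 -
    (emDelta p κ d S).δ ((emDelta p κ d S).divSeq x k n).1 := rfl
  rw [← sub_sub_cancel ((emDelta p κ d S).divSeq x k n).2 ((emDelta p κ d S).δ _), ← h]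
  exact Subring.sub_mem _ (divSeq_snd_mem p κ d S hk n) (hx _)

theorem δ_uE_mem (u : EM p κ d S) (hu : u ∈ uE p κ d S) :
    (emDelta p κ d S).δ u ∈ vE p κ d S := by
  have hle : uE p κ d S ≤ (emDelta p κ d S).subring (vE p κ d S) (vE p κ d S) le_rfl := by
    refine pdSpan_le p _ _ (fun a => ⟨e2_mem_vE p κ d S a, δ_e2_mem p κ d S a⟩)
      (fun n => ⟨uE_le p κ d S (x_mem_pdSpan p _ n), ?_⟩)
      (fun i n => ⟨uE_le p κ d S (t_mem_pdSpan p _ i n), ?_⟩)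
    · refine δ_divSeq_mem p κ d S ?_ (fun n => uE_le p κ d S (x_mem_pdSpan p _ n)) n
      obtain ⟨a, ha⟩ := kE0_eq p κ d S
      have hx0 : xE0 p κ d S ∈ vE p κ d S := uE_le p κ d S (x_mem_pdSpan p _ 0)
      rw [ha]
      exact Subring.add_mem _ (Subring.mul_mem _ hx0 (e2_mem_vE p κ d S a))
        (Subring.mul_mem _ (Subring.pow_mem _ (natCast_mem _ p) _) (Subring.pow_mem _ hx0 _))
    · exact δ_divSeq_mem p κ d S (Subring.neg_mem _ (zEE_mem_vE p κ d S _))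
        (fun n => uE_le p κ d S (t_mem_pdSpan p _ i n)) n
  exact (hle hu).2

/-- Modulo `p`, the quotient `E / (μ ⊗ 1)` is spanned over the second factor by the divided
powers. -/
theorem exists_uE_add (x : EM p κ d S) : ∃ u ∈ uE p κ d S, ∃ a, x = u + p * a := by
  have hV : ∀ x ∈ vE p κ d S, ∃ u ∈ uE p κ d S, ∃ a, x = u + p * a :=
    fun x ⟨u, hu, a, _, h⟩ => ⟨u, hu, a, h⟩
  -- The δ-subring `B` is the image of the completed tensor product; the generators `y` are
  -- quotients by [p]_q ⊗ 1, so `p y ∈ B`, which is the goal left over.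
  refine (emDelta p κ d S).eq_top_of_generated (eB p κ d S).range (genY p κ d S)
    (eB_range_δ p κ d S) ?_ (em_generated p κ d S) _
    (fun b hb => hV b (eB_range_le p κ d S hb)) (fun b hb => hV b (genY_subset p κ d S hb))
    (fun u hu => hV _ (δ_uE_mem p κ d S u hu)) x
  rintro _ ⟨j, -, y, hy, rfl⟩
  exact ⟨j, (p_mul_mkE p κ d S hy).symm⟩

end Generation

/-! ### Bijectivity modulo p and the isomorphism. -/

section Comparison

open PowerSeries

variable (p : ℕ) [hp : Fact p.Prime] (κ : Type u) [Field κ] [CharP κ p] [PerfectRing κ p] (d : ℕ)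
  (S : Type v) [CommRing S] [Algebra (WittVector p κ) S]
  [Algebra (RSq p κ d) S] [Algebra.Etale (RSq p κ d) S]
  [IsScalarTower (WittVector p κ) (RSq p κ d) S]

/-- The comparison map on `E / (μ ⊗ 1)`. -/
def emHat : EM p κ d S →+* PDhat p d S :=
  Ideal.Quotient.lift _ (eeHat p κ d S) fun x hx => by
    obtain ⟨c, rfl⟩ := Ideal.mem_span_singleton.mp hx
    rw [map_mul, eeHat_ofBB, bbHat_i1, hatL_X, zero_mul]

theorem emHat_mkE (x : EE p κ d S) : emHat p κ d S (mkE p κ d S x) = eeHat p κ d S x :=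
  Ideal.Quotient.lift_mk _ _ _

theorem emHat_e1 (a : AA p S) : emHat p κ d S (e1 p κ d S a) = hatL p κ d S a := by
  rw [e1, RingHom.comp_apply, eB, RingHom.comp_apply, emHat_mkE, eeHat_ofBB, bbHat_i1]

theorem emHat_e2 (a : AA p S) : emHat p κ d S (e2 p κ d S a) = ofPD p d S (pdA p d S a) := by
  rw [e2, RingHom.comp_apply, eB, RingHom.comp_apply, emHat_mkE, eeHat_ofBB, bbHat_i2]
  rfl

/-- Sequences with `sₙ ^ p = p sₙ₊₁` in a `p`-torsion free ring are determined by `s₀`. -/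
theorem IsPSeq.eq_of_zero_eq {T : Type*} [CommRing T] (hT : ∀ x : T, (p : T) * x = 0 → x = 0)
    {s t : ℕ → T} (hs : IsPSeq p s) (ht : IsPSeq p t) (h : s 0 = t 0) (n : ℕ) : s n = t n := by
  induction n with
  | zero => exact h
  | succ n ih =>
    refine sub_eq_zero.mp (hT _ ?_)
    rw [mul_sub, ← hs n, ← ht n, ih, sub_self]

theorem IsPSeq.map {T T' : Type*} [CommRing T] [CommRing T'] (f : T →+* T') {s : ℕ → T}
    (hs : IsPSeq p s) : IsPSeq p fun n => f (s n) := fun n => by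
  rw [← map_pow, hs n, map_mul, map_natCast]

/-- `PDhat` is `p`-torsion free, so only the first terms have to be compared, and `p` times either
one is μ^(p-1). -/
theorem emHat_xE (n : ℕ) : emHat p κ d S (xE p κ d S n) = ofPD p d S (xPD p κ d S n) := by
  refine IsPSeq.eq_of_zero_eq p (pdhat_torsionFree p d S)
    (IsPSeq.map p (emHat p κ d S) (isPSeq_xE p κ d S))
    (IsPSeq.map p (ofPD p d S) (isPSeq_xPD p κ d S)) ?_ n
  refine sub_eq_zero.mp (pdhat_torsionFree p d S _ ?_)
  have h1 := congrArg (emHat p κ d S) (p_mul_xE0 p κ d S)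
  have h2 := congrArg (ofPD p d S) (p_mul_xPD p κ d S)
  rw [map_mul, map_natCast, emHat_e2] at h1
  rw [map_mul, map_natCast, ← map_pow] at h2
  rw [mul_sub, h2]
  exact sub_eq_zero.mpr h1

theorem emHat_tE (i : Fin d) (n : ℕ) :
    emHat p κ d S (tE p κ d S i n) = ofPD p d S (tPD p κ d S i n) := by
  refine IsPSeq.eq_of_zero_eq p (pdhat_torsionFree p d S)
    (IsPSeq.map p (emHat p κ d S) (isPSeq_tE p κ d S i))
    (IsPSeq.map p (ofPD p d S) (isPSeq_tPD p κ d S i)) ?_ n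
  change emHat p κ d S (tE0 p κ d S i) = ofPD p d S (pdT p d S i)
  rw [tE0, map_sub, emHat_e1, emHat_e2, hatL_C, hatR_rX, hatXT, map_sub, sub_sub_cancel]

theorem emHat_sum (c : (ℕ × (Fin d →₀ ℕ)) →₀ AA p S) :
    emHat p κ d S (c.sum fun k a => e2 p κ d S a * pdMon p (xE p κ d S) (tE p κ d S) k) =
      ofPD p d S (c.sum fun k a => pdA p d S a * pdMon p (xPD p κ d S) (tPD p κ d S) k) := by
  rw [map_finsuppSum, map_finsuppSum]
  refine Finsupp.sum_congr fun k _ => ?_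
  rw [map_mul, map_mul, emHat_e2, map_pdMon, map_pdMon]
  simp only [emHat_xE, emHat_tE]

theorem emHat_surjective_mod (y : PDhat p d S) : ∃ x z, y = emHat p κ d S x + p * z := by
  obtain ⟨a, z, rfl⟩ := exists_ofPD_add p d S y
  obtain ⟨c, rfl⟩ := exists_finsupp p (pdA p d S) (mem_pdSpan_PD p κ d S a)
  exact ⟨_, z, by rw [emHat_sum]⟩

/-- Injectivity modulo `p`: the spanning result writes `x` through monomials upstairs, and the
control of relations in the divided power algebra makes all coefficients divisible by `p`. -/
theorem exists_of_emHat_eq {x : EM p κ d S} {z : PDhat p d S} (h : emHat p κ d S x = p * z) :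
    ∃ y, x = p * y := by
  obtain ⟨u, hu, a, rfl⟩ := exists_uE_add p κ d S x
  obtain ⟨c, rfl⟩ := exists_finsupp p (e2 p κ d S) hu
  rw [map_add, map_mul, map_natCast, emHat_sum] at h
  obtain ⟨w, hw⟩ := p_dvd_of_ofPD p d S (z := z - emHat p κ d S a)
    (y := c.sum fun k a => pdA p d S a * pdMon p (xPD p κ d S) (tPD p κ d S) k)
    (by linear_combination h)
  obtain ⟨b, rfl⟩ := exists_finsupp p (pdA p d S) (mem_pdSpan_PD p κ d S w)
  -- The image of the monomial sum is `p w`; expanding `w` with coefficients `b` makes `c - p b` a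
  -- genuine relation.
  have hc := coeff_mem_of_sum_pdMon p κ d S (c - (p : AA p S) • b) (by
    rw [Finsupp.sum_sub_index (by intros; rw [map_sub, sub_mul]), hw,
      Finsupp.sum_smul_index (by intros; simp), Finsupp.mul_sum, sub_eq_zero]
    refine Finsupp.sum_congr fun k _ => ?_
    rw [map_mul, map_natCast, mul_assoc])
  -- In `EM` the ideal (p, μ^(p-1)) collapses to (p), since μ^(p-1) is `p` times `xE0`.
  have hdvd : ∀ k, (p : EM p κ d S) ∣ e2 p κ d S (c k) := fun k => by
    obtain ⟨a', b', h'⟩ := Ideal.mem_span_pair.mp (hc k)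
    have : c k = (p : AA p S) * (a' + b k) + b' * X ^ (p - 1) := by
      have h2 : (c - (p : AA p S) • b) k = c k - p * b k := rfl
      rw [h2] at h'
      linear_combination -h'
    rw [this, map_add, map_mul, map_mul, ← p_mul_xE0, map_natCast]
    exact dvd_add (dvd_mul_right _ _) ((dvd_mul_right _ _).mul_left _)
  exact dvd_add (Finset.dvd_sum fun k _ => (hdvd k).mul_right _) (dvd_mul_right _ _)

theorem exists_ofEE_add (x : A1 p κ d S) : ∃ (e : EE p κ d S) (a b : A1 p κ d S),
    x = ofEE p κ d S e + p * a + p1 p κ d S X * b := by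
  obtain ⟨e, he⟩ := exists_of_sub_mem (idEE_fg p κ d S) 1 x
  have he' : x - ofEE p κ d S e ∈ (idEE p κ d S).map (ofEE p κ d S) := by
    rw [pow_one] at he
    exact he
  rw [idEE, Ideal.map_span, Set.image_pair, map_natCast, Ideal.mem_span_pair] at he'
  obtain ⟨a, b, h⟩ := he'
  have hX : p1 p κ d S X = ofEE p κ d S (ofBB p κ d S (i1 p κ S X)) := rfl
  refine ⟨e, a, b, ?_⟩
  rw [hX]
  linear_combination -h

/-- Modulo (p, p₁(μ)) every element of A_R(1) comes from E, so the two statements modulo `p` about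
E/(μ ⊗ 1) are exactly what successive approximation needs. -/
theorem a1Hat_surjective_and_ker : Function.Surjective (a1Hat p κ d S) ∧
    RingHom.ker (a1Hat p κ d S) = Ideal.span {p1 p κ d S X} := by
  have : IsAdicComplete ((idEE p κ d S).map (ofEE p κ d S)) (A1 p κ d S) :=
    isAdicComplete_map (idEE_fg p κ d S)
  have := isHausdorff_natCast (PD p d S) p
  have hX : a1Hat p κ d S (p1 p κ d S X) = 0 := by rw [a1Hat_p1, hatL_X]
  refine surjective_and_ker_eq p ((idEE p κ d S).map (ofEE p κ d S)) ?_
    (pdhat_torsionFree p d S) _ _ hX (fun y => ?_) fun x z hxz => ?_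
  · rw [← map_natCast (ofEE p κ d S)]
    exact Ideal.mem_map_of_mem _ (Ideal.subset_span (Or.inl rfl))
  · obtain ⟨x, z, h⟩ := emHat_surjective_mod p κ d S y
    obtain ⟨e, rfl⟩ := mkE_surjective p κ d S x
    exact ⟨ofEE p κ d S e, z, by rw [h, emHat_mkE, a1Hat_ofEE]⟩
  · obtain ⟨e, a, b, rfl⟩ := exists_ofEE_add p κ d S x
    rw [map_add, map_add, map_mul, map_mul, hX, zero_mul, add_zero, map_natCast, a1Hat_ofEE,
      ← emHat_mkE] at hxz
    obtain ⟨y, hy⟩ := exists_of_emHat_eq p κ d S (z := z - a1Hat p κ d S a)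
      (x := mkE p κ d S e) (by linear_combination hxz)
    obtain ⟨y, rfl⟩ := mkE_surjective p κ d S y
    rw [← map_natCast (mkE p κ d S), ← map_mul] at hy
    obtain ⟨w, hw⟩ := Ideal.mem_span_singleton.mp (Ideal.Quotient.eq.mp hy)
    refine ⟨ofEE p κ d S y + a, ofEE p κ d S w + b, ?_⟩
    have hw' := congrArg (ofEE p κ d S) hw
    rw [map_sub, map_mul, map_mul, map_natCast] at hw'
    have hX' : ofEE p κ d S (mu1 p κ d S) = p1 p κ d S X := rfl
    rw [hX'] at hw'
    linear_combination hw'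

/-- The comparison isomorphism. -/
def a1ModEquiv : A1Mod p κ d S ≃+* PDhat p d S :=
  (Ideal.quotEquivOfEq (a1Hat_surjective_and_ker p κ d S).2.symm).trans
    (RingHom.quotientKerEquivOfSurjective (a1Hat_surjective_and_ker p κ d S).1)

theorem a1ModEquiv_mk (x : A1 p κ d S) :
    a1ModEquiv p κ d S (Ideal.Quotient.mk _ x) = a1Hat p κ d S x := rfl

theorem isAdicComplete_natCast_of_ringEquiv {A B : Type*} [CommRing A] [CommRing B]
    (e : A ≃+* B) (h : IsAdicComplete (Ideal.span {(p : B)}) B) :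
    IsAdicComplete (Ideal.span {(p : A)}) A := by
  rw [← IsAdicComplete.congr_ringEquiv (Ideal.span {(p : A)}) e, Ideal.map_span,
    Set.image_singleton, map_natCast]
  exact h

end Comparison

end WachPrism

end

theorem proposition2p7 (p : ℕ) [Fact p.Prime] (κ : Type*) [Field κ] [CharP κ p]
    [PerfectRing κ p] (d : ℕ) (S : Type*) [CommRing S] [Algebra (WittVector p κ) S]
    [Algebra (WachPrism.RSq p κ d) S]
    [IsScalarTower (WittVector p κ) (WachPrism.RSq p κ d) S]
    [Algebra.Etale (WachPrism.RSq p κ d) S]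
    (hconn : ConnectedSpace
      (PrimeSpectrum (WachPrism.RR p S ⧸ Ideal.span {(p : WachPrism.RR p S)}))) :
    -- both rings are `p`-adically complete and `p`-torsion free
    (IsAdicComplete (Ideal.span {(p : WachPrism.A1Mod p κ d S)}) (WachPrism.A1Mod p κ d S) ∧
      (p : WachPrism.A1Mod p κ d S) ∈ nonZeroDivisors (WachPrism.A1Mod p κ d S)) ∧
    (IsAdicComplete (Ideal.span {(p : WachPrism.PDhat p d S)}) (WachPrism.PDhat p d S) ∧
      (p : WachPrism.PDhat p d S) ∈ nonZeroDivisors (WachPrism.PDhat p d S)) ∧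
    ∃ α : WachPrism.A1Mod p κ d S ≃+* WachPrism.PDhat p d S,
      -- `α` is `A_R`-linear; in particular `p₂(μ) ↦ μ` and `p₂([Xᵢ^♭]) ↦ [Xᵢ^♭]`
      (∀ a : WachPrism.AA p S,
        α (WachPrism.p2Mod p κ d S a) = WachPrism.ofPD p d S (WachPrism.pdA p d S a)) ∧
      -- `p₁([Xᵢ^♭]) ↦ [Xᵢ^♭] - Tᵢ`
      (∀ i : Fin d,
        α (WachPrism.p1Mod p κ d S (PowerSeries.C (WachPrism.rX p κ d S i : WachPrism.RR p S))) =
          WachPrism.ofPD p d S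
            (WachPrism.pdA p d S
              (PowerSeries.C (WachPrism.rX p κ d S i : WachPrism.RR p S)) -
              WachPrism.pdT p d S i)) ∧
      -- `α` is `φ`-equivariant
      (∀ x, α (WachPrism.frobA1Mod p κ d S x) = WachPrism.frobPDhat p d S κ (α x)) ∧
      -- `α` is `Γ_R`-equivariant, where `Γ_R` acts on the source through `1 × Γ_R`
      (∀ (g : WachPrism.GammaR p d) (x),
        α (WachPrism.gammaA1Mod p κ d S g x) = WachPrism.gammaPDhat p d S κ g (α x)) := by
  -- Completeness and torsion freeness are known for `PDhat` and are carried back to the quotient of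
  -- A_R(1) along the isomorphism.
  have hc : IsAdicComplete (Ideal.span {(p : WachPrism.PDhat p d S)}) (WachPrism.PDhat p d S) :=
    WachPrism.isAdicComplete_natCast p
  have ht := WachPrism.pdhat_torsionFree p d S
  let α := WachPrism.a1ModEquiv p κ d S
  refine ⟨⟨WachPrism.isAdicComplete_natCast_of_ringEquiv p α hc, ?_⟩, ⟨hc, ?_⟩, α,
    fun a => ?_, fun i => ?_, fun x => ?_, fun g x => ?_⟩
  · rw [mem_nonZeroDivisors_iff_left]
    intro x hx
    refine α.injective ?_
    rw [map_zero]
    refine ht _ ?_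
    rw [← map_natCast α, ← map_mul, hx, map_zero]
  · exact mem_nonZeroDivisors_iff_left.mpr ht
  · exact (WachPrism.a1ModEquiv_mk p κ d S _).trans (WachPrism.a1Hat_p2 p κ d S a)
  · exact ((WachPrism.a1ModEquiv_mk p κ d S _).trans (WachPrism.a1Hat_p1 p κ d S _)).trans
      ((WachPrism.hatL_C p κ d S _).trans (WachPrism.hatR_rX p κ d S i))
  · obtain ⟨x, rfl⟩ := Ideal.Quotient.mk_surjective x
    exact WachPrism.a1Hat_frobA1 p κ d S x
  · obtain ⟨x, rfl⟩ := Ideal.Quotient.mk_surjective x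
    exact WachPrism.a1Hat_gammaA1 p κ d S g x
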